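/- An instance of Secluded Steiner Tree (with costs) consists of a finite simple graph $G$ with $n$ vertices and $m$ edges, a cost function $\omega\colon V(G)\to\mathbb{N}$, a non-empty set $S\subseteq V(G)$ of $p$ terminals, and non-negative integers $k$ and $C$; the question is whether $G$ has a connected subgraph $T$ with $S\subseteq V(T)$, $|N_G[V(T)]|\le k$ and $\omega(N_G[V(T)])\le C$, where $N_G[U]$ is the closed neighbourhood of $U$. Let $W=\max_v\omega(v)$, let $\ell$ be the size of a Steiner tree for $S$, i.e. the minimum number of vertices of a connected subgraph of $G$ containing $S$ (with $\ell=\infty$ if there is none), and let $r=\max(k-\ell,0)$. The integers $p$, $k$, $C$ and the input graph (as an unordered list of edges) are given; $\ell$ and $r$ are not. The following hold on a random access machine with words of $\Theta(\log n)$ bits, on which an instruction takes time proportional to the number of words it handles (for a multiplication or division, to the product of the numbers of words of its operands). In the time bounds each of $m$, $\log n$, $\log W$ is read as at least $1$. (a) Secluded Steiner Tree is fixed-parameter tractable for the parameter $r+p$: there are a function $f$ and a constant $d$ such that it is solvable deterministically in time $f(r+p)\cdot L^{d}$, where $L$ is the length of the input in bits. (b) Secluded Steiner Tree is solvable in time $2^{O(p+r)}\cdot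 nm\cdot\log W+O(\log C)$ by a true-biased Monte Carlo algorithm: for all outcomes of its coin tosses the algorithm halts within this time, its answer is correct whenever it is "yes", and on every yes-instance it answers "yes" with probability at least $1-1/e$. (c) Secluded Steiner Tree is solvable in time $2^{O(p+r)}\cdot nm\log n\cdot\log W+O(\log C)$ by a deterministic algorithm. The additive term $O(\log C)$ is the time for reading the number $C$; it is absorbed by the first term if $C\le nW$, which can be assumed without loss of generality. -/

import Mathlib

open MeasureTheory

namespace Secluded

/-! ## The problem -/

/-- An instance `(G, ω, S, k, C)` of Secluded Steiner Tree: a finite simple graph `G` with vertex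
set `{0, …, n - 1}`, vertex costs `ω`, a set `S = {s₁, …, s_p}` of terminals (`p ≥ 1`), and bounds
`k` and `C`. -/
structure Instance where
  n : ℕ
  G : SimpleGraph (Fin n)
  ω : Fin n → ℕ
  S : Finset (Fin n)
  S_nonempty : S.Nonempty
  k : ℕ
  C : ℕ

namespace Instance

open Classical in
/-- The closed neighbourhood `N_G[U]` of a set of vertices `U`. -/
noncomputable def closedNbhd (I : Instance) (U : Set (Fin I.n)) : Finset (Fin I.n) :=
  Finset.univ.filter fun v => v ∈ U ∨ ∃ u ∈ U, I.G.Adj u v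

/-- `T` is a connected subgraph of `G` that contains all the terminals. -/
def Connects (I : Instance) (T : I.G.Subgraph) : Prop :=
  T.Connected ∧ (I.S : Set (Fin I.n)) ⊆ T.verts

/-- Yes-instances: there is a connected subgraph `T` of `G` with `S ⊆ V(T)`,
`|N_G[V(T)]| ≤ k` and `ω(N_G[V(T)]) ≤ C`. -/
def IsYes (I : Instance) : Prop :=
  ∃ T : I.G.Subgraph, I.Connects T ∧
    (I.closedNbhd T.verts).card ≤ I.k ∧ ∑ v ∈ I.closedNbhd T.verts, I.ω v ≤ I.C

/-- The number of edges. -/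
noncomputable def m (I : Instance) : ℕ := I.G.edgeSet.ncard

/-- The number of terminals. -/
def p (I : Instance) : ℕ := I.S.card

/-- The largest vertex cost. -/
def W (I : Instance) : ℕ := Finset.univ.sup I.ω

/-- The size (number of vertices) `ℓ` of a Steiner tree for `S`, i.e. of a smallest connected
subgraph that contains `S`; it is `⊤` if there is no such subgraph. -/
noncomputable def ell (I : Instance) : ℕ∞ :=
  ⨅ (T : I.G.Subgraph) (_ : I.Connects T), T.verts.encard

/-- The parameter `r = k - ℓ`, read as `0` if `k < ℓ` (in particular if `ℓ = ⊤`). -/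
noncomputable def r (I : Instance) : ℕ := ((I.k : ℕ∞) - I.ell).toNat

end Instance

/-- A presentation of the instance as an input: the edges are listed in an arbitrary order, each of
them once and with its two ends in either order; the terminals are listed in an arbitrary order. -/
structure Presentation (I : Instance) where
  edges : List (Fin I.n × Fin I.n)
  edges_nodup : (edges.map fun e => s(e.1, e.2)).Nodup
  mem_edges : ∀ u v : Fin I.n, s(u, v) ∈ edges.map (fun e => s(e.1, e.2)) ↔ I.G.Adj u v
  terminals : List (Fin I.n)
  terminals_nodup : terminals.Nodup
  mem_terminals : ∀ v : Fin I.n, v ∈ terminals ↔ v ∈ I.S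

/-- The sequence of numbers `n, m, p, k, C`, the `n` vertex costs, the `2m` ends of the edges and
the `p` terminals, which is the input of an algorithm. -/
def Presentation.input {I : Instance} (E : Presentation I) : List ℕ :=
  [I.n, E.edges.length, E.terminals.length, I.k, I.C] ++ List.ofFn I.ω ++
    E.edges.flatMap (fun e => [(e.1 : ℕ), (e.2 : ℕ)]) ++ E.terminals.map (fun v => (v : ℕ))

/-- The length of the input in bits (with one separator for each number). -/
def Presentation.length {I : Instance} (E : Presentation I) : ℕ :=
  (E.input.map fun x => x.size + 1).sum

/-! ## The machine

A random access machine with registers and an indirectly addressed memory, both holding natural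
numbers, programmed with structured control flow. It has words of `w` bits, and the time of an
instruction is proportional to the number of words that it handles (for a multiplication or
division, to the product of the numbers of words of its operands). So an instruction on numbers of
`O(w)` bits takes constant time, and longer numbers are paid for by their length. -/

/-- The binary arithmetic operations. -/
inductive Op
  | add
  | sub
  | mul
  | div

/-- The value of an operation (subtraction is truncated at `0`, division is rounded down). -/
def Op.eval : Op → ℕ → ℕ → ℕ
  | add, a, b => a + b
  | sub, a, b => a - b
  | mul, a, b => a * b
  | div, a, b => a / b

/-- The time for handling the number `x` when words have `w` bits. -/
def words (w x : ℕ) : ℕ := x.size / w + 1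

/-- The time of an operation. -/
def Op.time (w : ℕ) : Op → ℕ → ℕ → ℕ
  | add, a, b => words w a + words w b
  | sub, a, b => words w a + words w b
  | mul, a, b => words w a * words w b
  | div, a, b => words w a * words w b

/-- Programs. Registers are denoted by their numbers. -/
inductive Prog
  /-- `Rᵢ ← a` -/
  | const (i a : ℕ)
  /-- `Rᵢ ← Rⱼ op Rₗ` -/
  | arith (op : Op) (i j l : ℕ)
  /-- `Rᵢ ← M[Rⱼ]` -/
  | load (i j : ℕ)
  /-- `M[Rᵢ] ← Rⱼ` -/
  | store (i j : ℕ)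
  /-- `Rᵢ ←` a fair random bit -/
  | coin (i : ℕ)
  /-- do nothing -/
  | skip
  /-- `P; Q` -/
  | seq (P Q : Prog)
  /-- `if Rᵢ ≠ 0 then P else Q` -/
  | ite (i : ℕ) (P Q : Prog)
  /-- `while Rᵢ ≠ 0 do P` -/
  | while (i : ℕ) (P : Prog)

/-- A program is deterministic if it does not toss coins. -/
def Prog.CoinFree : Prog → Prop
  | .coin _ => False
  | .seq P Q => P.CoinFree ∧ Q.CoinFree
  | .ite _ P Q => P.CoinFree ∧ Q.CoinFree
  | .while _ P => P.CoinFree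
  | _ => True

/-- The state of the machine: registers, memory, and the number of coins tossed so far. -/
structure State where
  reg : ℕ → ℕ
  mem : ℕ → ℕ
  pos : ℕ

/-- Write `x` into register `i`. -/
def State.set (s : State) (i x : ℕ) : State := { s with reg := Function.update s.reg i x }

/-- The initial state: the input stands in the memory, everything else is `0`. -/
def State.init (input : List ℕ) : State where
  reg := fun _ => 0
  mem := fun a => input.getD a 0
  pos := 0

/-- `Exec w τ P s t s'`: on a machine with words of `w` bits, the program `P`, started in the state
`s` with the outcomes `τ 0, τ 1, …` of the coin tosses, halts in the state `s'` after time `t`. -/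
inductive Exec (w : ℕ) (τ : ℕ → Bool) : Prog → State → ℕ → State → Prop
  | const (i a : ℕ) (s : State) : Exec w τ (.const i a) s (words w a) (s.set i a)
  | arith (op : Op) (i j l : ℕ) (s : State) :
      Exec w τ (.arith op i j l) s (op.time w (s.reg j) (s.reg l))
        (s.set i (op.eval (s.reg j) (s.reg l)))
  | load (i j : ℕ) (s : State) :
      Exec w τ (.load i j) s (words w (s.reg j) + words w (s.mem (s.reg j)))
        (s.set i (s.mem (s.reg j)))
  | store (i j : ℕ) (s : State) :
      Exec w τ (.store i j) s (words w (s.reg i) + words w (s.reg j))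
        { s with mem := Function.update s.mem (s.reg i) (s.reg j) }
  | coin (i : ℕ) (s : State) :
      Exec w τ (.coin i) s 1 { s.set i (τ s.pos).toNat with pos := s.pos + 1 }
  | skip (s : State) : Exec w τ .skip s 1 s
  | seq {P Q : Prog} {s s₁ s₂ : State} {t₁ t₂ : ℕ}
      (h₁ : Exec w τ P s t₁ s₁) (h₂ : Exec w τ Q s₁ t₂ s₂) :
      Exec w τ (.seq P Q) s (t₁ + t₂) s₂
  | ite_true {i : ℕ} {P Q : Prog} {s s₁ : State} {t : ℕ}
      (h : s.reg i ≠ 0) (h₁ : Exec w τ P s t s₁) :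
      Exec w τ (.ite i P Q) s (words w (s.reg i) + t) s₁
  | ite_false {i : ℕ} {P Q : Prog} {s s₁ : State} {t : ℕ}
      (h : s.reg i = 0) (h₁ : Exec w τ Q s t s₁) :
      Exec w τ (.ite i P Q) s (words w (s.reg i) + t) s₁
  | while_true {i : ℕ} {P : Prog} {s s₁ s₂ : State} {t₁ t₂ : ℕ}
      (h : s.reg i ≠ 0) (h₁ : Exec w τ P s t₁ s₁) (h₂ : Exec w τ (.while i P) s₁ t₂ s₂) :
      Exec w τ (.while i P) s (words w (s.reg i) + t₁ + t₂) s₂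
  | while_false {i : ℕ} {P : Prog} {s : State} (h : s.reg i = 0) :
      Exec w τ (.while i P) s (words w (s.reg i)) s

/-- A run is determined by the program, the initial state and the coins. -/
theorem Exec.deterministic {w : ℕ} {τ : ℕ → Bool} {P : Prog} {s s₁ s₂ : State} {t₁ t₂ : ℕ}
    (h₁ : Exec w τ P s t₁ s₁) (h₂ : Exec w τ P s t₂ s₂) : t₁ = t₂ ∧ s₁ = s₂ := by
  induction h₁ generalizing t₂ s₂ with
  | seq _ _ ih₁ ih₂ =>
    cases h₂ with
    | seq g₁ g₂ =>
      obtain ⟨rfl, rfl⟩ := ih₁ g₁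
      obtain ⟨rfl, rfl⟩ := ih₂ g₂
      exact ⟨rfl, rfl⟩
  | ite_true h _ ih =>
    cases h₂ with
    | ite_true _ g => obtain ⟨rfl, rfl⟩ := ih g; exact ⟨rfl, rfl⟩
    | ite_false h' _ => exact absurd h' h
  | ite_false h _ ih =>
    cases h₂ with
    | ite_true h' _ => exact absurd h h'
    | ite_false _ g => obtain ⟨rfl, rfl⟩ := ih g; exact ⟨rfl, rfl⟩
  | while_true h _ _ ih₁ ih₂ =>
    cases h₂ with
    | while_true _ g₁ g₂ =>
      obtain ⟨rfl, rfl⟩ := ih₁ g₁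
      obtain ⟨rfl, rfl⟩ := ih₂ g₂
      exact ⟨rfl, rfl⟩
    | while_false h' => exact absurd h' h
  | while_false h =>
    cases h₂ with
    | while_true h' _ _ => exact absurd h h'
    | while_false _ => exact ⟨rfl, rfl⟩
  | _ => cases h₂; exact ⟨rfl, rfl⟩

/-! ## Algorithms for the problem -/

/-- On the presentation `E` of the instance `I` and the coins `τ`, the program halts within time `T`
and its answer (`1`, that is "yes", or `0`, that is "no", in register `0`) is `b`. The words of the
machine have as many bits as the number `n` of vertices. -/
def Answers (P : Prog) {I : Instance} (E : Presentation I) (τ : ℕ → Bool) (T : ℕ) (b : Bool) :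
    Prop :=
  ∃ t s, Exec I.n.size τ P (State.init E.input) t s ∧ t ≤ T ∧ s.reg 0 = b.toNat

/-- The distribution of a sequence of independent fair coin tosses. -/
noncomputable def coins : Measure (ℕ → Bool) :=
  Measure.infinitePi fun _ => (PMF.uniformOfFintype Bool).toMeasure

/-- `P` is a deterministic algorithm that solves Secluded Steiner Tree in time `T`. -/
def SolvesDet (P : Prog) (T : ∀ I : Instance, Presentation I → ℕ) : Prop :=
  P.CoinFree ∧ ∀ (I : Instance) (E : Presentation I) (τ : ℕ → Bool),
    ∃ b, Answers P E τ (T I E) b ∧ (b = true ↔ I.IsYes)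

/-- `P` is a true-biased Monte Carlo algorithm that solves Secluded Steiner Tree in time `T`:
whatever the coins are, it halts within time `T` with an answer, and the answer "yes" is correct;
for every yes-instance the answer is "yes" with probability at least `1 - 1/e`. -/
def SolvesMonteCarlo (P : Prog) (T : ∀ I : Instance, Presentation I → ℕ) : Prop :=
  ∀ (I : Instance) (E : Presentation I),
    (∀ τ : ℕ → Bool, ∃ b, Answers P E τ (T I E) b ∧ (b = true → I.IsYes)) ∧
    (I.IsYes → ENNReal.ofReal (1 - Real.exp (-1)) ≤ coins {τ | Answers P E τ (T I E) true})

end Secluded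

/-!
A single deterministic program, which runs in time `2^{O(p + r)} · n · max(1, m) · max(1, log W) +
O(log C)`, proves all three parts: a program without coins is a Monte Carlo algorithm that is right
with certainty, the time bound of the deterministic algorithm is larger by a factor, and all the
quantities other than `p + r` are bounded by the length of the input.

*The size of a Steiner tree.* For every set `X` of terminals, given by bits, and every vertex `v`, a
table holds the smallest known number of vertices besides `v` of a connected set that contains `v`
and `X`. It is relaxed `n` times, for all pairs of disjoint sets `Y`, `Z` and all arcs `(a, b)`, by
hanging a tree for `b` and `Z` below a tree for `a` and `Y`. A tree with `t + 1` vertices is split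
at an edge at its root into smaller trees, so that after `t` rounds its table entry is right
(`Net.TableComplete.relax`). This takes `4^p · n · O(m + p)` steps and yields `ℓ`, hence
`r = k - ℓ`.

*The exploration.* A solution is searched for from the first terminal on, vertex by vertex, with a
queue; an advice of bits decides for each neighbour that is found whether it is included into the
solution or excluded. The decided vertices are the closed neighbourhood of the included ones at the
end, so that a solution can be recognized (`Net.yesSet_of_explore`). The point is that the advice
can be short. Consider a solution `T` from which no vertex that is not a terminal can be removed.
When a vertex `x` of `T` that is not a terminal is processed, some undecided neighbour of `x` lies
in `T`, since otherwise `x` could be removed (`Net.Tight.exists_open`). So if `x` has only one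
undecided neighbour, no advice is needed. Otherwise at least two vertices are decided with one bit
each, while one nonterminal of `T` is processed; so the number of bits is at most twice the
difference between the number of decided vertices and the number of processed nonterminals. In
total these are at most `2 (|N[T]| - |T| + p) ≤ 2 (k - ℓ + p)` bits (`Net.YesSet.exists_explore`),
and all `4^(r + p)` advices can be tried, each of them in `O(n m + n)` steps.

*The machine.* The programs are written in a language of `for` loops (`Cmd`), which is compiled to
the machine. A weakest precondition calculus (`wp`) yields correctness and, through bounds on all the
numbers that occur, the time (`exec_of_wp`): the number of steps times the number of words that a
step handles. Two inputs need care. The bound `C` can be much longer than everything else; a single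
command reads it and replaces it by the sum of all costs if it is larger. And `k` is not bounded in
terms of `n` and `r` if the terminals cannot be connected; so it is read only when a Steiner tree
has been found.
-/

namespace Secluded

/-! ### A language of `for` loops, and its compilation to the machine -/

/-- The state of a program in the high-level language: variables and memory. -/
structure Store where
  var : ℕ → ℕ
  mem : ℕ → ℕ

/-- Assign `x` to the variable `i`. -/
def Store.set (σ : Store) (i x : ℕ) : Store := { σ with var := Function.update σ.var i x }

/-- Write `x` to the memory cell `a`. -/
def Store.put (σ : Store) (a x : ℕ) : Store := { σ with mem := Function.update σ.mem a x }

@[simp] theorem Store.set_mem (σ : Store) (i x : ℕ) : (σ.set i x).mem = σ.mem := rfl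
@[simp] theorem Store.put_var (σ : Store) (i x : ℕ) : (σ.put i x).var = σ.var := rfl
@[simp] theorem Store.set_var (σ : Store) (i x j : ℕ) :
    (σ.set i x).var j = if j = i then x else σ.var j := by
  simp [Store.set, Function.update_apply]
theorem Store.put_mem (σ : Store) (a x c : ℕ) :
    (σ.put a x).mem c = if c = a then x else σ.mem c := by
  simp [Store.put, Function.update_apply]

/-- Expressions: numerals, variables, memory access, arithmetic. -/
inductive Ex
  | num (a : ℕ)
  | var (i : ℕ)
  | mem (e : Ex)
  | bin (o : Op) (e f : Ex)

namespace Ex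

instance : Add Ex := ⟨bin .add⟩
instance : Sub Ex := ⟨bin .sub⟩
instance : Mul Ex := ⟨bin .mul⟩
instance : Div Ex := ⟨bin .div⟩

/-- The value of an expression. -/
def val (σ : Store) : Ex → ℕ
  | num a => a
  | var i => σ.var i
  | mem e => σ.mem (e.val σ)
  | bin o e f => o.eval (e.val σ) (f.val σ)

/-- The code that evaluates an expression into register `d`, with the registers above `d` as
scratch space. There is no instruction for copying a register, so `0` is added to it. -/
def code : Ex → ℕ → Prog
  | num a, d => .const d a
  | var i, d => .seq (.const d 0) (.arith .add d i d)
  | mem e, d => .seq (e.code d) (.load d d)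
  | bin o e f, d => .seq (e.code d) (.seq (f.code (d + 1)) (.arith o d d (d + 1)))

/-- The number of instructions of the code. -/
def steps : Ex → ℕ
  | num _ => 1
  | var _ => 2
  | mem e => e.steps + 1
  | bin _ e f => e.steps + f.steps + 1

end Ex

/-- Commands: assignment, storing, sequencing, branching, and loops
`for var i = 0, …, var l - 1 do c`. -/
inductive Cmd
  | skip
  | set (i : ℕ) (e : Ex)
  | put (e f : Ex)
  | seq (c d : Cmd)
  | ite (e : Ex) (c d : Cmd)
  | loop (i l : ℕ) (c : Cmd)

namespace Cmd

/-- The first scratch register; the variables are the registers below it. -/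
abbrev scratch : ℕ := 40

/-- The code of an assignment. -/
def setCode (i : ℕ) (e : Ex) : Prog :=
  .seq (e.code scratch) (.seq (.const i 0) (.arith .add i scratch i))

/-- Compilation of commands. -/
def code : Cmd → Prog
  | skip => .skip
  | set i e => setCode i e
  | put e f => .seq (e.code scratch) (.seq (f.code (scratch + 1)) (.store scratch (scratch + 1)))
  | seq c d => .seq c.code d.code
  | ite e c d => .seq (e.code scratch) (.ite scratch c.code d.code)
  | loop i l c =>
    .seq (.const i 0) (.seq (Ex.code (.var l - .var i) scratch)
      (.while scratch (.seq c.code (.seq (setCode i (.var i + .num 1))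
        (Ex.code (.var l - .var i) scratch)))))

/-- A bound on the number of instructions that are executed, where `β l` bounds the value of the
variable `l` that limits a loop. -/
def steps (β : ℕ → ℕ) : Cmd → ℕ
  | skip => 1
  | set _ e => e.steps + 2
  | put e f => e.steps + f.steps + 1
  | seq c d => c.steps β + d.steps β
  | ite e c d => e.steps + 1 + c.steps β + d.steps β
  | loop _ l c => 7 + β l * (c.steps β + 12)

end Cmd

/-- The parameters of a run: the word length `w`; a bound `B` on all numbers and a smaller bound `b`
on the operands of multiplications and divisions; a bound `κ` on the time of an instruction; the
bounds `β` on the loops; and the set `X` of memory cells that may be read. -/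
structure Par where
  w : ℕ
  b : ℕ
  B : ℕ
  κ : ℕ
  β : ℕ → ℕ
  X : ℕ → Prop
  eight_le : 8 ≤ b
  sq_le : b * b ≤ B
  two_words_le : 2 * words w B ≤ κ
  words_sq_le : words w b * words w b ≤ κ

namespace Par

variable (K : Par)

theorem eight_mul_le : 8 * K.b ≤ K.B := (Nat.mul_le_mul_right _ K.eight_le).trans K.sq_le

theorem b_le_B : K.b ≤ K.B := (Nat.le_mul_self _).trans K.sq_le

end Par

theorem words_mono {w x y : ℕ} (h : x ≤ y) : words w x ≤ words w y :=
  Nat.add_le_add_right (Nat.div_le_div_right (Nat.size_le_size h)) 1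

theorem words_pos (w x : ℕ) : 1 ≤ words w x := Nat.le_add_left _ _

namespace Par

variable {K : Par}

theorem words_add_le {x y : ℕ} (hx : x ≤ K.B) (hy : y ≤ K.B) :
    words K.w x + words K.w y ≤ K.κ := by
  have := words_mono (w := K.w) hx
  have := words_mono (w := K.w) hy
  have := K.two_words_le
  omega

theorem words_le {x : ℕ} (hx : x ≤ K.B) : words K.w x ≤ K.κ :=
  (Nat.le_add_right _ _).trans (words_add_le hx hx)

theorem one_le_κ (K : Par) : 1 ≤ K.κ := (words_pos K.w 0).trans (words_le (Nat.zero_le _))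

end Par

/-- All variables, and all memory cells that may be read, hold numbers up to `B`. -/
def Store.Bounded (K : Par) (σ : Store) : Prop :=
  (∀ i, σ.var i ≤ K.B) ∧ ∀ a, K.X a → σ.mem a ≤ K.B

/-- The evaluation of the expression meets only numbers within the bounds and reads only memory cells
that may be read. -/
def Ex.Ok (K : Par) (σ : Store) : Ex → Prop
  | .num a => a ≤ 8
  | .var i => i < 40
  | .mem e => e.Ok K σ ∧ K.X (e.val σ)
  | .bin .add e f => e.Ok K σ ∧ f.Ok K σ ∧ e.val σ + f.val σ ≤ K.B
  | .bin .sub e f => e.Ok K σ ∧ f.Ok K σ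
  | .bin .mul e f => e.Ok K σ ∧ f.Ok K σ ∧ e.val σ ≤ K.b ∧ f.val σ ≤ K.b
  | .bin .div e f => e.Ok K σ ∧ f.Ok K σ ∧ e.val σ ≤ K.b ∧ f.val σ ≤ K.b

theorem Ex.Ok.val_le {K : Par} {σ : Store} (hσ : σ.Bounded K) {e : Ex} (h : e.Ok K σ) :
    e.val σ ≤ K.B := by
  induction e with
  | num a => exact (le_trans h K.eight_le).trans K.b_le_B
  | var i => exact hσ.1 i
  | mem e _ => exact hσ.2 _ h.2
  | bin o e f ihe ihf =>
    cases o with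
    | add => exact h.2.2
    | sub => exact (Nat.sub_le _ _).trans (ihe h.1)
    | mul => exact (Nat.mul_le_mul h.2.2.1 h.2.2.2).trans K.sq_le
    | div => exact (Nat.div_le_self _ _).trans (ihe h.1)

theorem Ex.Ok.time_le {K : Par} {σ : Store} (hσ : σ.Bounded K) {o : Op} {e f : Ex}
    (h : (Ex.bin o e f).Ok K σ) : o.time K.w (e.val σ) (f.val σ) ≤ K.κ := by
  cases o with
  | add => exact Par.words_add_le (h.1.val_le hσ) (h.2.1.val_le hσ)
  | sub => exact Par.words_add_le (h.1.val_le hσ) (h.2.val_le hσ)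
  | mul => exact (Nat.mul_le_mul (words_mono h.2.2.1) (words_mono h.2.2.2)).trans K.words_sq_le
  | div => exact (Nat.mul_le_mul (words_mono h.2.2.1) (words_mono h.2.2.2)).trans K.words_sq_le

theorem Ex.Ok.left {K : Par} {σ : Store} {o : Op} {e f : Ex} (h : (Ex.bin o e f).Ok K σ) :
    e.Ok K σ := by cases o <;> exact h.1

theorem Ex.Ok.right {K : Par} {σ : Store} {o : Op} {e f : Ex} (h : (Ex.bin o e f).Ok K σ) :
    f.Ok K σ := by
  cases o
  · exact h.2.1
  · exact h.2
  · exact h.2.1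
  · exact h.2.1

/-- The machine state `s` represents the store `σ`. -/
def Rep (s : State) (σ : Store) : Prop := (∀ i < Cmd.scratch, s.reg i = σ.var i) ∧ s.mem = σ.mem

theorem Ex.exec {K : Par} {σ : Store} (hσ : σ.Bounded K) (τ : ℕ → Bool) {e : Ex} (h : e.Ok K σ)
    {d : ℕ} (hd : Cmd.scratch ≤ d) {s : State} (hs : Rep s σ) :
    ∃ t s', Exec K.w τ (e.code d) s t s' ∧ t ≤ K.κ * e.steps ∧ Rep s' σ ∧
      s'.reg d = e.val σ ∧ ∀ i < d, s'.reg i = s.reg i := by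
  have rep {s : State} (hs : Rep s σ) {d x : ℕ} (hd : Cmd.scratch ≤ d) : Rep (s.set d x) σ :=
    ⟨fun i hi => by simp [State.set, Function.update_of_ne (by omega : i ≠ d), hs.1 i hi], hs.2⟩
  have low {s : State} {d x i : ℕ} (hi : i < d) : (s.set d x).reg i = s.reg i := by
    simp [State.set, Function.update_of_ne (by omega : i ≠ d)]
  have at_d {s : State} {d x : ℕ} : (s.set d x).reg d = x := by simp [State.set]
  have hκ := K.one_le_κ
  induction e generalizing d s with
  | num a =>
    refine ⟨_, _, Exec.const d a s, ?_, rep hs hd, at_d, fun i hi => low hi⟩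
    exact (Par.words_le (h.val_le hσ)).trans (Nat.le_of_eq (Nat.mul_one _).symm)
  | var i =>
    have hi : i < Cmd.scratch := h
    refine ⟨_, _, .seq (.const d 0 s) (.arith .add d i d _), ?_, rep (rep hs hd) hd, ?_,
      fun j hj => (low hj).trans (low hj)⟩
    · have h1 : words K.w 0 ≤ K.κ := Par.words_le (Nat.zero_le _)
      have h2 := Par.words_add_le (K := K) (hσ.1 i) (Nat.zero_le K.B)
      simp only [Op.time, at_d, low (show i < d by omega), hs.1 i hi, Ex.steps]
      omega
    · simp [Op.eval, at_d, low (show i < d by omega), hs.1 i hi, Ex.val]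
  | mem e ih =>
    obtain ⟨t, s', hx, ht, hr, hv, hl⟩ := ih h.1 hd hs
    refine ⟨_, _, .seq hx (.load d d s'), ?_, rep hr hd, ?_, fun j hj => (low hj).trans (hl j hj)⟩
    · have := Par.words_add_le (K := K) (h.1.val_le hσ) (hσ.2 _ h.2)
      rw [hv, hr.2, Ex.steps, Nat.mul_add]
      omega
    · rw [at_d, hv, hr.2]; rfl
  | bin o e f ihe ihf =>
    obtain ⟨t, s₁, hx, ht, hr, hv, hl⟩ := ihe h.left hd hs
    obtain ⟨t', s₂, hx', ht', hr', hv', hl'⟩ := ihf h.right (d := d + 1) (by omega) hr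
    refine ⟨_, _, .seq hx (.seq hx' (.arith o d d (d + 1) s₂)), ?_, rep hr' hd, ?_,
      fun j hj => (low hj).trans ((hl' j (by omega)).trans (hl j hj))⟩
    · have := h.time_le hσ
      rw [hv', hl' d (by omega), hv, Ex.steps, Nat.mul_add, Nat.mul_add]
      omega
    · rw [at_d, hv', hl' d (by omega), hv]; rfl

theorem Cmd.exec_setCode {K : Par} {σ : Store} (hσ : σ.Bounded K) (τ : ℕ → Bool) {i : ℕ}
    (hi : i < 40) {e : Ex} (h : e.Ok K σ) {s : State} (hs : Rep s σ) :
    ∃ t s', Exec K.w τ (Cmd.setCode i e) s t s' ∧ t ≤ K.κ * (e.steps + 2) ∧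
      Rep s' (σ.set i (e.val σ)) ∧ (σ.set i (e.val σ)).Bounded K := by
  obtain ⟨t, s', hx, ht, hr, hv, -⟩ := Ex.exec hσ τ h le_rfl hs
  refine ⟨_, _, .seq hx (.seq (.const i 0 _) (.arith .add i Cmd.scratch i _)), ?_, ⟨?_, hr.2⟩, ?_,
    hσ.2⟩
  · have h1 : words K.w 0 ≤ K.κ := Par.words_le (Nat.zero_le _)
    have h2 := Par.words_add_le (K := K) (h.val_le hσ) (Nat.zero_le K.B)
    simp only [Op.time, State.set, Function.update_self,
      Function.update_of_ne (show Cmd.scratch ≠ i by simp [Cmd.scratch]; omega), hv]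
    rw [Nat.mul_add]
    omega
  · intro j hj
    simp only [State.set, Function.update_self, Op.eval,
      Function.update_of_ne (show Cmd.scratch ≠ i by simp [Cmd.scratch]; omega), hv,
      Store.set_var, Function.update_apply]
    split_ifs
    · simp
    · exact hr.1 j hj
  · intro j
    rw [Store.set_var]
    split_ifs
    exacts [h.val_le hσ, hσ.1 j]

/-- The weakest precondition: if it holds at `σ`, the command respects the bounds `K` and reaches a
store with `Q`. A loop comes with an invariant. -/
def wp (K : Par) : Cmd → (Store → Prop) → Store → Prop
  | .skip, Q, σ => Q σ
  | .set i e, Q, σ => i < 40 ∧ e.Ok K σ ∧ Q (σ.set i (e.val σ))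
  | .put e f, Q, σ => e.Ok K σ ∧ f.Ok K σ ∧ Q (σ.put (e.val σ) (f.val σ))
  | .seq c d, Q, σ => wp K c (wp K d Q) σ
  | .ite e c d, Q, σ =>
    e.Ok K σ ∧ (e.val σ ≠ 0 → wp K c Q σ) ∧ (e.val σ = 0 → wp K d Q σ)
  | .loop i l c, Q, σ =>
    i < 40 ∧ l < 40 ∧ i ≠ l ∧ σ.var l ≤ K.β l ∧ ∃ Inv : ℕ → Store → Prop, Inv 0 (σ.set i 0) ∧
      (∀ j < σ.var l, ∀ σ', Inv j σ' → σ'.var i = j → σ'.var l = σ.var l →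
        wp K c (fun σ'' => σ''.var i = j ∧ σ''.var l = σ.var l ∧ Inv (j + 1) (σ''.set i (j + 1)))
          σ') ∧
      ∀ σ', Inv (σ.var l) σ' → Q σ'

theorem wp_mono {K : Par} {c : Cmd} {Q Q' : Store → Prop} {σ : Store} (h : wp K c Q σ)
    (hQ : ∀ σ', Q σ' → Q' σ') : wp K c Q' σ := by
  induction c generalizing Q Q' σ with
  | skip => exact hQ _ h
  | set i e => exact ⟨h.1, h.2.1, hQ _ h.2.2⟩
  | put e f => exact ⟨h.1, h.2.1, hQ _ h.2.2⟩
  | seq c d ihc ihd => exact ihc h fun _ h' => ihd h' hQ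
  | ite e c d ihc ihd => exact ⟨h.1, fun h' => ihc (h.2.1 h') hQ, fun h' => ihd (h.2.2 h') hQ⟩
  | loop i l c _ =>
    obtain ⟨h1, h2, h3, h4, Inv, h5, h6, h7⟩ := h
    exact ⟨h1, h2, h3, h4, Inv, h5, h6, fun σ' h' => hQ _ (h7 σ' h')⟩

/-- The weakest precondition is sound for the compiled code, and the running time is at most `κ`
times the number of steps. -/
theorem exec_of_wp {K : Par} (τ : ℕ → Bool) {c : Cmd} {Q : Store → Prop} {σ : Store}
    (h : wp K c Q σ) (hσ : σ.Bounded K) {s : State} (hs : Rep s σ) :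
    ∃ t s' σ', Exec K.w τ c.code s t s' ∧ t ≤ K.κ * c.steps K.β ∧ Rep s' σ' ∧ σ'.Bounded K ∧
      Q σ' := by
  have hκ := K.one_le_κ
  induction c generalizing Q σ s with
  | skip => exact ⟨1, s, σ, .skip s, by simpa [Cmd.steps] using hκ, hs, hσ, h⟩
  | set i e =>
    obtain ⟨t, s', hx, ht, hr, hb⟩ := Cmd.exec_setCode hσ τ h.1 h.2.1 hs
    exact ⟨t, s', _, hx, ht, hr, hb, h.2.2⟩
  | put e f =>
    obtain ⟨t, s₁, hx, ht, hr, hv, hl⟩ := Ex.exec hσ τ h.1 le_rfl hs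
    obtain ⟨t', s₂, hx', ht', hr', hv', hl'⟩ :=
      Ex.exec hσ τ h.2.1 (d := Cmd.scratch + 1) (by omega) hr
    refine ⟨_, _, _, .seq hx (.seq hx' (.store _ _ _)), ?_, ?_, ?_, h.2.2⟩
    · have := Par.words_add_le (K := K) (h.1.val_le hσ) (h.2.1.val_le hσ)
      rw [hv', hl' _ (by omega), hv, Cmd.steps, Nat.mul_add, Nat.mul_add]
      omega
    · refine ⟨hr'.1, ?_⟩
      simp only [hv', hl' _ (Nat.lt_succ_self _), hv, hr'.2, Store.put]
    · refine ⟨hσ.1, fun a ha => ?_⟩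
      rw [Store.put_mem]
      split_ifs
      exacts [h.2.1.val_le hσ, hσ.2 a ha]
  | seq c d ihc ihd =>
    obtain ⟨t, s₁, σ₁, hx, ht, hr, hb, hq⟩ := ihc h hσ hs
    obtain ⟨t', s₂, σ₂, hx', ht', hr', hb', hq'⟩ := ihd hq hb hr
    refine ⟨_, s₂, σ₂, .seq hx hx', ?_, hr', hb', hq'⟩
    rw [Cmd.steps, Nat.mul_add]
    omega
  | ite e c d ihc ihd =>
    obtain ⟨t, s₁, hx, ht, hr, hv, -⟩ := Ex.exec hσ τ h.1 le_rfl hs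
    have hw := Par.words_le (h.1.val_le hσ)
    by_cases h0 : e.val σ = 0
    · obtain ⟨t', s₂, σ₂, hx', ht', hr', hb', hq'⟩ := ihd (h.2.2 h0) hσ hr
      refine ⟨_, s₂, σ₂, .seq hx (.ite_false (by rw [hv]; exact h0) hx'), ?_, hr', hb', hq'⟩
      rw [hv, Cmd.steps, Nat.mul_add, Nat.mul_add, Nat.mul_add]
      omega
    · obtain ⟨t', s₂, σ₂, hx', ht', hr', hb', hq'⟩ := ihc (h.2.1 h0) hσ hr
      refine ⟨_, s₂, σ₂, .seq hx (.ite_true (by rw [hv]; exact h0) hx'), ?_, hr', hb', hq'⟩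
      rw [hv, Cmd.steps, Nat.mul_add, Nat.mul_add, Nat.mul_add]
      omega
  | loop i l c ih =>
    obtain ⟨hi, hl, hil, hN, Inv, h0, hstep, hQ⟩ := h
    set N := σ.var l with hNdef
    have hNB : N ≤ K.B := hσ.1 l
    have hcond : ∀ σ' : Store, (Ex.var l - Ex.var i).Ok K σ' := fun _ => ⟨hl, hi⟩
    -- the loop, from the point at which `d` iterations are left
    have main : ∀ d j σ' s', j + d = N → Inv j σ' → σ'.var i = j → σ'.var l = N →
        σ'.Bounded K → Rep s' σ' → s'.reg Cmd.scratch = N - j →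
        ∃ t s'' σ'', Exec K.w τ (.while Cmd.scratch (.seq c.code
          (.seq (Cmd.setCode i (.var i + .num 1)) (Ex.code (.var l - .var i) Cmd.scratch)))) s' t s''
          ∧ t ≤ K.κ * (1 + d * (c.steps K.β + 12)) ∧ Rep s'' σ'' ∧ σ''.Bounded K ∧ Inv N σ'' := by
      intro d
      induction d with
      | zero =>
        intro j σ' s' hj hI _ _ hb hr hreg
        obtain rfl : j = N := by omega
        refine ⟨_, s', σ', .while_false (by omega), ?_, hr, hb, hI⟩
        have : words K.w (s'.reg Cmd.scratch) ≤ K.κ := Par.words_le (by omega)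
        omega
      | succ d ihd =>
        intro j σ' s' hj hI hji hjl hb hr hreg
        obtain ⟨t₁, s₁, σ₁, hx₁, ht₁, hr₁, hb₁, hv₁, hl₁, hI₁⟩ :=
          ih (hstep j (by omega) σ' hI hji hjl) hb hr
        have hinc : (Ex.var i + Ex.num 1).Ok K σ₁ :=
          ⟨hi, by change 1 ≤ 8; omega, by change σ₁.var i + 1 ≤ K.B; omega⟩
        obtain ⟨t₂, s₂, hx₂, ht₂, hr₂, hb₂⟩ := Cmd.exec_setCode hb₁ τ hi hinc hr₁
        have hval : (Ex.var i + Ex.num 1).val σ₁ = j + 1 := by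
          change σ₁.var i + 1 = j + 1
          rw [hv₁]
        rw [hval] at hr₂ hb₂
        obtain ⟨t₃, s₃, hx₃, ht₃, hr₃, hv₃, -⟩ := Ex.exec hb₂ τ (hcond _) le_rfl hr₂
        have e1 : (σ₁.set i (j + 1)).var i = j + 1 := by simp [Store.set_var]
        have e2 : (σ₁.set i (j + 1)).var l = N := by simp [Store.set_var, hil.symm, hl₁]
        obtain ⟨t₄, s₄, σ₄, hx₄, ht₄, hr₄, hb₄, hI₄⟩ := ihd (j + 1) _ s₃ (by omega) hI₁ e1 e2 hb₂ hr₃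
          (by rw [hv₃]; change (σ₁.set i (j + 1)).var l - (σ₁.set i (j + 1)).var i = _; rw [e1, e2])
        refine ⟨_, s₄, σ₄, .while_true (by omega) (.seq hx₁ (.seq hx₂ hx₃)) hx₄, ?_, hr₄, hb₄, hI₄⟩
        have hw : words K.w (s'.reg Cmd.scratch) ≤ K.κ := Par.words_le (by omega)
        have hs2 : (Ex.var i + Ex.num 1).steps = 4 := rfl
        have hs3 : (Ex.var l - Ex.var i).steps = 5 := rfl
        rw [hs2] at ht₂
        rw [hs3] at ht₃
        calc _ ≤ K.κ + (K.κ * c.steps K.β + (K.κ * (4 + 2) + K.κ * 5)) +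
            K.κ * (1 + d * (c.steps K.β + 12)) := by omega
          _ = _ := by ring
    have hb1 : (σ.set i 0).Bounded K := by
      refine ⟨fun j => ?_, hσ.2⟩
      rw [Store.set_var]
      split_ifs
      exacts [Nat.zero_le _, hσ.1 j]
    have hr1 : Rep (s.set i 0) (σ.set i 0) := by
      refine ⟨fun j hj => ?_, hs.2⟩
      simp only [State.set, Store.set, Function.update_apply]
      split_ifs
      exacts [rfl, hs.1 j hj]
    have e1 : (σ.set i 0).var i = 0 := by simp [Store.set_var]
    have e2 : (σ.set i 0).var l = N := by simp [Store.set_var, hil.symm, hNdef]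
    obtain ⟨t₃, s₃, hx₃, ht₃, hr₃, hv₃, -⟩ := Ex.exec hb1 τ (hcond _) le_rfl hr1
    obtain ⟨t₄, s₄, σ₄, hx₄, ht₄, hr₄, hb₄, hI₄⟩ := main N 0 _ s₃ (by omega) h0 e1 e2 hb1 hr₃
      (by rw [hv₃]; change (σ.set i 0).var l - (σ.set i 0).var i = _; rw [e1, e2])
    refine ⟨_, s₄, σ₄, .seq (.const i 0 s) (.seq hx₃ hx₄), ?_, hr₄, hb₄, hQ _ hI₄⟩
    have hw : words K.w 0 ≤ K.κ := Par.words_le (Nat.zero_le _)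
    have hs3 : (Ex.var l - Ex.var i).steps = 5 := rfl
    rw [hs3] at ht₃
    calc _ ≤ K.κ + (K.κ * 5 + K.κ * (1 + N * (c.steps K.β + 12))) := by omega
      _ = K.κ * (7 + N * (c.steps K.β + 12)) := by ring
      _ ≤ _ := Nat.mul_le_mul_left _ (Nat.add_le_add_left (Nat.mul_le_mul_right _ hN) _)

theorem Ex.coinFree_code (e : Ex) (d : ℕ) : (e.code d).CoinFree := by
  induction e generalizing d with
  | num a => trivial
  | var i => exact ⟨trivial, trivial⟩
  | mem e ih => exact ⟨ih d, trivial⟩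
  | bin o e f ihe ihf => exact ⟨ihe d, ihf _, trivial⟩

theorem Cmd.coinFree_code (c : Cmd) : c.code.CoinFree := by
  induction c with
  | skip => trivial
  | set i e => exact ⟨e.coinFree_code _, trivial, trivial⟩
  | put e f => exact ⟨e.coinFree_code _, f.coinFree_code _, trivial⟩
  | seq c d ihc ihd => exact ⟨ihc, ihd⟩
  | ite e c d ihc ihd => exact ⟨e.coinFree_code _, ihc, ihd⟩
  | loop i l c ih =>
    exact ⟨trivial, Ex.coinFree_code _ _, ih, ⟨Ex.coinFree_code _ _, trivial, trivial⟩,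
      Ex.coinFree_code _ _⟩

section simp_lemmas

variable {K : Par} {σ : Store}

@[simp] theorem val_num (a : ℕ) : (Ex.num a).val σ = a := rfl
@[simp] theorem val_var (i : ℕ) : (Ex.var i).val σ = σ.var i := rfl
@[simp] theorem val_mem (e : Ex) : (Ex.mem e).val σ = σ.mem (e.val σ) := rfl
@[simp] theorem val_add (e f : Ex) : (e + f).val σ = e.val σ + f.val σ := rfl
@[simp] theorem val_sub (e f : Ex) : (e - f).val σ = e.val σ - f.val σ := rfl
@[simp] theorem val_mul (e f : Ex) : (e * f).val σ = e.val σ * f.val σ := rfl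
@[simp] theorem val_div (e f : Ex) : (e / f).val σ = e.val σ / f.val σ := rfl
@[simp] theorem ok_num (a : ℕ) : (Ex.num a).Ok K σ ↔ a ≤ 8 := Iff.rfl
@[simp] theorem ok_var (i : ℕ) : (Ex.var i).Ok K σ ↔ i < 40 := Iff.rfl
@[simp] theorem ok_mem (e : Ex) : (Ex.mem e).Ok K σ ↔ e.Ok K σ ∧ K.X (e.val σ) := Iff.rfl
@[simp] theorem ok_add (e f : Ex) :
    (e + f).Ok K σ ↔ e.Ok K σ ∧ f.Ok K σ ∧ e.val σ + f.val σ ≤ K.B := Iff.rfl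
@[simp] theorem ok_sub (e f : Ex) : (e - f).Ok K σ ↔ e.Ok K σ ∧ f.Ok K σ := Iff.rfl
@[simp] theorem ok_mul (e f : Ex) :
    (e * f).Ok K σ ↔ e.Ok K σ ∧ f.Ok K σ ∧ e.val σ ≤ K.b ∧ f.val σ ≤ K.b := Iff.rfl
@[simp] theorem ok_div (e f : Ex) :
    (e / f).Ok K σ ↔ e.Ok K σ ∧ f.Ok K σ ∧ e.val σ ≤ K.b ∧ f.val σ ≤ K.b := Iff.rfl

variable {Q : Store → Prop}

@[simp] theorem wp_skip : wp K .skip Q σ ↔ Q σ := Iff.rfl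
@[simp] theorem wp_set (i : ℕ) (e : Ex) :
    wp K (.set i e) Q σ ↔ i < 40 ∧ e.Ok K σ ∧ Q (σ.set i (e.val σ)) := Iff.rfl
@[simp] theorem wp_put (e f : Ex) :
    wp K (.put e f) Q σ ↔ e.Ok K σ ∧ f.Ok K σ ∧ Q (σ.put (e.val σ) (f.val σ)) := Iff.rfl
@[simp] theorem wp_ite (e : Ex) (c d : Cmd) : wp K (.ite e c d) Q σ ↔
    e.Ok K σ ∧ (e.val σ ≠ 0 → wp K c Q σ) ∧ (e.val σ = 0 → wp K d Q σ) := Iff.rfl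

/-- A block of commands. -/
def Cmd.block : List Cmd → Cmd
  | [] => .skip
  | c :: l => .seq c (block l)

@[simp] theorem wp_block_nil : wp K (.block []) Q σ ↔ Q σ := Iff.rfl
@[simp] theorem wp_block_cons (c : Cmd) (l : List Cmd) :
    wp K (.block (c :: l)) Q σ ↔ wp K c (wp K (.block l) Q) σ := Iff.rfl

theorem wp_block_set {i : ℕ} {e : Ex} {l : List Cmd} (x : ℕ) (hi : i < 40) (he : e.Ok K σ)
    (hx : e.val σ = x) (h : wp K (.block l) Q (σ.set i x)) :
    wp K (.block (.set i e :: l)) Q σ := by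
  subst hx
  exact ⟨hi, he, h⟩

theorem wp_block_put {e f : Ex} {l : List Cmd} (a x : ℕ) (he : e.Ok K σ) (hf : f.Ok K σ)
    (ha : e.val σ = a) (hx : f.val σ = x) (h : wp K (.block l) Q (σ.put a x)) :
    wp K (.block (.put e f :: l)) Q σ := by
  subst ha hx
  exact ⟨he, hf, h⟩

theorem wp_seq_of {c d : Cmd} (Q' : Store → Prop) (hc : wp K c Q' σ)
    (h : ∀ σ', Q' σ' → wp K d Q σ') : wp K (.seq c d) Q σ := by
  change wp K c (wp K d Q) σ
  exact wp_mono hc h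

/-- The rule for a command within a block. -/
theorem wp_block_of {c : Cmd} {l : List Cmd} (Q' : Store → Prop) (hc : wp K c Q' σ)
    (h : ∀ σ', Q' σ' → wp K (.block l) Q σ') : wp K (.block (c :: l)) Q σ := by
  change wp K c (wp K (.block l) Q) σ
  exact wp_mono hc h

end simp_lemmas

/-- The rule for loops. -/
theorem wp_loop {K : Par} {σ : Store} {Q : Store → Prop} {i l : ℕ} {c : Cmd} (N : ℕ)
    (hN : σ.var l = N) (hil : i < 40 ∧ l < 40 ∧ i ≠ l) (hβ : N ≤ K.β l)
    (Inv : ℕ → Store → Prop) (h0 : Inv 0 (σ.set i 0))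
    (hstep : ∀ j < N, ∀ σ', Inv j σ' → σ'.var i = j → σ'.var l = N →
      wp K c (fun σ'' => σ''.var i = j ∧ σ''.var l = N ∧ Inv (j + 1) (σ''.set i (j + 1))) σ')
    (hQ : ∀ σ', Inv N σ' → Q σ') : wp K (.loop i l c) Q σ := by
  subst hN
  exact ⟨hil.1, hil.2.1, hil.2.2, hβ, Inv, h0, hstep, hQ⟩

/-! ### Connected sets of vertices -/

/-- The combinatorial part of an input, with vertices `0, …, n - 1`, the `m2` arcs (each edge in both
directions) `src j → dst j`, and the terminals `ter 0, …, ter (p - 1)`. -/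
structure Net where
  n : ℕ
  m2 : ℕ
  p : ℕ
  src : ℕ → ℕ
  dst : ℕ → ℕ
  ter : ℕ → ℕ
  src_lt : ∀ j < m2, src j < n
  dst_lt : ∀ j < m2, dst j < n
  symm : ∀ j < m2, ∃ j' < m2, src j' = dst j ∧ dst j' = src j
  ter_lt : ∀ i < p, ter i < n
  ter_inj : ∀ i < p, ∀ i' < p, ter i = ter i' → i = i'
  p_pos : 0 < p

namespace Net

variable (D : Net)

/-- Adjacency of vertices. -/
def Adj (a b : ℕ) : Prop := ∃ j < D.m2, D.src j = a ∧ D.dst j = b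

/-- `A` is a connected set of vertices that contains `v`, expressed by cuts: a set that contains `v`
and that no arc within `A` leaves contains all of `A`. -/
def Con (A : Finset ℕ) (v : ℕ) : Prop :=
  v ∈ A ∧ ∀ B : Set ℕ, v ∈ B → (∀ u ∈ B, u ∈ A → ∀ w ∈ A, D.Adj u w → w ∈ B) → ∀ w ∈ A, w ∈ B

variable {D}

theorem Adj.symm {a b : ℕ} (h : D.Adj a b) : D.Adj b a := by
  obtain ⟨j, hj, rfl, rfl⟩ := h
  exact D.symm j hj

theorem Adj.left_lt {a b : ℕ} (h : D.Adj a b) : a < D.n := by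
  obtain ⟨j, hj, rfl, rfl⟩ := h
  exact D.src_lt j hj

theorem Adj.right_lt {a b : ℕ} (h : D.Adj a b) : b < D.n := h.symm.left_lt

theorem Con.singleton (v : ℕ) : D.Con {v} v :=
  ⟨Finset.mem_singleton_self v, fun B hv _ w hw => by rwa [Finset.mem_singleton.1 hw]⟩

theorem Con.root_change {A : Finset ℕ} {u v : ℕ} (h : D.Con A v) (hu : u ∈ A) : D.Con A u := by
  refine ⟨hu, fun B huB hB => ?_⟩
  by_cases hv : v ∈ B
  · exact h.2 B hv hB
  -- otherwise the complement of `B` is closed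
  · exact absurd huB (h.2 Bᶜ hv (fun x hx hxA w hw hxw hwB => hx (hB w hwB hw x hxA hxw.symm)) u hu)

theorem Con.join {A B : Finset ℕ} {u v : ℕ} (hA : D.Con A v) (hB : D.Con B u) (h : D.Adj v u) :
    D.Con (A ∪ B) v := by
  refine ⟨Finset.mem_union_left _ hA.1, fun C hv hC => ?_⟩
  have h1 := hA.2 C hv fun x hx hxA w hw => hC x hx (Finset.mem_union_left _ hxA) w
    (Finset.mem_union_left _ hw)
  have h2 := hB.2 C (hC v hv (Finset.mem_union_left _ hA.1) u (Finset.mem_union_right _ hB.1) h)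
    fun x hx hxA w hw => hC x hx (Finset.mem_union_right _ hxA) w (Finset.mem_union_right _ hw)
  intro w hw
  exact (Finset.mem_union.1 hw).elim (h1 w) (h2 w)

theorem Con.insert {A : Finset ℕ} {v x b : ℕ} (hA : D.Con A v) (hx : x ∈ A) (h : D.Adj x b) :
    D.Con (insert b A) v := by
  have := ((hA.root_change hx).join (Con.singleton b) h).root_change
    (Finset.mem_union_left _ hA.1)
  rwa [Finset.union_comm] at this

/-- Trees with a root, built by hanging one tree below the root of another one. -/
inductive RootedTree (D : Net) : Finset ℕ → ℕ → Prop
  | single (v : ℕ) : RootedTree D {v} v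
  | join {A B : Finset ℕ} {v u : ℕ} (hA : RootedTree D A v) (hB : RootedTree D B u)
      (h : D.Adj v u) (hd : Disjoint A B) : RootedTree D (A ∪ B) v

theorem RootedTree.root_mem {A : Finset ℕ} {v : ℕ} (h : D.RootedTree A v) : v ∈ A := by
  induction h with
  | single v => exact Finset.mem_singleton_self v
  | join _ _ _ _ ih _ => exact Finset.mem_union_left _ ih

theorem RootedTree.insert {A : Finset ℕ} {v x y : ℕ} (h : D.RootedTree A v) (hx : x ∈ A)
    (hy : y ∉ A) (hxy : D.Adj x y) : D.RootedTree (insert y A) v := by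
  induction h with
  | single v =>
    rw [Finset.mem_singleton] at hx
    subst hx
    have := RootedTree.join (RootedTree.single (D := D) x) (.single y) hxy
      (by simpa [eq_comm] using hy)
    rwa [Finset.union_comm] at this
  | @join A B v u hA hB h hd ihA ihB =>
    rw [Finset.mem_union, not_or] at hy
    rcases Finset.mem_union.1 hx with hx | hx
    · have := RootedTree.join (ihA hx hy.1) hB h (by
        rw [Finset.disjoint_insert_left]; exact ⟨hy.2, hd⟩)
      rwa [Finset.insert_union] at this
    · have := RootedTree.join hA (ihB hx hy.2) h (by
        rw [Finset.disjoint_insert_right]; exact ⟨hy.1, hd⟩)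
      rwa [Finset.union_insert] at this

/-- A connected set has a spanning tree with a given root. -/
theorem Con.rootedTree {A : Finset ℕ} {v : ℕ} (h : D.Con A v) : D.RootedTree A v := by
  classical
  -- a largest tree with root `v` within `A`
  obtain ⟨B, hB, hmax⟩ := Finset.exists_max_image
    (A.powerset.filter fun B => D.RootedTree B v) Finset.card
    ⟨{v}, by simpa using ⟨h.1, RootedTree.single v⟩⟩
  rw [Finset.mem_filter, Finset.mem_powerset] at hB
  have hAB : ∀ w ∈ A, w ∈ (B : Set ℕ) := by
    refine h.2 _ hB.2.root_mem fun x hx _ w hw hxw => ?_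
    by_contra hwB
    have := hmax (Insert.insert w B) (by
      rw [Finset.mem_filter, Finset.mem_powerset]
      exact ⟨Finset.insert_subset hw hB.1, hB.2.insert hx hwB hxw⟩)
    rw [Finset.card_insert_of_notMem hwB] at this
    omega
  rw [show A = B from Finset.Subset.antisymm hAB hB.1]
  exact hB.2

variable (D)

/-- The closed neighbourhood. -/
noncomputable def nbd (A : Finset ℕ) : Finset ℕ :=
  open Classical in (Finset.range D.n).filter fun v => v ∈ A ∨ ∃ u ∈ A, D.Adj u v

/-- `A` is the vertex set of a connected subgraph that contains the terminals. -/
def Sol (A : Finset ℕ) : Prop :=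
  A ⊆ Finset.range D.n ∧ D.Con A (D.ter 0) ∧ ∀ i < D.p, D.ter i ∈ A

/-- `A` is the vertex set of a solution with the costs `om` and the bounds `k` and `C`. -/
def YesSet (om : ℕ → ℕ) (k C : ℕ) (A : Finset ℕ) : Prop :=
  D.Sol A ∧ (D.nbd A).card ≤ k ∧ ∑ v ∈ D.nbd A, om v ≤ C

variable {D}

theorem mem_nbd {A : Finset ℕ} {v : ℕ} :
    v ∈ D.nbd A ↔ v < D.n ∧ (v ∈ A ∨ ∃ u ∈ A, D.Adj u v) := by
  simp [nbd]

theorem nbd_mono {A B : Finset ℕ} (h : A ⊆ B) : D.nbd A ⊆ D.nbd B := by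
  intro v
  rw [mem_nbd, mem_nbd]
  rintro ⟨hv, hA | ⟨u, hu, huv⟩⟩
  exacts [⟨hv, .inl (h hA)⟩, ⟨hv, .inr ⟨u, h hu, huv⟩⟩]

/-! ### Steiner trees by dynamic programming over sets of terminals -/

/-- The sets with the bit representations `Y` and `Z` are disjoint. -/
def BitDisjoint (Y Z : ℕ) : Prop := ∀ i, Y.testBit i = true → Z.testBit i = false

theorem BitDisjoint.testBit_add {Y Z : ℕ} (h : BitDisjoint Y Z) (i : ℕ) :
    (Y + Z).testBit i = (Y.testBit i || Z.testBit i) := by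
  induction i generalizing Y Z with
  | zero =>
    have := h 0
    simp only [Nat.testBit_zero, decide_eq_true_eq, decide_eq_false_iff_not] at this ⊢
    rw [← Bool.decide_or, decide_eq_decide]
    omega
  | succ i ih =>
    have h0 := h 0
    simp only [Nat.testBit_zero, decide_eq_true_eq, decide_eq_false_iff_not] at h0
    rw [Nat.testBit_add_one, Nat.testBit_add_one, Nat.testBit_add_one,
      show (Y + Z) / 2 = Y / 2 + Z / 2 by omega]
    exact ih fun j hj => by
      rw [← Nat.testBit_add_one] at hj ⊢
      exact h _ hj

variable (D)

/-- There is a connected set of at most `q + 1` vertices that contains `v` and the terminals with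
indices in the bit set `X`. -/
def Reach (X v q : ℕ) : Prop :=
  ∃ A : Finset ℕ, A ⊆ Finset.range D.n ∧ D.Con A v ∧ A.card ≤ q + 1 ∧
    ∀ i < D.p, X.testBit i → D.ter i ∈ A

/-- The entries of the table `d` are realized by connected sets; `n` stands for `∞`. -/
def TableSound (d : ℕ → ℕ → ℕ) : Prop :=
  ∀ X < 2 ^ D.p, ∀ v < D.n, d X v ≤ D.n ∧ (d X v < D.n → D.Reach X v (d X v))

/-- The table `d` takes account of all trees with at most `t + 1` vertices. -/
def TableComplete (t : ℕ) (d : ℕ → ℕ → ℕ) : Prop :=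
  ∀ A v, D.RootedTree A v → A ⊆ Finset.range D.n → A.card ≤ t + 1 → ∀ X < 2 ^ D.p,
    (∀ i < D.p, X.testBit i → D.ter i ∈ A) → d X v + 1 ≤ A.card

variable {D}

theorem Reach.join {Y Z v u q q' : ℕ} (h : D.Reach Y v q) (h' : D.Reach Z u q') (huv : D.Adj v u)
    (hYZ : BitDisjoint Y Z) : D.Reach (Y + Z) v (q + q' + 1) := by
  obtain ⟨A, hA, hA', hA'', hAX⟩ := h
  obtain ⟨B, hB, hB', hB'', hBX⟩ := h'
  refine ⟨A ∪ B, Finset.union_subset hA hB, hA'.join hB' huv,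
    (Finset.card_union_le _ _).trans (by omega), fun i hi hX => ?_⟩
  rw [hYZ.testBit_add, Bool.or_eq_true] at hX
  rw [Finset.mem_union]
  exact hX.imp (hAX i hi) (hBX i hi)

/-- A bit set is the disjoint sum of its parts inside and outside of a given set of indices. -/
theorem exists_split_bits (X : ℕ) (S : Set ℕ) :
    ∃ Y Z : ℕ, BitDisjoint Y Z ∧ Y + Z = X ∧ (∀ i, Y.testBit i → X.testBit i ∧ i ∉ S) ∧
      ∀ i, Z.testBit i → X.testBit i ∧ i ∈ S := by
  classical
  have key (f : ℕ → Bool) (N : ℕ) : ∃ Y : ℕ, ∀ i, Y.testBit i = (decide (i < N) && f i) := by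
    induction N with
    | zero => exact ⟨0, by simp⟩
    | succ N ih =>
      obtain ⟨Y, hY⟩ := ih
      refine ⟨Y ||| (if f N then 2 ^ N else 0), fun i => ?_⟩
      rw [Nat.testBit_or, hY]
      rcases lt_trichotomy i N with h | rfl | h
      · have h1 : i < N + 1 := by omega
        have h2 : N ≠ i := by omega
        cases hf : f N <;> simp [h, h1, h2]
      · cases hf : f i <;> simp
      · have h1 : ¬ i < N + 1 := by omega
        have h2 : N ≠ i := by omega
        have h3 : ¬ i < N := by omega
        cases hf : f N <;> simp [h1, h2, h3]
  obtain ⟨Y, hY⟩ := key (fun i => X.testBit i && decide (i ∉ S)) X.size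
  obtain ⟨Z, hZ⟩ := key (fun i => X.testBit i && decide (i ∈ S)) X.size
  have hlt : ∀ i, X.testBit i = true → i < X.size := fun i hi => by
    by_contra h
    rw [Nat.testBit_lt_two_pow ((Nat.lt_size_self X).trans_le
      (Nat.pow_le_pow_right two_pos (not_lt.1 h)))] at hi
    exact absurd hi (by simp)
  have h0 : BitDisjoint Y Z := by
    intro i
    rw [hY, hZ]
    by_cases hi : i ∈ S <;> simp [hi]
  refine ⟨Y, Z, h0, ?_, fun i hi => ?_, fun i hi => ?_⟩
  · refine Nat.eq_of_testBit_eq fun i => ?_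
    rw [h0.testBit_add, hY, hZ]
    by_cases hi : i ∈ S <;> cases hX : X.testBit i <;> simp [hi, hlt, hX]
  · rw [hY] at hi; simp at hi; exact hi.2
  · rw [hZ] at hi; simp at hi; exact hi.2

theorem RootedTree.card_pos {A : Finset ℕ} {v : ℕ} (h : D.RootedTree A v) : 0 < A.card :=
  Finset.card_pos.2 ⟨v, h.root_mem⟩

/-- One round of relaxations of the table over all disjoint pairs of bit sets and all arcs. -/
theorem TableComplete.relax {t : ℕ} {d d' : ℕ → ℕ → ℕ} (h : D.TableComplete t d)
    (hle : ∀ X < 2 ^ D.p, ∀ v < D.n, d' X v ≤ d X v)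
    (hr : ∀ Y < 2 ^ D.p, ∀ Z < 2 ^ D.p, BitDisjoint Y Z → ∀ j < D.m2,
      d' (Y + Z) (D.src j) ≤ d Y (D.src j) + d Z (D.dst j) + 1) : D.TableComplete (t + 1) d' := by
  intro A v hA hAn hc X hX hXA
  rcases hA with _ | @⟨A, B, _, u, hA, hB, huv, hd⟩
  · exact (Nat.add_le_add_right (hle X hX v (by simpa using hAn)) 1).trans
      (h _ _ (.single v) hAn (by simp) X hX hXA)
  · rw [Finset.card_union_of_disjoint hd] at hc ⊢
    have hA0 := hA.card_pos
    have hB0 := hB.card_pos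
    obtain ⟨Y, Z, hYZ, rfl, hY, hZ⟩ := exists_split_bits X {i | D.ter i ∈ B}
    obtain ⟨j, hj, rfl, rfl⟩ := huv
    have h1 := h A _ hA (Finset.union_subset_left hAn) (by omega) Y (by omega) fun i hi hYi => by
      obtain ⟨h2, h3⟩ := hY i hYi
      exact (Finset.mem_union.1 (hXA i hi h2)).resolve_right h3
    have h2 := h B _ hB (Finset.union_subset_right hAn) (by omega) Z (by omega)
      fun i _ hZi => (hZ i hZi).2
    have h3 := hr Y (by omega) Z (by omega) hYZ j hj
    omega

/-- The table at the beginning: trees with one vertex, which contain at most one terminal. -/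
theorem tableComplete_zero {d : ℕ → ℕ → ℕ} (h0 : ∀ v < D.n, d 0 v = 0)
    (h1 : ∀ i < D.p, d (2 ^ i) (D.ter i) = 0) : D.TableComplete 0 d := by
  intro A v hA hAn hc X hX hXA
  have hv := hA.root_mem
  have hAv : ∀ w ∈ A, w = v := fun w hw => Finset.card_le_one.1 hc w hw v hv
  have hA0 := hA.card_pos
  suffices d X v = 0 by omega
  by_cases hX0 : X = 0
  · rw [hX0]; exact h0 v (Finset.mem_range.1 (hAn hv))
  obtain ⟨i, hi⟩ : ∃ i, X.testBit i = true := Nat.exists_testBit_of_ne_zero hX0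
  have hlt : ∀ i, X.testBit i = true → i < D.p := fun i hi => by
    by_contra h
    rw [Nat.testBit_lt_two_pow (hX.trans_le (Nat.pow_le_pow_right two_pos (not_lt.1 h)))] at hi
    exact absurd hi (by simp)
  have hiv : D.ter i = v := hAv _ (hXA i (hlt i hi) hi)
  have : X = 2 ^ i := by
    refine Nat.eq_of_testBit_eq fun j => ?_
    rw [Nat.testBit_two_pow]
    by_cases hij : i = j
    · subst hij; simp [hi]
    · rw [decide_eq_false hij]
      by_contra hj
      rw [Bool.not_eq_false] at hj
      exact hij (D.ter_inj i (hlt i hi) j (hlt j hj) (hiv.trans (hAv _ (hXA j (hlt j hj) hj)).symm))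
  rw [this, ← hiv]
  exact h1 i (hlt i hi)

theorem TableSound.exists_sol {d : ℕ → ℕ → ℕ} (h : D.TableSound d)
    (hlt : d (2 ^ D.p - 1) (D.ter 0) < D.n) :
    ∃ A, D.Sol A ∧ A.card ≤ d (2 ^ D.p - 1) (D.ter 0) + 1 := by
  obtain ⟨A, hA, hc, hcard, hX⟩ := (h (2 ^ D.p - 1) (by have := Nat.two_pow_pos D.p; omega)
    (D.ter 0) (D.ter_lt 0 D.p_pos)).2 hlt
  exact ⟨A, ⟨hA, hc, fun i hi => hX i hi (by simp [Nat.testBit_two_pow_sub_one, hi])⟩, hcard⟩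

theorem TableComplete.card_sol {d : ℕ → ℕ → ℕ} (h : D.TableComplete D.n d) {A : Finset ℕ}
    (hA : D.Sol A) : d (2 ^ D.p - 1) (D.ter 0) + 1 ≤ A.card := by
  have : A.card ≤ D.n := by simpa using Finset.card_le_card hA.1
  exact h A _ hA.2.1.rootedTree hA.1 (by omega) _ (by have := Nat.two_pow_pos D.p; omega)
    fun i hi _ => hA.2.2 i hi

end Net

/-! ### Exploration of a solution with advice -/

/-- The state of an exploration: the status of the vertices (`0` undecided, `1` included,
otherwise excluded), the queue of the included vertices and its length, and the unread advice. -/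
structure Search where
  st : ℕ → ℕ
  q : ℕ → ℕ
  tl : ℕ
  adv : ℕ

namespace Search

/-- Include the vertex `b`. -/
def incl (c : Search) (b : ℕ) : Search :=
  { c with st := Function.update c.st b 1, q := Function.update c.q c.tl b, tl := c.tl + 1 }

/-- Exclude the vertex `b`. -/
def excl (c : Search) (b : ℕ) : Search := { c with st := Function.update c.st b 2 }

/-- Decide about the vertex `b` by the next bit of the advice. -/
def ask (c : Search) (b : ℕ) : Search :=
  if c.adv % 2 = 0 then excl { c with adv := c.adv / 2 } b else incl { c with adv := c.adv / 2 } b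

end Search

namespace Net

variable (D : Net)

open Classical in
/-- Decide about the head of the arc `j` if its tail is `x` and its head is undecided: the head is
included if `f`, and the advice is asked otherwise. -/
noncomputable def arcStep (x : ℕ) (f : Prop) (c : Search) (j : ℕ) : Search :=
  if D.src j = x ∧ c.st (D.dst j) = 0 then
    if f then c.incl (D.dst j) else c.ask (D.dst j)
  else c

/-- Decide about all the undecided neighbours of `x` along the first arcs. -/
noncomputable def scan (x : ℕ) (f : Prop) (c : Search) : ℕ → Search
  | 0 => c
  | j + 1 => D.arcStep x f (scan x f c j) j

/-- The vertex `x` has two undecided neighbours. -/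
def TwoOpen (c : Search) (x : ℕ) : Prop :=
  ∃ a b, D.Adj x a ∧ D.Adj x b ∧ c.st a = 0 ∧ c.st b = 0 ∧ a ≠ b

/-- The vertex `x` is not a terminal and has at most one undecided neighbour. In this case the
neighbour has to be included. -/
def Forced (c : Search) (x : ℕ) : Prop := (∀ i < D.p, D.ter i ≠ x) ∧ ¬ D.TwoOpen c x

/-- Process the vertex in position `h` of the queue. -/
noncomputable def round (h : ℕ) (c : Search) : Search :=
  if h < c.tl then D.scan (c.q h) (D.Forced c (c.q h)) c D.m2 else c

/-- The exploration starts with the first terminal. -/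
def start (a : ℕ) : Search where
  st := Function.update (fun _ => 0) (D.ter 0) 1
  q := fun _ => D.ter 0
  tl := 1
  adv := a

/-- The exploration with the advice `a` after the given number of rounds. -/
noncomputable def explore (a : ℕ) : ℕ → Search
  | 0 => D.start a
  | h + 1 => D.round h (explore a h)

/-- The set of included vertices. -/
def included (c : Search) : Finset ℕ := (Finset.range D.n).filter fun v => c.st v = 1

/-- The set of decided vertices. -/
def decided (c : Search) : Finset ℕ := (Finset.range D.n).filter fun v => c.st v ≠ 0

/-- The invariant of the exploration, when the vertices in the first `d` positions of the queue have
been processed, and the vertices in the positions from `l` on have no children. -/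
structure SearchInv (d l : ℕ) (c : Search) : Prop where
  lt : ∀ v, c.st v ≠ 0 → v < D.n
  mem_q : ∀ v, c.st v = 1 ↔ ∃ i < c.tl, c.q i = v
  q_inj : ∀ i < c.tl, ∀ i' < c.tl, c.q i = c.q i' → i = i'
  q_zero : c.q 0 = D.ter 0
  tl_pos : 0 < c.tl
  excluded : ∀ v, c.st v ≠ 0 → c.st v ≠ 1 → ∃ u, c.st u = 1 ∧ D.Adj u v
  con : D.Con (D.included c) (D.ter 0)
  leaf : ∀ i, l ≤ i → i < c.tl → i ≠ 0 → D.Con ((D.included c).erase (c.q i)) (D.ter 0)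
  done : ∀ i < d, i < c.tl → ∀ b, D.Adj (c.q i) b → c.st b ≠ 0

/-- `c'` is reached from `c` by further decisions. -/
structure Extends (c c' : Search) : Prop where
  st : ∀ v, c.st v ≠ 0 → c'.st v = c.st v
  tl : c.tl ≤ c'.tl
  q : ∀ i < c.tl, c'.q i = c.q i

variable {D}

theorem mem_included {c : Search} {v : ℕ} : v ∈ D.included c ↔ v < D.n ∧ c.st v = 1 := by
  simp [included]

theorem mem_decided {c : Search} {v : ℕ} : v ∈ D.decided c ↔ v < D.n ∧ c.st v ≠ 0 := by
  simp [decided]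

theorem Extends.refl (c : Search) : Extends c c := ⟨fun _ _ => rfl, le_rfl, fun _ _ => rfl⟩

theorem Extends.trans {c c' c'' : Search} (h : Extends c c') (h' : Extends c' c'') :
    Extends c c'' where
  st v hv := by rw [h'.st v (by rwa [h.st v hv]), h.st v hv]
  tl := h.tl.trans h'.tl
  q i hi := by rw [h'.q i (hi.trans_le h.tl), h.q i hi]

theorem Extends.of_incl {c : Search} {b : ℕ} (hb : c.st b = 0) : Extends c (c.incl b) where
  st v hv := by
    have : v ≠ b := by rintro rfl; exact hv hb
    simp [Search.incl, this]
  tl := Nat.le_succ _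
  q i hi := by simp [Search.incl, hi.ne]

theorem Extends.of_excl {c : Search} {b : ℕ} (hb : c.st b = 0) : Extends c (c.excl b) where
  st v hv := by
    have : v ≠ b := by rintro rfl; exact hv hb
    simp [Search.excl, this]
  tl := le_rfl
  q _ _ := rfl

theorem included_incl {c : Search} {b : ℕ} (hb : b < D.n) :
    D.included (c.incl b) = insert b (D.included c) := by
  ext v
  rw [Finset.mem_insert, mem_included, mem_included]
  by_cases hv : v = b
  · subst hv; simp [Search.incl, hb]
  · simp [Search.incl, hv]

theorem included_excl {c : Search} {b : ℕ} (hb : c.st b = 0) :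
    D.included (c.excl b) = D.included c := by
  ext v
  rw [mem_included, mem_included]
  by_cases hv : v = b
  · subst hv; simp [Search.excl, hb]
  · simp [Search.excl, hv]

theorem card_decided_incl {c : Search} {b : ℕ} (hb : b < D.n) (h0 : c.st b = 0) :
    (D.decided (c.incl b)).card = (D.decided c).card + 1 := by
  have : D.decided (c.incl b) = insert b (D.decided c) := by
    ext v
    rw [Finset.mem_insert, mem_decided, mem_decided]
    by_cases hv : v = b
    · subst hv; simp [Search.incl, hb]
    · simp [Search.incl, hv]
  rw [this, Finset.card_insert_of_notMem (by simp [mem_decided, h0])]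

theorem card_decided_excl {c : Search} {b : ℕ} (hb : b < D.n) (h0 : c.st b = 0) :
    (D.decided (c.excl b)).card = (D.decided c).card + 1 := by
  have : D.decided (c.excl b) = insert b (D.decided c) := by
    ext v
    rw [Finset.mem_insert, mem_decided, mem_decided]
    by_cases hv : v = b
    · subst hv; simp [Search.excl, hb]
    · simp [Search.excl, hv]
  rw [this, Finset.card_insert_of_notMem (by simp [mem_decided, h0])]

theorem SearchInv.incl {d l h b : ℕ} {c : Search} (H : D.SearchInv d l c) (hd : d ≤ h)
    (hh : h < c.tl) (hl : h < l) (hb : D.Adj (c.q h) b) (h0 : c.st b = 0) : D.SearchInv d l (c.incl b) := by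
  have hE := Extends.of_incl h0
  have hbn := hb.right_lt
  have hx : c.st (c.q h) = 1 := (H.mem_q _).2 ⟨h, hh, rfl⟩
  have hxI : c.q h ∈ D.included c := mem_included.2 ⟨hb.left_lt, hx⟩
  have hqb : ∀ i < c.tl, c.q i ≠ b := fun i hi hib => by
    have := (H.mem_q b).2 ⟨i, hi, hib⟩
    omega
  have hqt : (c.incl b).q c.tl = b := by simp [Search.incl]
  have hst : ∀ v, v ≠ b → (c.incl b).st v = c.st v := fun v hv => by simp [Search.incl, hv]
  have hstb : (c.incl b).st b = 1 := by simp [Search.incl]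
  have htl : (c.incl b).tl = c.tl + 1 := rfl
  constructor
  · intro v hv
    by_cases hvb : v = b
    · rwa [hvb]
    · rw [hst v hvb] at hv; exact H.lt v hv
  · intro v
    by_cases hvb : v = b
    · subst hvb
      exact ⟨fun _ => ⟨c.tl, Nat.lt_succ_self _, hqt⟩, fun _ => hstb⟩
    · rw [hst v hvb, H.mem_q]
      constructor
      · rintro ⟨i, hi, rfl⟩
        exact ⟨i, hi.trans (Nat.lt_succ_self _), hE.q i hi⟩
      · rintro ⟨i, hi, rfl⟩
        rcases Nat.lt_succ_iff_lt_or_eq.1 hi with hi | rfl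
        · exact ⟨i, hi, (hE.q i hi).symm⟩
        · exact absurd hqt hvb
  · intro i hi i' hi' hii
    rw [htl] at hi hi'
    rcases Nat.lt_succ_iff_lt_or_eq.1 hi with h1 | rfl <;>
      rcases Nat.lt_succ_iff_lt_or_eq.1 hi' with h2 | rfl
    · rw [hE.q i h1, hE.q i' h2] at hii
      exact H.q_inj i h1 i' h2 hii
    · rw [hE.q i h1, hqt] at hii
      exact absurd hii (hqb i h1)
    · rw [hE.q i' h2, hqt] at hii
      exact absurd hii.symm (hqb i' h2)
    · rfl
  · rw [hE.q 0 H.tl_pos, H.q_zero]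
  · exact Nat.succ_pos _
  · intro v hv hv1
    by_cases hvb : v = b
    · exact absurd (hvb ▸ hstb) hv1
    · rw [hst v hvb] at hv hv1
      obtain ⟨u, hu, huv⟩ := H.excluded v hv hv1
      exact ⟨u, by rw [hE.st u (by omega), hu], huv⟩
  · rw [included_incl hbn]
    exact H.con.insert hxI hb
  · intro i hli hi hi0
    rw [included_incl hbn]
    rcases Nat.lt_succ_iff_lt_or_eq.1 hi with hi | rfl
    · rw [hE.q i hi, Finset.erase_insert_of_ne (hqb i hi).symm]
      refine (H.leaf i hli hi hi0).insert (Finset.mem_erase.2 ⟨fun hc => ?_, hxI⟩) hb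
      have := H.q_inj _ hh _ hi hc
      omega
    · rw [hqt, Finset.erase_insert (by simp [mem_included, h0])]
      exact H.con
  · intro i hi hit b' hb'
    rcases Nat.lt_succ_iff_lt_or_eq.1 hit with h1 | rfl
    · rw [hE.q i h1] at hb'
      rw [hE.st b' (H.done i hi h1 b' hb')]
      exact H.done i hi h1 b' hb'
    · omega

theorem SearchInv.excl {d l h b : ℕ} {c : Search} (H : D.SearchInv d l c) (hh : h < c.tl)
    (hb : D.Adj (c.q h) b) (h0 : c.st b = 0) : D.SearchInv d l (c.excl b) := by
  have hE := Extends.of_excl h0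
  have hx : c.st (c.q h) = 1 := (H.mem_q _).2 ⟨h, hh, rfl⟩
  have hst : ∀ v, v ≠ b → (c.excl b).st v = c.st v := fun v hv => by simp [Search.excl, hv]
  have hstb : (c.excl b).st b = 2 := by simp [Search.excl]
  constructor
  · intro v hv
    by_cases hvb : v = b
    · rw [hvb]; exact hb.right_lt
    · rw [hst v hvb] at hv; exact H.lt v hv
  · intro v
    rw [show (∃ i < (c.excl b).tl, (c.excl b).q i = v) ↔ _ from (H.mem_q v).symm]
    by_cases hvb : v = b
    · subst hvb; simp [hstb, h0]
    · rw [hst v hvb]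
  · exact H.q_inj
  · exact H.q_zero
  · exact H.tl_pos
  · intro v hv hv1
    by_cases hvb : v = b
    · subst hvb
      exact ⟨c.q h, by rw [hE.st _ (by omega), hx], hb⟩
    · rw [hst v hvb] at hv hv1
      obtain ⟨u, hu, huv⟩ := H.excluded v hv hv1
      exact ⟨u, by rw [hE.st u (by omega), hu], huv⟩
  · rw [included_excl h0]; exact H.con
  · rw [included_excl h0]; exact H.leaf
  · intro i hi hit b' hb'
    have := H.done i hi hit b' hb'
    rw [hE.st b' this]
    exact this

/-- The advice does not matter for the invariant. -/
theorem SearchInv.set_adv {d l : ℕ} {c : Search} (H : D.SearchInv d l c) (a : ℕ) :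
    D.SearchInv d l { c with adv := a } :=
  ⟨H.lt, H.mem_q, H.q_inj, H.q_zero, H.tl_pos, H.excluded, H.con, H.leaf, H.done⟩

theorem SearchInv.weaken {d l l' : ℕ} {c : Search} (H : D.SearchInv d l c) (hl : l ≤ l') :
    D.SearchInv d l' c :=
  ⟨H.lt, H.mem_q, H.q_inj, H.q_zero, H.tl_pos, H.excluded, H.con,
    fun i hi => H.leaf i (hl.trans hi), H.done⟩

theorem arcStep_cases (D : Net) (x : ℕ) (f : Prop) (c : Search) (j : ℕ) :
    (¬ (D.src j = x ∧ c.st (D.dst j) = 0) ∧ D.arcStep x f c j = c) ∨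
    ((D.src j = x ∧ c.st (D.dst j) = 0) ∧ ∃ a,
      (D.arcStep x f c j = Search.incl { c with adv := a } (D.dst j) ∨
        D.arcStep x f c j = Search.excl { c with adv := a } (D.dst j))) := by
  unfold arcStep
  split_ifs with h hf
  · exact .inr ⟨h, c.adv, .inl rfl⟩
  · refine .inr ⟨h, c.adv / 2, ?_⟩
    unfold Search.ask
    split_ifs
    exacts [.inr rfl, .inl rfl]
  · exact .inl ⟨h, rfl⟩

theorem SearchInv.scan {h : ℕ} {c : Search} (H : D.SearchInv h h c) (hh : h < c.tl) (f : Prop)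
    (j : ℕ) (hj : j ≤ D.m2) :
    D.SearchInv h (h + 1) (D.scan (c.q h) f c j) ∧ Extends c (D.scan (c.q h) f c j) ∧
      ∀ j' < j, D.src j' = c.q h → (D.scan (c.q h) f c j).st (D.dst j') ≠ 0 := by
  induction j with
  | zero => exact ⟨H.weaken (Nat.le_succ h), .refl c, fun j' hj' => absurd hj' (Nat.not_lt_zero _)⟩
  | succ j ih =>
    obtain ⟨h1, h2, h3⟩ := ih (by omega)
    have hq := h2.q h hh
    rw [Net.scan]
    set c₁ := D.scan (c.q h) f c j
    rcases arcStep_cases D (c.q h) f c₁ j with ⟨hn, he⟩ | ⟨⟨hs, h0⟩, a, he⟩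
    · rw [he]
      refine ⟨h1, h2, fun j' hj' hsj => ?_⟩
      rcases Nat.lt_succ_iff_lt_or_eq.1 hj' with hj' | rfl
      · exact h3 j' hj' hsj
      · exact fun h0 => hn ⟨hsj, h0⟩
    · have hadj : D.Adj (Search.q { c₁ with adv := a } h) (D.dst j) :=
        ⟨j, by omega, hs.trans hq.symm, rfl⟩
      have hext : Extends c { c₁ with adv := a } := ⟨h2.st, h2.tl, h2.q⟩
      have key : ∀ c₂, Extends { c₁ with adv := a } c₂ → c₂.st (D.dst j) ≠ 0 →
          ∀ j' < j + 1, D.src j' = c.q h → c₂.st (D.dst j') ≠ 0 := by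
        intro c₂ hE hd j' hj' hsj
        rcases Nat.lt_succ_iff_lt_or_eq.1 hj' with hj' | rfl
        · have := h3 j' hj' hsj
          rw [hE.st _ this]
          exact this
        · exact hd
      rcases he with he | he
      · rw [he]
        have hE := Extends.of_incl (c := { c₁ with adv := a }) h0
        exact ⟨(h1.set_adv a).incl le_rfl (hh.trans_le h2.tl) (Nat.lt_succ_self h) hadj h0,
          hext.trans hE, key _ hE (by simp [Search.incl])⟩
      · rw [he]
        have hE := Extends.of_excl (c := { c₁ with adv := a }) h0
        exact ⟨(h1.set_adv a).excl (hh.trans_le h2.tl) hadj h0, hext.trans hE,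
          key _ hE (by simp [Search.excl])⟩

theorem SearchInv.round {h : ℕ} {c : Search} (H : D.SearchInv h h c) :
    D.SearchInv (h + 1) (h + 1) (D.round h c) ∧ Extends c (D.round h c) := by
  unfold Net.round
  split_ifs with hh
  · obtain ⟨h1, h2, h3⟩ := H.scan hh (D.Forced c (c.q h)) D.m2 le_rfl
    refine ⟨⟨h1.lt, h1.mem_q, h1.q_inj, h1.q_zero, h1.tl_pos, h1.excluded, h1.con, h1.leaf,
      fun i hi hit b hb => ?_⟩, h2⟩
    rcases Nat.lt_succ_iff_lt_or_eq.1 hi with hi | rfl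
    · exact h1.done i hi hit b hb
    · rw [h2.q i hh] at hb
      obtain ⟨j, hj, hs, rfl⟩ := hb
      exact h3 j hj hs
  · refine ⟨⟨H.lt, H.mem_q, H.q_inj, H.q_zero, H.tl_pos, H.excluded, H.con,
      fun i hi => H.leaf i (by omega), fun i hi hit => H.done i (by omega) hit⟩, .refl c⟩

theorem searchInv_start (D : Net) (a : ℕ) : D.SearchInv 0 0 (D.start a) := by
  have hs : ∀ v, (D.start a).st v ≠ 0 → v = D.ter 0 := fun v hv => by
    by_contra h
    exact hv (by simp [start, h])
  have h1 : (D.start a).st (D.ter 0) = 1 := by simp [start]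
  have hI : D.included (D.start a) = {D.ter 0} := by
    ext v
    rw [mem_included, Finset.mem_singleton]
    refine ⟨fun h => hs v (by omega), ?_⟩
    rintro rfl
    exact ⟨D.ter_lt 0 D.p_pos, h1⟩
  constructor
  · intro v hv
    rw [hs v hv]
    exact D.ter_lt 0 D.p_pos
  · intro v
    refine ⟨fun hv => ⟨0, Nat.one_pos, (hs v (by omega)).symm⟩, ?_⟩
    rintro ⟨i, -, rfl⟩
    exact h1
  · intro i hi i' hi' _
    change i < 1 at hi
    change i' < 1 at hi'
    omega
  · rfl
  · exact Nat.one_pos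
  · intro v hv hv1
    exact absurd (hs v hv ▸ h1) hv1
  · rw [hI]; exact .singleton _
  · intro i _ hi hi0
    change i < 1 at hi
    omega
  · intro i hi
    omega

theorem searchInv_explore (D : Net) (a h : ℕ) : D.SearchInv h h (D.explore a h) := by
  induction h with
  | zero => exact searchInv_start D a
  | succ h ih => exact ih.round.1

theorem SearchInv.tl_le {d l : ℕ} {c : Search} (H : D.SearchInv d l c) : c.tl ≤ D.n := by
  have : ((Finset.range c.tl).image c.q).card = c.tl := by
    rw [Finset.card_image_of_injOn, Finset.card_range]
    intro i hi i' hi'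
    exact H.q_inj i (by simpa using hi) i' (by simpa using hi')
  rw [← this, ← Finset.card_range D.n]
  refine Finset.card_le_card fun v hv => ?_
  obtain ⟨i, hi, rfl⟩ := Finset.mem_image.1 hv
  have := (H.mem_q (c.q i)).2 ⟨i, Finset.mem_range.1 hi, rfl⟩
  exact Finset.mem_range.2 (H.lt _ (by omega))

/-- When all the included vertices have been processed, the decided vertices are the closed
neighbourhood of the included ones. -/
theorem SearchInv.decided_eq {l : ℕ} {c : Search} (H : D.SearchInv D.n l c) :
    D.decided c = D.nbd (D.included c) := by
  ext v
  rw [mem_decided, mem_nbd]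
  refine and_congr_right fun hv => ⟨fun h0 => ?_, ?_⟩
  · by_cases h1 : c.st v = 1
    · exact .inl (mem_included.2 ⟨hv, h1⟩)
    · obtain ⟨u, hu, huv⟩ := H.excluded v h0 h1
      exact .inr ⟨u, mem_included.2 ⟨huv.left_lt, hu⟩, huv⟩
  · rintro (hI | ⟨u, hu, huv⟩)
    · rw [mem_included] at hI
      omega
    · obtain ⟨i, hi, rfl⟩ := (H.mem_q u).1 (mem_included.1 hu).2
      exact H.done i (hi.trans_le H.tl_le) hi v huv

/-- The exploration finds only solutions. -/
theorem yesSet_of_explore {om : ℕ → ℕ} {k C a : ℕ}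
    (hter : ∀ i < D.p, (D.explore a D.n).st (D.ter i) = 1)
    (hk : (D.decided (D.explore a D.n)).card ≤ k)
    (hC : ∑ v ∈ D.decided (D.explore a D.n), om v ≤ C) :
    D.YesSet om k C (D.included (D.explore a D.n)) := by
  have H := searchInv_explore D a D.n
  rw [H.decided_eq] at hk hC
  exact ⟨⟨Finset.filter_subset _ _, H.con, fun i hi => mem_included.2 ⟨D.ter_lt i hi, hter i hi⟩⟩,
    hk, hC⟩

/-! ### The right advice -/

/-- With the right advice of `β` bits, `f` ends in the state `c` and leaves the rest of the advice
unread. -/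
def Advised (f : ℕ → Search) (c : Search) (β : ℕ) : Prop :=
  ∃ e < 2 ^ β, ∀ a, f (e + 2 ^ β * a) = { c with adv := a }

theorem Advised.comp {f : ℕ → Search} {g : Search → Search} {c c' : Search} {β γ : ℕ}
    (hf : Advised f c β) (hg : Advised (fun a => g { c with adv := a }) c' γ) :
    Advised (fun a => g (f a)) c' (β + γ) := by
  obtain ⟨e, he, hf⟩ := hf
  obtain ⟨e', he', hg⟩ := hg
  refine ⟨e + 2 ^ β * e', ?_, fun a => ?_⟩
  · rw [pow_add]
    calc e + 2 ^ β * e' < 2 ^ β * (e' + 1) := by rw [Nat.mul_add]; omega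
      _ ≤ _ := Nat.mul_le_mul_left _ he'
  · have : e + 2 ^ β * e' + 2 ^ (β + γ) * a = e + 2 ^ β * (e' + 2 ^ γ * a) := by ring
    change g (f _) = _
    rw [this, hf]
    exact hg a

theorem Advised.const {f : ℕ → Search} {c : Search} (h : ∀ a, f a = { c with adv := a }) :
    Advised f c 0 :=
  ⟨0, Nat.one_pos, fun a => by simpa using h a⟩

/-- The state `c` agrees with the solution `T`. -/
structure Agrees (D : Net) (T : Finset ℕ) (c : Search) : Prop where
  incl : ∀ v, c.st v = 1 → v ∈ T
  excl : ∀ v, c.st v ≠ 0 → c.st v ≠ 1 → v ∉ T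

theorem Agrees.of_incl {T : Finset ℕ} {c : Search} {b : ℕ} (h : D.Agrees T c) (hb : b ∈ T) :
    D.Agrees T (c.incl b) := by
  constructor <;> intro v <;> by_cases hv : v = b
  · subst hv; exact fun _ => hb
  · simpa [Search.incl, hv] using h.incl v
  · subst hv; simp [Search.incl]
  · simpa [Search.incl, hv] using h.excl v

theorem Agrees.of_excl {T : Finset ℕ} {c : Search} {b : ℕ} (h : D.Agrees T c) (hb : b ∉ T) :
    D.Agrees T (c.excl b) := by
  constructor <;> intro v <;> by_cases hv : v = b
  · subst hv; simp [Search.excl]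
  · simpa [Search.excl, hv] using h.incl v
  · subst hv; exact fun _ _ => hb
  · simpa [Search.excl, hv] using h.excl v

/-- Without a forced decision, the right advice has one bit for each new decision. -/
theorem exists_advice_scan {T : Finset ℕ} {c : Search} (H : D.Agrees T c) (x : ℕ) (j : ℕ)
    (hj : j ≤ D.m2) : ∃ c' β, Advised (fun a => D.scan x False { c with adv := a } j) c' β ∧
      D.Agrees T c' ∧ (D.decided c').card = (D.decided c).card + β := by
  induction j with
  | zero => exact ⟨c, 0, .const fun a => rfl, H, rfl⟩
  | succ j ih =>
    obtain ⟨c₁, β, hA, hT, hc⟩ := ih (by omega)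
    by_cases hs : D.src j = x ∧ c₁.st (D.dst j) = 0
    · have hb := D.dst_lt j (by omega)
      by_cases hbT : D.dst j ∈ T
      · refine ⟨c₁.incl (D.dst j), β + 1, hA.comp (g := fun c => D.arcStep x False c j)
          ⟨1, by norm_num, fun a => ?_⟩, hT.of_incl hbT, ?_⟩
        · have h1 : (1 + 2 ^ 1 * a) % 2 ≠ 0 := by omega
          have h2 : (1 + 2 ^ 1 * a) / 2 = a := by omega
          simp only [arcStep, hs, and_self, if_true, if_false, Search.ask, h1, h2]
          rfl
        · rw [card_decided_incl hb hs.2, hc, Nat.add_assoc]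
      · refine ⟨c₁.excl (D.dst j), β + 1, hA.comp (g := fun c => D.arcStep x False c j)
          ⟨0, by norm_num, fun a => ?_⟩, hT.of_excl hbT, ?_⟩
        · have h1 : (0 + 2 ^ 1 * a) % 2 = 0 := by omega
          have h2 : (0 + 2 ^ 1 * a) / 2 = a := by omega
          simp only [arcStep, hs, and_self, if_true, if_false, Search.ask, h1, h2]
          rfl
        · rw [card_decided_excl hb hs.2, hc, Nat.add_assoc]
    · refine ⟨c₁, β, hA.comp (g := fun c => D.arcStep x False c j) (.const fun a => ?_), hT, hc⟩
      exact if_neg hs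

/-- Forced decisions agree with the solution if it contains the open neighbours. -/
theorem agrees_scan_forced {T : Finset ℕ} {c : Search} (H : D.Agrees T c) (x : ℕ) (j : ℕ)
    (hj : j ≤ D.m2) (hx : ∀ b, D.Adj x b → c.st b = 0 → b ∈ T) :
    ∃ c', (∀ a, D.scan x True { c with adv := a } j = { c' with adv := a }) ∧ D.Agrees T c' ∧
      ∀ v, c'.st v = 0 → c.st v = 0 := by
  induction j with
  | zero => exact ⟨c, fun a => rfl, H, fun _ => id⟩
  | succ j ih =>
    obtain ⟨c₁, hA, hT, h0⟩ := ih (by omega)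
    by_cases hs : D.src j = x ∧ c₁.st (D.dst j) = 0
    · have hbT : D.dst j ∈ T := hx _ ⟨j, by omega, hs.1, rfl⟩ (h0 _ hs.2)
      refine ⟨c₁.incl (D.dst j), fun a => ?_, hT.of_incl hbT, fun v hv => ?_⟩
      · rw [scan, hA]
        simp only [arcStep, hs, and_self, if_true]
        rfl
      · by_cases hvb : v = D.dst j
        · subst hvb; simp [Search.incl] at hv
        · exact h0 v (by simpa [Search.incl, hvb] using hv)
    · refine ⟨c₁, fun a => ?_, hT, h0⟩
      rw [scan, hA]
      exact if_neg hs

variable (D)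

/-- `T` is connected, but no longer so without one of its vertices that are not terminals. -/
def Tight (T : Finset ℕ) : Prop :=
  T ⊆ Finset.range D.n ∧ D.Con T (D.ter 0) ∧
    ∀ x ∈ T, (∀ i < D.p, D.ter i ≠ x) → ¬ D.Con (T.erase x) (D.ter 0)

open Classical in
/-- The number of processed vertices that are not terminals. -/
noncomputable def inner (h : ℕ) (c : Search) : ℕ :=
  ((Finset.range h).filter fun i => i < c.tl ∧ ∀ i' < D.p, D.ter i' ≠ c.q i).card

variable {D}

/-- An unprocessed vertex that is not a terminal has an undecided neighbour in the solution, because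
it is a cut vertex of the solution. -/
theorem Tight.exists_open {T : Finset ℕ} (hT : D.Tight T) {h : ℕ} {c : Search}
    (H : D.SearchInv h h c) (hA : D.Agrees T c) (hh : h < c.tl)
    (hx : ∀ i < D.p, D.ter i ≠ c.q h) : ∃ b ∈ T, D.Adj (c.q h) b ∧ c.st b = 0 := by
  by_contra! hno
  have hx1 := (H.mem_q _).2 ⟨h, hh, rfl⟩
  have h0 : h ≠ 0 := by
    rintro rfl
    exact hx 0 D.p_pos H.q_zero.symm
  have hleaf := H.leaf h le_rfl hh h0
  have hsub : ∀ w ∈ (D.included c).erase (c.q h), w ∈ T.erase (c.q h) := fun w hw => by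
    rw [Finset.mem_erase, mem_included] at hw
    exact Finset.mem_erase.2 ⟨hw.1, hA.incl w hw.2.2⟩
  refine hT.2.2 _ (hA.incl _ hx1) hx ⟨hsub _ hleaf.1, fun B hB hcl => ?_⟩
  have h1 : ∀ w ∈ (D.included c).erase (c.q h), w ∈ B :=
    hleaf.2 B hB fun u hu huI w hw huw => hcl u hu (hsub u huI) w (hsub w hw) huw
  have h2 := hT.2.1.2 (insert (c.q h) B) (.inr hB) (by
    rintro u hu huT w hw huw
    by_cases hwx : w = c.q h
    · exact .inl hwx
    refine .inr ?_
    by_cases hux : u = c.q h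
    · subst hux
      have hw0 := hno w hw huw
      have hw1 : c.st w = 1 := by
        by_contra hw1
        exact hA.excl w hw0 hw1 hw
      exact h1 w (Finset.mem_erase.2 ⟨hwx, mem_included.2 ⟨huw.right_lt, hw1⟩⟩)
    · exact hcl u (hu.resolve_left hux) (Finset.mem_erase.2 ⟨hux, huT⟩) w
        (Finset.mem_erase.2 ⟨hwx, hw⟩) huw)
  intro w hw
  rw [Finset.mem_erase] at hw
  exact (h2 w hw.2).resolve_left hw.1

theorem inner_succ_le {h : ℕ} {c c' : Search} (hE : Extends c c') (hh : h < c.tl) :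
    D.inner (h + 1) c' ≤ D.inner h c + 1 ∧
      ((∃ i < D.p, D.ter i = c.q h) → D.inner (h + 1) c' ≤ D.inner h c) := by
  classical
  have key : ∀ i ∈ Finset.range h, (i < c'.tl ∧ ∀ i' < D.p, D.ter i' ≠ c'.q i) →
      (i < c.tl ∧ ∀ i' < D.p, D.ter i' ≠ c.q i) := by
    intro i hi hi'
    have : i < c.tl := (Finset.mem_range.1 hi).trans hh
    rw [hE.q i this] at hi'
    exact ⟨this, hi'.2⟩
  have hle : ((Finset.range h).filter fun i => i < c'.tl ∧ ∀ i' < D.p, D.ter i' ≠ c'.q i).card ≤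
      D.inner h c := Finset.card_le_card fun i hi => by
    rw [Finset.mem_filter] at hi ⊢
    exact ⟨hi.1, key i hi.1 hi.2⟩
  unfold inner
  rw [Finset.range_add_one, Finset.filter_insert]
  constructor
  · split_ifs
    · exact (Finset.card_insert_le _ _).trans (Nat.add_le_add_right hle 1)
    · exact hle.trans (Nat.le_succ _)
  · rintro ⟨i, hi, hih⟩
    rw [if_neg fun hc => hc.2 i hi (by rw [hE.q h hh, hih])]
    exact hle

theorem inner_of_tl_le {h : ℕ} {c : Search} (hh : c.tl ≤ h) : D.inner (h + 1) c = D.inner h c := by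
  classical
  unfold inner
  rw [Finset.range_add_one, Finset.filter_insert, if_neg (by omega)]

theorem Extends.decided_subset {c c' : Search} (h : Extends c c') : D.decided c ⊆ D.decided c' :=
  fun v hv => by
    rw [mem_decided] at hv ⊢
    rw [h.st v hv.2]
    exact hv

/-- In a round with the right advice, the number of bits that are read is at most twice the number of
the new decisions, not counting one for a vertex that is not a terminal. -/
theorem Tight.exists_advice_round {T : Finset ℕ} (hT : D.Tight T) {h : ℕ} {c : Search}
    (H : D.SearchInv h h c) (hA : D.Agrees T c) :
    ∃ c' β, Advised (fun a => D.round h { c with adv := a }) c' β ∧ D.Agrees T c' ∧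
      D.SearchInv (h + 1) (h + 1) c' ∧
      β + 2 * D.inner (h + 1) c' + 2 * (D.decided c).card ≤
        2 * (D.decided c').card + 2 * D.inner h c := by
  by_cases hh : h < c.tl
  · -- the invariant holds after the round, and all neighbours are decided then
    have hinv : ∀ {c' : Search} {a a' : ℕ}, D.round h { c with adv := a } = { c' with adv := a' } →
        D.SearchInv (h + 1) (h + 1) c' ∧ Extends c c' := fun {c' a a'} he => by
      obtain ⟨h1, h2⟩ := (H.set_adv a).round
      rw [he] at h1 h2
      exact ⟨h1.set_adv c'.adv, h2.st, h2.tl, h2.q⟩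
    have hround : ∀ a, D.round h { c with adv := a } =
        D.scan (c.q h) (D.Forced c (c.q h)) { c with adv := a } D.m2 := fun a => if_pos hh
    have hdone : ∀ {c' : Search}, D.SearchInv (h + 1) (h + 1) c' → Extends c c' → ∀ b,
        D.Adj (c.q h) b → b ∈ D.decided c' := fun h1 h2 b hb =>
      mem_decided.2 ⟨hb.right_lt, h1.done h (Nat.lt_succ_self h) (hh.trans_le h2.tl) b
        (by rwa [h2.q h hh])⟩
    have hopen : ∀ b, c.st b = 0 → b ∉ D.decided c := fun b hb hb' => (mem_decided.1 hb').2 hb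
    by_cases hF : D.Forced c (c.q h)
    · obtain ⟨b, hbT, hb, hb0⟩ := hT.exists_open H hA hh hF.1
      obtain ⟨c', hc', hA', -⟩ := agrees_scan_forced hA (c.q h) D.m2 le_rfl fun b' hb' hb0' => by
        by_contra hb'T
        exact hF.2 ⟨b, b', hb, hb', hb0, hb0', fun h => hb'T (h ▸ hbT)⟩
      have hc'' : ∀ a, D.round h { c with adv := a } = { c' with adv := a } := fun a => by
        rw [hround, eq_true hF, hc']
      obtain ⟨h1, h2⟩ := hinv (hc'' 0)
      refine ⟨c', 0, .const hc'', hA', h1, ?_⟩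
      have := (inner_succ_le h2 hh (D := D)).1
      have : (D.decided c).card < (D.decided c').card := Finset.card_lt_card
        (Finset.ssubset_iff_subset_ne.2 ⟨h2.decided_subset, fun he =>
          hopen b hb0 (he ▸ hdone h1 h2 b hb)⟩)
      omega
    · obtain ⟨c', β, hc', hA', hβ⟩ := exists_advice_scan hA (c.q h) D.m2 le_rfl
      have hc'' : Advised (fun a => D.round h { c with adv := a }) c' β := by
        obtain ⟨e, he, hf⟩ := hc'
        refine ⟨e, he, fun a => ?_⟩
        change D.round h _ = _
        rw [hround, eq_false hF]
        exact hf a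
      obtain ⟨h1, h2⟩ : D.SearchInv (h + 1) (h + 1) c' ∧ Extends c c' := by
        obtain ⟨e, he, hf⟩ := hc''
        exact hinv (hf 0)
      refine ⟨c', β, hc'', hA', h1, ?_⟩
      by_cases hter : ∃ i < D.p, D.ter i = c.q h
      · have := (inner_succ_le h2 hh).2 hter
        omega
      · have := (inner_succ_le h2 hh (D := D)).1
        have htwo : D.TwoOpen c (c.q h) := by
          by_contra h2
          exact hF ⟨fun i hi he => hter ⟨i, hi, he⟩, h2⟩
        obtain ⟨b, b', hb, hb', hb0, hb0', hbb⟩ := htwo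
        have : (insert b (insert b' (D.decided c))).card ≤ (D.decided c').card := by
          refine Finset.card_le_card ?_
          rw [Finset.insert_subset_iff, Finset.insert_subset_iff]
          exact ⟨hdone h1 h2 b hb, hdone h1 h2 b' hb', h2.decided_subset⟩
        rw [Finset.card_insert_of_notMem (by simp [hbb, hopen b hb0]),
          Finset.card_insert_of_notMem (hopen b' hb0')] at this
        omega
  · refine ⟨c, 0, .const fun a => if_neg hh, hA, ?_, ?_⟩
    · have := H.round.1
      rwa [show D.round h c = c from if_neg hh] at this
    · rw [inner_of_tl_le (by omega)]
      omega

theorem Tight.exists_advice_explore {T : Finset ℕ} (hT : D.Tight T) (h : ℕ) :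
    ∃ c β, Advised (fun a => D.explore a h) c β ∧ D.Agrees T c ∧ D.SearchInv h h c ∧
      β + 2 * D.inner h c + 2 ≤ 2 * (D.decided c).card := by
  induction h with
  | zero =>
    have H := searchInv_start D 0
    have hs : ∀ v, (D.start 0).st v ≠ 0 → v = D.ter 0 := fun v hv => by
      by_contra h
      exact hv (by simp [start, h])
    have h1 : (D.start 0).st (D.ter 0) = 1 := by simp [start]
    refine ⟨D.start 0, 0, .const fun a => rfl, ⟨fun v hv => ?_, fun v hv hv1 => ?_⟩, H, ?_⟩
    · rw [hs v (by omega)]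
      exact hT.2.1.1
    · exact absurd (hs v hv ▸ h1) hv1
    · have : 0 < (D.decided (D.start 0)).card :=
        Finset.card_pos.2 ⟨D.ter 0, mem_decided.2 ⟨D.ter_lt 0 D.p_pos, by omega⟩⟩
      simp only [inner, Finset.range_zero, Finset.filter_empty, Finset.card_empty]
      omega
  | succ h ih =>
    obtain ⟨c, β, hA, hT', H, hβ⟩ := ih
    obtain ⟨c', γ, hA', hT'', H', hγ⟩ := hT.exists_advice_round H hT'
    exact ⟨c', β + γ, hA.comp (g := D.round h) hA', hT'', H', by omega⟩

/-- With the right advice, of at most `2 (|N[T]| - |T| + p)` bits, the exploration ends with the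
solution. -/
theorem Tight.exists_explore {T : Finset ℕ} (hT : D.Tight T) {L : ℕ}
    (hL : 2 * (D.nbd T).card + 2 * D.p ≤ L + 2 * T.card) :
    ∃ a < 2 ^ L, D.included (D.explore a D.n) = T ∧ D.decided (D.explore a D.n) = D.nbd T := by
  classical
  obtain ⟨c, β, ⟨e, he, hf⟩, hA, H, hβ⟩ := hT.exists_advice_explore D.n
  have heq : D.explore e D.n = { c with adv := 0 } := by simpa using hf 0
  -- the included vertices form a closed subset of `T`
  have hI : D.included c = T := by
    refine Finset.Subset.antisymm (fun v hv => hA.incl v (mem_included.1 hv).2) fun v hv => ?_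
    refine hT.2.1.2 (D.included c) H.con.1 (fun u hu _ w hw huw => ?_) v hv
    obtain ⟨i, hi, rfl⟩ := (H.mem_q u).1 (mem_included.1 hu).2
    have h0 := H.done i (hi.trans_le H.tl_le) hi w huw
    refine mem_included.2 ⟨huw.right_lt, ?_⟩
    by_contra h1
    exact hA.excl w h0 h1 hw
  have hdec : D.decided c = D.nbd T := by rw [H.decided_eq, hI]
  -- all vertices of `T` but the terminals have been counted
  have hcount : T.card ≤ D.inner D.n c + D.p := by
    have : T ⊆ ((Finset.range D.n).filter fun i => i < c.tl ∧ ∀ i' < D.p, D.ter i' ≠ c.q i).image c.q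
        ∪ (Finset.range D.p).image D.ter := by
      intro v hv
      rw [← hI, mem_included] at hv
      obtain ⟨i, hi, rfl⟩ := (H.mem_q v).1 hv.2
      rw [Finset.mem_union, Finset.mem_image, Finset.mem_image]
      by_cases ht : ∃ i' < D.p, D.ter i' = c.q i
      · obtain ⟨i', hi', h⟩ := ht
        exact .inr ⟨i', Finset.mem_range.2 hi', h⟩
      · push Not at ht
        exact .inl ⟨i, by simpa using ⟨hi.trans_le H.tl_le, hi, ht⟩, rfl⟩
    refine (Finset.card_le_card this).trans ((Finset.card_union_le _ _).trans ?_)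
    refine Nat.add_le_add Finset.card_image_le (Finset.card_image_le.trans ?_)
    rw [Finset.card_range]
  rw [hdec] at hβ
  refine ⟨e, he.trans_le (Nat.pow_le_pow_right two_pos (by omega)), ?_, ?_⟩
  · rw [heq]; exact hI
  · rw [heq]; exact hdec

/-- If there is a solution, and all connected sets that contain the terminals have at least `ell`
elements, the exploration finds a solution with one of `4 ^ (k - ell + p)` advices. -/
theorem YesSet.exists_explore {om : ℕ → ℕ} {k C ell : ℕ} {A : Finset ℕ} (hA : D.YesSet om k C A)
    (hell : ∀ A, D.Sol A → ell ≤ A.card) :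
    ∃ a < 4 ^ (k - ell + D.p), (∀ i < D.p, (D.explore a D.n).st (D.ter i) = 1) ∧
      (D.decided (D.explore a D.n)).card ≤ k ∧ ∑ v ∈ D.decided (D.explore a D.n), om v ≤ C := by
  classical
  obtain ⟨T, hT, hmin⟩ := Finset.exists_min_image
    ((Finset.range D.n).powerset.filter fun A => D.YesSet om k C A) Finset.card
    ⟨A, by simpa using ⟨hA.1.1, hA⟩⟩
  rw [Finset.mem_filter] at hT
  obtain ⟨-, hT⟩ := hT
  have htight : D.Tight T := by
    refine ⟨hT.1.1, hT.1.2.1, fun x hx hxt hc => ?_⟩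
    have hsub := Finset.erase_subset x T
    have hn := nbd_mono (D := D) hsub
    have := hmin (T.erase x) (by
      rw [Finset.mem_filter, Finset.mem_powerset]
      exact ⟨hsub.trans hT.1.1, ⟨hsub.trans hT.1.1, hc, fun i hi =>
        Finset.mem_erase.2 ⟨hxt i hi, hT.1.2.2 i hi⟩⟩, (Finset.card_le_card hn).trans hT.2.1,
        (Finset.sum_le_sum_of_subset hn).trans hT.2.2⟩)
    have := Finset.card_erase_lt_of_mem hx
    omega
  have h1 := hell T hT.1
  have h2 : T.card ≤ (D.nbd T).card := Finset.card_le_card fun v hv =>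
    mem_nbd.2 ⟨Finset.mem_range.1 (hT.1.1 hv), .inl hv⟩
  have h3 := hT.2.1
  obtain ⟨a, ha, hI, hd⟩ := htight.exists_explore (L := 2 * (k - ell + D.p)) (by omega)
  rw [pow_mul] at ha
  refine ⟨a, ha, fun i hi => ?_, hd ▸ hT.2⟩
  have := hT.1.2.2 i hi
  rw [← hI, mem_included] at this
  exact this.2

end Net

/-! ### The program for the size of a Steiner tree

The variables have fixed roles in all programs: `1` is `n`, `2` is `2 m`, `3` is `p`; `4`, `5`, `6`,
`7`, `8`, `9` are the base addresses of the ends of the edges, the terminals, the marks of the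
terminals, the statuses of the vertices, the queue and the table; `10` is `2 ^ p`, `11` is the bound
on the cost, `12` is the first terminal, `13` is `k`, `14` is `4 ^ (r + p)`, `15` is `2 ^ p * n`, `16`
is `r + p` and `17` is the answer. The variables from `19` on are loop counters and temporaries. -/

open Ex in
/-- The head of the arc with the number `var j`. The two ends of an edge stand in the positions
`2 i` and `2 i + 1`, so the other end of the arc in position `j` stands in position
`4 (j / 2) + 1 - j`. -/
def headEx (j : ℕ) : Ex := mem (var 4 + (num 4 * (var j / num 2) + num 1 - var j))

open Ex in
/-- Relax the entry of the table for the sum of the disjoint bit sets `var 21` and `var 22` along the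
arc `var 23`. -/
def relaxArc : Cmd := .block [
  .set 24 (mem (var 4 + var 23)),
  .set 25 (headEx 23),
  .set 26 (mem (var 9 + var 21 * var 1 + var 24) + mem (var 9 + var 22 * var 1 + var 25) + num 1),
  .set 27 (var 9 + (var 21 + var 22) * var 1 + var 24),
  .ite (mem (var 27) - var 26) (.put (var 27) (var 26)) .skip]

open Ex in
/-- Set `var 24` to `0` if and only if the bit sets `var 21` and `var 22` are disjoint. -/
def testDisjoint : Cmd := .block [
  .set 24 (num 0),
  .set 25 (var 21),
  .set 26 (var 22),
  .loop 23 3 (.block [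
    .set 24 (var 24 + (var 25 - num 2 * (var 25 / num 2)) * (var 26 - num 2 * (var 26 / num 2))),
    .set 25 (var 25 / num 2),
    .set 26 (var 26 / num 2)])]

open Ex in
/-- Compute the table of the sizes of Steiner trees for all the sets of terminals with all the
possible additional vertices. -/
def fillTable : Cmd := .block [
  .set 15 (var 10 * var 1),
  .loop 20 15 (.put (var 9 + var 20) (var 1)),
  .loop 20 1 (.put (var 9 + var 20) (num 0)),
  .set 22 (num 1),
  .loop 20 3 (.block [
    .put (var 9 + var 22 * var 1 + mem (var 5 + var 20)) (num 0),
    .set 22 (var 22 + var 22)]),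
  .loop 20 1 (.loop 21 10 (.loop 22 10 (.seq testDisjoint
    (.ite (var 24) .skip (.loop 23 2 relaxArc)))))]

/-- The contents `V` of the variables below `13` and `M` of the memory below `V 7`, which do not
change any more, present the input; and the bounds are large enough. -/
structure Layout (K : Par) (D : Net) (om V M : ℕ → ℕ) : Prop where
  v1 : V 1 = D.n
  v2 : V 2 = D.m2
  v3 : V 3 = D.p
  v4 : V 4 = 5 + D.n
  v5 : V 5 = V 4 + D.m2
  v6 : V 6 = V 5 + D.p
  v7 : V 7 = V 6 + D.n
  v8 : V 8 = V 7 + D.n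
  v9 : V 9 = V 8 + D.n
  v10 : V 10 = 2 ^ D.p
  v12 : V 12 = D.ter 0
  cost : ∀ v < D.n, M (5 + v) = om v
  src : ∀ j < D.m2, M (V 4 + j) = D.src j
  dst : ∀ j < D.m2, M (V 4 + (4 * (j / 2) + 1 - j)) = D.dst j
  even : 2 ∣ D.m2
  ter : ∀ i < D.p, M (V 5 + i) = D.ter i
  isTer : ∀ v < D.n, M (V 6 + v) ≠ 0 ↔ ∃ i < D.p, D.ter i = v
  readable : ∀ a, 5 ≤ a → K.X a
  β1 : D.n ≤ K.β 1
  β2 : D.m2 ≤ K.β 2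
  β3 : D.p ≤ K.β 3
  β10 : 2 ^ D.p ≤ K.β 10
  β15 : 2 ^ D.p * D.n ≤ K.β 15
  n_le : D.n ≤ K.b
  m2_le : D.m2 ≤ K.b
  pow_le : 2 ^ D.p ≤ K.b
  addr_le : V 9 + 2 ^ D.p * D.n ≤ K.B
  cost_le : ∑ v ∈ Finset.range D.n, om v ≤ K.B

/-- The store agrees with the fixed contents of the first variables and memory cells. -/
structure Keeps (V M : ℕ → ℕ) (σ : Store) : Prop where
  var : ∀ i < 13, σ.var i = V i
  mem : ∀ a < V 7, σ.mem a = M a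

theorem Keeps.set {V M : ℕ → ℕ} {σ : Store} (h : Keeps V M σ) {i x : ℕ} (hi : 13 ≤ i) :
    Keeps V M (σ.set i x) :=
  ⟨fun j hj => by rw [Store.set_var, if_neg (by omega), h.var j hj], h.mem⟩

theorem Keeps.put {V M : ℕ → ℕ} {σ : Store} (h : Keeps V M σ) {a x : ℕ} (ha : V 7 ≤ a) :
    Keeps V M (σ.put a x) :=
  ⟨h.var, fun c hc => by rw [Store.put_mem, if_neg (by omega), h.mem c hc]⟩

/-- The table in the memory. -/
def tab (D : Net) (V : ℕ → ℕ) (σ : Store) (X v : ℕ) : ℕ := σ.mem (V 9 + X * D.n + v)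

theorem tab_set (D : Net) (V : ℕ → ℕ) (σ : Store) (i x : ℕ) : tab D V (σ.set i x) = tab D V σ := rfl

theorem tab_put (D : Net) (V : ℕ → ℕ) (σ : Store) {X v X' v' x : ℕ} (hv : v < D.n) (hv' : v' < D.n) :
    tab D V (σ.put (V 9 + X * D.n + v) x) X' v' =
      if X' = X ∧ v' = v then x else tab D V σ X' v' := by
  unfold tab
  rw [Store.put_mem]
  refine if_congr ⟨fun h => ?_, ?_⟩ rfl rfl
  · have h1 : X' * D.n + v' = X * D.n + v := by omega
    have h2 : (v' + D.n * X') / D.n = (v + D.n * X) / D.n := by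
      rw [show v' + D.n * X' = X' * D.n + v' by ring, h1]; congr 1; ring
    rw [Nat.add_mul_div_left _ _ (by omega), Nat.add_mul_div_left _ _ (by omega),
      Nat.div_eq_of_lt hv, Nat.div_eq_of_lt hv'] at h2
    have h3 : X' = X := by omega
    subst h3
    exact ⟨rfl, by omega⟩
  · rintro ⟨rfl, rfl⟩; rfl

theorem Net.TableSound.update {D : Net} {d d' : ℕ → ℕ → ℕ} (h : D.TableSound d) {X v x : ℕ}
    (hx : x ≤ D.n) (hr : D.Reach X v x)
    (hd : ∀ X' v', v' < D.n → d' X' v' = if X' = X ∧ v' = v then x else d X' v') :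
    D.TableSound d' := by
  intro X' hX' v' hv'
  rw [hd X' v' hv']
  split_ifs with hc
  · obtain ⟨rfl, rfl⟩ := hc
    exact ⟨hx, fun _ => hr⟩
  · exact h X' hX' v' hv'

namespace Layout

variable {K : Par} {D : Net} {om V M : ℕ → ℕ} (L : Layout K D om V M)

theorem tab_lt {X v : ℕ} (hX : X < 2 ^ D.p) (hv : v < D.n) : X * D.n + v < 2 ^ D.p * D.n := by
  calc X * D.n + v < (X + 1) * D.n := by rw [Nat.add_mul]; omega
    _ ≤ _ := Nat.mul_le_mul_right _ hX

include L

theorem nums : V 1 = D.n ∧ V 2 = D.m2 ∧ V 3 = D.p ∧ V 4 = 5 + D.n ∧ V 5 = V 4 + D.m2 ∧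
    V 6 = V 5 + D.p ∧ V 7 = V 6 + D.n ∧ V 8 = V 7 + D.n ∧ V 9 = V 8 + D.n ∧ V 10 = 2 ^ D.p ∧
    V 9 + 2 ^ D.p * D.n ≤ K.B ∧ 2 ^ D.p ≤ K.b ∧ D.n ≤ K.b ∧ D.m2 ≤ K.b ∧ 8 ≤ K.b ∧
    8 * K.b ≤ K.B ∧ D.p < 2 ^ D.p :=
  ⟨L.v1, L.v2, L.v3, L.v4, L.v5, L.v6, L.v7, L.v8, L.v9, L.v10, L.addr_le, L.pow_le, L.n_le, L.m2_le,
    K.eight_le, K.eight_mul_le, Nat.lt_two_pow_self⟩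

theorem tail_val {σ : Store} (hσ : Keeps V M σ) {j : ℕ} (hj : j < D.m2) :
    σ.mem (V 4 + j) = D.src j := by
  have := L.nums
  rw [hσ.mem _ (by omega), L.src j hj]

theorem ter_val {σ : Store} (hσ : Keeps V M σ) {i : ℕ} (hi : i < D.p) :
    σ.mem (V 5 + i) = D.ter i := by
  have := L.nums
  rw [hσ.mem _ (by omega), L.ter i hi]

theorem head_ok {σ : Store} (hσ : Keeps V M σ) {i j : ℕ} (hi : i < 40) (hij : σ.var i = j)
    (hj : j < D.m2) : (headEx i).Ok K σ ∧ (headEx i).val σ = D.dst j := by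
  have h4 := hσ.var 4 (by omega)
  have := L.nums
  obtain ⟨q, hq⟩ := L.even
  have hr := L.readable (V 4 + (4 * (j / 2) + 1 - j)) (by omega)
  have hd := L.dst j hj
  rw [← hσ.mem _ (by omega)] at hd
  simp only [headEx, ok_mem, ok_add, ok_sub, ok_mul, ok_div, ok_var, ok_num, val_add, val_sub,
    val_mul, val_div, val_num, val_var, val_mem, h4, hij, hd]
  refine ⟨⟨⟨by omega, ⟨⟨⟨by omega, ⟨hi, by omega, by omega, by omega⟩, by omega, by omega⟩, by omega,
    by omega⟩, hi⟩, by omega⟩, hr⟩, trivial⟩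

theorem wp_relaxArc {σ : Store} (hσ : Keeps V M σ) {Y Z j : ℕ} (hY : Y < 2 ^ D.p)
    (hZ : Z < 2 ^ D.p) (hYZ : Y + Z < 2 ^ D.p) (hj : j < D.m2) (h21 : σ.var 21 = Y)
    (h22 : σ.var 22 = Z) (h23 : σ.var 23 = j) (hs : D.TableSound (tab D V σ)) :
    wp K relaxArc (fun σ' => Keeps V M σ' ∧ (∀ i < 24, σ'.var i = σ.var i) ∧
      ∀ X v, v < D.n → tab D V σ' X v = if X = Y + Z ∧ v = D.src j then
        min (tab D V σ X v) (tab D V σ Y (D.src j) + tab D V σ Z (D.dst j) + 1)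
        else tab D V σ X v) σ := by
  have h1 := hσ.var 1 (by omega); have h4 := hσ.var 4 (by omega); have h9 := hσ.var 9 (by omega)
  have hN := L.nums
  have ha := D.src_lt j hj
  have hb := D.dst_lt j hj
  have ht1 := tab_lt hY ha
  have ht2 := tab_lt hZ hb
  have ht3 := tab_lt hYZ ha
  have hs1 := (hs Y hY _ ha).1
  have hs2 := (hs Z hZ _ hb).1
  have hs1' : σ.mem (V 9 + Y * D.n + D.src j) ≤ D.n := hs1
  have hs2' : σ.mem (V 9 + Z * D.n + D.dst j) ≤ D.n := hs2
  unfold relaxArc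
  refine wp_block_set (D.src j) (by norm_num) ?_ (by simpa [h4, h23] using L.tail_val hσ hj) ?_
  · simp [h4, h23]
    exact ⟨by omega, L.readable _ (by omega)⟩
  obtain ⟨hok, hval⟩ := L.head_ok (hσ.set (i := 24) (x := D.src j) (by omega)) (i := 23) (j := j)
    (by norm_num) (by simpa using h23) hj
  refine wp_block_set (D.dst j) (by norm_num) hok hval ?_
  refine wp_block_set (tab D V σ Y (D.src j) + tab D V σ Z (D.dst j) + 1) (by norm_num) ?_
    (by simp [h9, h21, h22, h1, L.v1, tab]) ?_
  · simp [h9, h21, h22, h1, L.v1]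
    and_intros <;> first | omega | exact L.readable _ (by omega)
  refine wp_block_set (V 9 + (Y + Z) * D.n + D.src j) (by norm_num) ?_
    (by simp [h9, h21, h22, h1, L.v1]) ?_
  · simp [h9, h21, h22, h1, L.v1]
    and_intros <;> omega
  set x := tab D V σ Y (D.src j) + tab D V σ Z (D.dst j) + 1 with hx
  have hkeep : Keeps V M ((((σ.set 24 (D.src j)).set 25 (D.dst j)).set 26 x).set 27
      (V 9 + (Y + Z) * D.n + D.src j)) :=
    (((hσ.set (by omega)).set (by omega)).set (by omega)).set (by omega)
  have hvars : ∀ i < 24, ((((σ.set 24 (D.src j)).set 25 (D.dst j)).set 26 x).set 27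
      (V 9 + (Y + Z) * D.n + D.src j)).var i = σ.var i := fun i hi => by
    simp only [Store.set_var]
    rw [if_neg (by omega), if_neg (by omega), if_neg (by omega), if_neg (by omega)]
  have hvars' := hvars
  simp only [Store.set_var] at hvars'
  have hmem : σ.mem (V 9 + (Y + Z) * D.n + D.src j) = tab D V σ (Y + Z) (D.src j) := rfl
  simp only [wp_block_cons, wp_block_nil, wp_ite, wp_put, wp_skip, val_sub, val_mem, val_var, ok_sub,
    ok_mem, ok_var, Store.set_var, Store.set_mem, reduceIte, Nat.reduceLT, true_and, and_true,
    Nat.reduceEqDiff]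
  refine ⟨L.readable _ (by omega), fun hlt => ⟨hkeep.put (by omega), hvars, fun X v hv => ?_⟩,
    fun hge => ⟨hkeep, hvars', fun X v hv => ?_⟩⟩
  · rw [tab_put D V _ ha hv]
    simp only [tab_set]
    split_ifs with hc
    · obtain ⟨rfl, rfl⟩ := hc
      omega
    · rfl
  · simp only [tab_set]
    split_ifs with hc
    · obtain ⟨rfl, rfl⟩ := hc
      omega
    · rfl

omit L in
theorem bitDisjoint_iff {Y Z : ℕ} (hY : Y < 2 ^ D.p) :
    (∀ i < D.p, Y.testBit i = true → Z.testBit i = false) ↔ Net.BitDisjoint Y Z := by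
  refine ⟨fun h i hi => h i ?_ hi, fun h i _ => h i⟩
  by_contra hip
  rw [Nat.testBit_lt_two_pow (hY.trans_le (Nat.pow_le_pow_right two_pos (not_lt.1 hip)))] at hi
  exact absurd hi (by simp)

theorem wp_testDisjoint {σ : Store} (hσ : Keeps V M σ) {Y Z : ℕ} (hY : Y < 2 ^ D.p)
    (hZ : Z < 2 ^ D.p) (h21 : σ.var 21 = Y) (h22 : σ.var 22 = Z) :
    wp K testDisjoint (fun σ' => Keeps V M σ' ∧ (∀ i < 23, σ'.var i = σ.var i) ∧ σ'.mem = σ.mem ∧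
      (σ'.var 24 = 0 ↔ Net.BitDisjoint Y Z)) σ := by
  have hN := L.nums
  unfold testDisjoint
  refine wp_block_set 0 (by norm_num) (by simp) rfl ?_
  refine wp_block_set Y (by norm_num) (by simp) (by simp [h21]) ?_
  refine wp_block_set Z (by norm_num) (by simp) (by simp [h22]) ?_
  refine wp_loop D.p (by simp [hσ.var 3, L.v3]) (by norm_num) L.β3
    (fun j σ' => Keeps V M σ' ∧ (∀ i < 23, σ'.var i = σ.var i) ∧ σ'.mem = σ.mem ∧
      σ'.var 25 = Y / 2 ^ j ∧ σ'.var 26 = Z / 2 ^ j ∧ σ'.var 24 ≤ j ∧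
      (σ'.var 24 = 0 ↔ ∀ i < j, Y.testBit i = true → Z.testBit i = false)) ?_ ?_ ?_
  · refine ⟨(((hσ.set ?_).set ?_).set ?_).set ?_, fun i hi => ?_, rfl, ?_⟩
    all_goals try omega
    · simp only [Store.set_var]
      rw [if_neg (by omega), if_neg (by omega), if_neg (by omega), if_neg (by omega)]
    · simp
  · rintro j hj σ' ⟨hk, hv, hm, h25, h26, h24, hiff⟩ h23 -
    have e1 : Y / 2 ^ j ≤ Y := Nat.div_le_self _ _
    have e2 : Z / 2 ^ j ≤ Z := Nat.div_le_self _ _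
    have b1 : Y.testBit j = decide (Y / 2 ^ j % 2 = 1) := Nat.testBit_eq_decide_div_mod_eq
    have b2 : Z.testBit j = decide (Z / 2 ^ j % 2 = 1) := Nat.testBit_eq_decide_div_mod_eq
    have m1 : Y / 2 ^ j - 2 * (Y / 2 ^ j / 2) = Y / 2 ^ j % 2 := by omega
    have m2 : Z / 2 ^ j - 2 * (Z / 2 ^ j / 2) = Z / 2 ^ j % 2 := by omega
    have h01 : Y / 2 ^ j % 2 = 0 ∨ Y / 2 ^ j % 2 = 1 := by omega
    have h02 : Z / 2 ^ j % 2 = 0 ∨ Z / 2 ^ j % 2 = 1 := by omega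
    have hprod : Y / 2 ^ j % 2 * (Z / 2 ^ j % 2) ≤ 1 ∧
        (Y / 2 ^ j % 2 * (Z / 2 ^ j % 2) = 0 ↔ (Y.testBit j = true → Z.testBit j = false)) := by
      rw [b1, b2]
      rcases h01 with h | h <;> rcases h02 with h' | h' <;> simp [h, h']
    set x := Y / 2 ^ j % 2 * (Z / 2 ^ j % 2)
    refine wp_block_set (σ'.var 24 + x) (by norm_num) ?_ (by simp [h25, h26, m1, m2, x]) ?_
    · simp [h25, h26, m1, m2]
      and_intros <;> omega
    refine wp_block_set (Y / 2 ^ (j + 1)) (by norm_num) ?_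
      (by simp [h25, Nat.div_div_eq_div_mul, pow_succ]) ?_
    · simp [h25]
      omega
    refine wp_block_set (Z / 2 ^ (j + 1)) (by norm_num) ?_
      (by simp [h26, Nat.div_div_eq_div_mul, pow_succ]) ?_
    · simp [h26]
      omega
    rw [wp_block_nil]
    refine ⟨by simp [h23], by simp [hk.var 3, L.v3], (((hk.set ?_).set ?_).set ?_).set ?_,
      fun i hi => ?_, hm, by simp, by simp, by simp; omega, ?_⟩
    all_goals try omega
    · simp only [Store.set_var]
      rw [if_neg (by omega), if_neg (by omega), if_neg (by omega), if_neg (by omega), hv i hi]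
    · simp only [Store.set_var, Nat.reduceEqDiff, reduceIte, Nat.add_eq_zero_iff, hprod.2, hiff]
      rw [Nat.forall_lt_succ_right]
  · rintro σ' ⟨hk, hv, hm, -, -, -, hiff⟩
    exact ⟨hk, hv, hm, hiff.trans (bitDisjoint_iff hY)⟩

end Layout

namespace Net

/-- The table `d'` takes account of the relaxation of the table `d` for the bit sets `Y` and `Z` along
the arc `j`. -/
def Relaxed (D : Net) (d d' : ℕ → ℕ → ℕ) (Y Z j : ℕ) : Prop :=
  BitDisjoint Y Z → d' (Y + Z) (D.src j) ≤ d Y (D.src j) + d Z (D.dst j) + 1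

theorem BitDisjoint.add_lt {Y Z p : ℕ} (h : BitDisjoint Y Z) (hY : Y < 2 ^ p) (hZ : Z < 2 ^ p) :
    Y + Z < 2 ^ p := by
  refine Nat.lt_pow_two_of_testBit _ fun i hi => ?_
  have h2 := Nat.pow_le_pow_right two_pos hi
  rw [h.testBit_add, Nat.testBit_lt_two_pow (hY.trans_le h2),
    Nat.testBit_lt_two_pow (hZ.trans_le h2)]
  rfl

end Net

/-- The invariant within a round of relaxations: the table is sound, it is at most the table `d` at
the beginning of the round, and the relaxations with `P` have been done. -/
structure RoundInv (D : Net) (V M : ℕ → ℕ) (d : ℕ → ℕ → ℕ) (P : ℕ → ℕ → ℕ → Prop) (σ : Store) :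
    Prop where
  keeps : Keeps V M σ
  sound : D.TableSound (tab D V σ)
  le : ∀ X < 2 ^ D.p, ∀ v < D.n, tab D V σ X v ≤ d X v
  relaxed : ∀ Y < 2 ^ D.p, ∀ Z < 2 ^ D.p, ∀ j < D.m2, P Y Z j → D.Relaxed d (tab D V σ) Y Z j

theorem RoundInv.congr {D : Net} {V M : ℕ → ℕ} {d : ℕ → ℕ → ℕ} {P P' : ℕ → ℕ → ℕ → Prop}
    {σ σ' : Store} (h : RoundInv D V M d P σ) (hk : Keeps V M σ') (hm : σ'.mem = σ.mem)
    (hP : ∀ Y < 2 ^ D.p, ∀ Z < 2 ^ D.p, ∀ j < D.m2, P' Y Z j → P Y Z j ∨ ¬ Net.BitDisjoint Y Z) :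
    RoundInv D V M d P' σ' := by
  have ht : tab D V σ' = tab D V σ := by unfold tab; rw [hm]
  refine ⟨hk, by rw [ht]; exact h.sound, by rw [ht]; exact h.le, fun Y hY Z hZ j hj hp => ?_⟩
  rw [ht]
  rcases hP Y hY Z hZ j hj hp with hp | hp
  exacts [h.relaxed Y hY Z hZ j hj hp, fun hd => absurd hd hp]

namespace Layout

variable {K : Par} {D : Net} {om V M : ℕ → ℕ} (L : Layout K D om V M)

include L

theorem wp_relaxArc_round {d : ℕ → ℕ → ℕ} {Y Z j : ℕ} (hY : Y < 2 ^ D.p) (hZ : Z < 2 ^ D.p)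
    (hYZ : Net.BitDisjoint Y Z) (hj : j < D.m2) {P : ℕ → ℕ → ℕ → Prop} {σ : Store}
    (h : RoundInv D V M d P σ) (h21 : σ.var 21 = Y) (h22 : σ.var 22 = Z) (h23 : σ.var 23 = j) :
    wp K relaxArc (fun σ' => RoundInv D V M d (fun Y' Z' j' => P Y' Z' j' ∨ Y' = Y ∧ Z' = Z ∧ j' = j) σ'
      ∧ ∀ i < 24, σ'.var i = σ.var i) σ := by
  have hlt := hYZ.add_lt hY hZ
  have ha := D.src_lt j hj
  have hb := D.dst_lt j hj
  refine wp_mono (L.wp_relaxArc h.keeps hY hZ hlt hj h21 h22 h23 h.sound) ?_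
  rintro σ' ⟨hk, hv, ht⟩
  have hle : ∀ X v, v < D.n → tab D V σ' X v ≤ tab D V σ X v := fun X v hv => by
    rw [ht X v hv]
    split_ifs
    exacts [min_le_left _ _, le_rfl]
  refine ⟨⟨hk, fun X hX v hv => ?_, fun X hX v hv => (hle X v hv).trans (h.le X hX v hv), ?_⟩, hv⟩
  · refine ⟨(hle X v hv).trans (h.sound X hX v hv).1, fun hn => ?_⟩
    rw [ht X v hv] at hn ⊢
    split_ifs at hn ⊢ with hc
    · obtain ⟨rfl, rfl⟩ := hc
      rcases min_cases (tab D V σ (Y + Z) (D.src j))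
        (tab D V σ Y (D.src j) + tab D V σ Z (D.dst j) + 1) with ⟨he, -⟩ | ⟨he, -⟩
      · rw [he] at hn ⊢
        exact (h.sound _ hX _ hv).2 hn
      · rw [he] at hn ⊢
        exact ((h.sound Y hY _ ha).2 (by omega)).join ((h.sound Z hZ _ hb).2 (by omega))
          ⟨j, hj, rfl, rfl⟩ hYZ
    · exact (h.sound X hX v hv).2 hn
  · rintro Y' hY' Z' hZ' j' hj' (hP | ⟨rfl, rfl, rfl⟩) hd
    · exact (hle _ _ (D.src_lt j' hj')).trans (h.relaxed Y' hY' Z' hZ' j' hj' hP hd)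
    · rw [ht _ _ ha, if_pos ⟨rfl, rfl⟩]
      have := h.le Y' hY _ ha
      have := h.le Z' hZ _ hb
      exact (min_le_right _ _).trans (by omega)

theorem wp_round {σ : Store} (hσ : Keeps V M σ) {t : ℕ} (hs : D.TableSound (tab D V σ))
    (hc : D.TableComplete t (tab D V σ)) :
    wp K (.loop 21 10 (.loop 22 10 (.seq testDisjoint
      (.ite (.var 24) .skip (.loop 23 2 relaxArc))))) (fun σ' => σ'.var 20 = σ.var 20 ∧
        Keeps V M σ' ∧ D.TableSound (tab D V σ') ∧ D.TableComplete (t + 1) (tab D V σ')) σ := by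
  set d := tab D V σ with hd
  refine wp_loop (2 ^ D.p) (by rw [hσ.var 10 (by omega), L.v10]) (by norm_num) L.β10
    (fun Y σ' => RoundInv D V M d (fun Y' _ _ => Y' < Y) σ' ∧ σ'.var 20 = σ.var 20) ?_ ?_ ?_
  · exact ⟨⟨hσ.set (by omega), hs, fun _ _ _ _ => le_rfl, fun Y _ Z _ j _ h => absurd h (by omega)⟩,
      by simp⟩
  · rintro Y hY σ₁ ⟨h₁, h20⟩ h21 -
    refine wp_loop (2 ^ D.p) (by rw [h₁.keeps.var 10 (by omega), L.v10]) (by norm_num) L.β10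
      (fun Z σ' => RoundInv D V M d (fun Y' Z' _ => Y' < Y ∨ Y' = Y ∧ Z' < Z) σ' ∧
        σ'.var 20 = σ.var 20 ∧ σ'.var 21 = Y) ?_ ?_ ?_
    · exact ⟨h₁.congr (h₁.keeps.set (by omega)) rfl fun _ _ _ _ _ _ => by omega, by simpa using h20,
        by simpa using h21⟩
    · rintro Z hZ σ₂ ⟨h₂, h20, h21⟩ h22 -
      refine wp_seq_of _ (L.wp_testDisjoint h₂.keeps hY hZ h21 h22) ?_
      rintro σ₃ ⟨hk₃, hv₃, hm₃, hdis⟩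
      have h₃ := h₂.congr hk₃ hm₃ fun _ _ _ _ _ _ => Or.inl
      refine ⟨by norm_num, fun hne => ?_, fun he => ?_⟩
      · have hnd : ¬ Net.BitDisjoint Y Z := fun hd => hne (hdis.2 hd)
        refine ⟨by rw [hv₃ 22 (by omega), h22], by rw [hk₃.var 10 (by omega), L.v10],
          h₃.congr (hk₃.set (by omega)) rfl fun Y' _ Z' _ _ _ hP => ?_,
          by simp [hv₃, h20], by simp [hv₃, h21]⟩
        by_cases hY' : Y' = Y ∧ Z' = Z
        · obtain ⟨rfl, rfl⟩ := hY'
          exact .inr hnd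
        · left; omega
      · have hyz := hdis.1 he
        refine wp_loop D.m2 (by rw [hk₃.var 2 (by omega), L.v2]) (by norm_num) L.β2
          (fun j σ' => RoundInv D V M d (fun Y' Z' j' => (Y' < Y ∨ Y' = Y ∧ Z' < Z) ∨
            Y' = Y ∧ Z' = Z ∧ j' < j) σ' ∧ ∀ i < 23, σ'.var i = σ₂.var i) ?_ ?_ ?_
        · refine ⟨h₃.congr (hk₃.set (by omega)) rfl fun _ _ _ _ _ _ => by omega, fun i hi => ?_⟩
          rw [Store.set_var, if_neg (by omega), hv₃ i hi]
        · rintro j hj σ₄ ⟨h₄, hv₄⟩ h23 hl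
          refine wp_mono (L.wp_relaxArc_round hY hZ hyz hj h₄ (by rw [hv₄ 21 (by omega), h21])
            (by rw [hv₄ 22 (by omega), h22]) h23) ?_
          rintro σ₅ ⟨h₅, hv₅⟩
          refine ⟨by rw [hv₅ 23 (by omega), h23], by rw [hv₅ 2 (by omega), hl],
            h₅.congr (h₅.keeps.set (by omega)) rfl fun _ _ _ _ _ _ => by omega, fun i hi => ?_⟩
          rw [Store.set_var, if_neg (by omega), hv₅ i (by omega), hv₄ i hi]
        · rintro σ₄ ⟨h₄, hv₄⟩
          refine ⟨by rw [hv₄ 22 (by omega), h22], by rw [h₄.keeps.var 10 (by omega), L.v10],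
            h₄.congr (h₄.keeps.set (by omega)) rfl fun _ _ _ _ _ _ => by omega,
            by simp [hv₄, h20], by simp [hv₄, h21]⟩
    · rintro σ₂ ⟨h₂, h20, h21⟩
      exact ⟨h21, by rw [h₂.keeps.var 10 (by omega), L.v10],
        h₂.congr (h₂.keeps.set (by omega)) rfl fun _ _ _ _ _ _ => by omega, by simpa using h20⟩
  · rintro σ' ⟨h, h20⟩
    exact ⟨h20, h.keeps, h.sound, hc.relax h.le fun Y hY Z hZ hyz j hj =>
      h.relaxed Y hY Z hZ j hj hY hyz⟩

/-- The table is computed correctly. -/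
theorem wp_fillTable {σ : Store} (hσ : Keeps V M σ) :
    wp K fillTable (fun σ' => Keeps V M σ' ∧ D.TableSound (tab D V σ') ∧
      D.TableComplete D.n (tab D V σ')) σ := by
  have hN := L.nums
  have hpn : 2 ^ D.p * D.n ≤ K.B := (Nat.mul_le_mul L.pow_le L.n_le).trans K.sq_le
  unfold fillTable
  refine wp_block_set (2 ^ D.p * D.n) (by norm_num) ?_
    (by simp [hσ.var 1, hσ.var 10, L.v1, L.v10]) ?_
  · simp [hσ.var 1, hσ.var 10, L.v1, L.v10, L.pow_le, L.n_le]
  -- all entries are `∞`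
  refine wp_block_of (fun σ' => Keeps V M σ' ∧ ∀ a < 2 ^ D.p * D.n, σ'.mem (V 9 + a) = D.n) ?_ ?_
  · refine wp_loop (2 ^ D.p * D.n) (by simp) (by norm_num) L.β15
      (fun j σ' => Keeps V M σ' ∧ ∀ a < j, σ'.mem (V 9 + a) = D.n)
      ⟨(hσ.set (by omega)).set (by omega), fun a ha => absurd ha (by omega)⟩ ?_ fun σ' h => h
    rintro j hj σ' ⟨hk, hm⟩ h20 h15
    rw [wp_put]
    have e : (Ex.var 9 + Ex.var 20).val σ' = V 9 + j := by simp [hk.var 9, h20]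
    rw [e, val_var, hk.var 1 (by omega), L.v1]
    refine ⟨?_, by simp, h20, h15, (hk.put (by omega)).set (by omega), fun a ha => ?_⟩
    · simp [hk.var 9, h20]
      omega
    · rw [Store.set_mem, Store.put_mem]
      split_ifs with hc
      · rfl
      · exact hm a (by omega)
  rintro σ₁ ⟨hk₁, hm₁⟩
  have hs₁ : D.TableSound (tab D V σ₁) := fun X hX v hv => by
    have : tab D V σ₁ X v = D.n := by
      unfold tab
      rw [Nat.add_assoc]
      exact hm₁ _ (tab_lt hX hv)
    omega
  -- the empty set of terminals
  have r0 : ∀ v < D.n, D.Reach 0 v 0 := fun v hv =>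
    ⟨{v}, by simpa using hv, .singleton v, by simp, fun i _ hi => by simp at hi⟩
  refine wp_block_of (fun σ' => Keeps V M σ' ∧ D.TableSound (tab D V σ') ∧
    ∀ v < D.n, tab D V σ' 0 v = 0) ?_ ?_
  · refine wp_loop D.n (by rw [hk₁.var 1 (by omega), L.v1]) (by norm_num) L.β1
      (fun j σ' => Keeps V M σ' ∧ D.TableSound (tab D V σ') ∧ ∀ v < j, tab D V σ' 0 v = 0)
      ⟨hk₁.set (by omega), hs₁, fun v hv => absurd hv (by omega)⟩ ?_ fun σ' h => h
    rintro j hj σ' ⟨hk, hs, h0⟩ h20 h1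
    rw [wp_put]
    have e : (Ex.var 9 + Ex.var 20).val σ' = V 9 + 0 * D.n + j := by simp [hk.var 9, h20]
    rw [e, val_num]
    have ht := fun X' v' (hv' : v' < D.n) => tab_put D V σ' (X := 0) (X' := X') (x := 0) hj hv'
    refine ⟨?_, by simp, h20, h1, (hk.put (by omega)).set (by omega),
      hs.update (Nat.zero_le _) (r0 j hj) ht, fun v hv => ?_⟩
    · simp [hk.var 9, h20]
      omega
    · rw [tab_set, ht _ _ (by omega)]
      split_ifs with hc
      · rfl
      · exact h0 v (by omega)
  rintro σ₂ ⟨hk₂, hs₂, h0₂⟩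
  refine wp_block_set 1 (by norm_num) (by simp) rfl ?_
  -- the sets of one terminal
  have r1 : ∀ i < D.p, D.Reach (2 ^ i) (D.ter i) 0 := fun i hi =>
    ⟨{D.ter i}, by simpa using D.ter_lt i hi, .singleton _, by simp, fun i' _ hi' => by
      rw [Nat.testBit_two_pow, decide_eq_true_eq] at hi'
      simp [hi']⟩
  refine wp_block_of (fun σ' => Keeps V M σ' ∧ D.TableSound (tab D V σ') ∧
    D.TableComplete 0 (tab D V σ')) ?_ ?_
  · refine wp_loop D.p (by simp [hk₂.var 3, L.v3]) (by norm_num) L.β3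
      (fun j σ' => Keeps V M σ' ∧ D.TableSound (tab D V σ') ∧ (∀ v < D.n, tab D V σ' 0 v = 0) ∧
        (∀ i < j, tab D V σ' (2 ^ i) (D.ter i) = 0) ∧ σ'.var 22 = 2 ^ j)
      ⟨(hk₂.set (by omega)).set (by omega), hs₂, h0₂, fun v hv => absurd hv (by omega), by simp⟩ ?_
      fun σ' h => ⟨h.1, h.2.1, Net.tableComplete_zero h.2.2.1 h.2.2.2.1⟩
    rintro j hj σ' ⟨hk, hs, h0, h1, h22⟩ h20 h3
    have hjp : 2 ^ j < 2 ^ D.p := Nat.pow_lt_pow_right (by omega) hj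
    have htl := D.ter_lt j hj
    have hlt := tab_lt hjp htl
    have hter := L.ter_val hk hj
    refine wp_block_put (V 9 + 2 ^ j * D.n + D.ter j) 0 ?_ (by simp)
      (by simp [hk.var 9, hk.var 1, hk.var 5, h20, h22, L.v1, hter]) rfl ?_
    · simp [hk.var 9, hk.var 1, hk.var 5, h20, h22, L.v1, hter]
      and_intros <;> first | omega | exact L.readable _ (by omega)
    refine wp_block_set (2 ^ (j + 1)) (by norm_num) ?_ (by simp [h22, pow_succ]; ring) ?_
    · simp [h22]
      omega
    rw [wp_block_nil]
    have ht := fun X' v' (hv' : v' < D.n) => tab_put D V σ' (X := 2 ^ j) (X' := X') (x := 0) htl hv'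
    refine ⟨by simp [h20], by simp [hk.var 3, L.v3], ((hk.put (by omega)).set (by omega)).set (by omega),
      hs.update (Nat.zero_le _) (r1 j hj) ht, fun v hv => ?_, fun i hi => ?_, by simp⟩
    · rw [tab_set, tab_set, ht _ _ hv]
      split_ifs with hc
      · rfl
      · exact h0 v hv
    · rw [tab_set, tab_set, ht _ _ (D.ter_lt i (by omega))]
      split_ifs with hc
      · rfl
      · refine h1 i (lt_of_le_of_ne (by omega) ?_)
        rintro rfl
        exact hc ⟨rfl, rfl⟩
  rintro σ₃ ⟨hk₃, hs₃, hc₃⟩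
  refine wp_block_of (fun σ' => Keeps V M σ' ∧ D.TableSound (tab D V σ') ∧
    D.TableComplete D.n (tab D V σ')) ?_ fun σ' h => h
  refine wp_loop D.n (by rw [hk₃.var 1 (by omega), L.v1]) (by norm_num) L.β1
    (fun t σ' => Keeps V M σ' ∧ D.TableSound (tab D V σ') ∧ D.TableComplete t (tab D V σ'))
    ⟨hk₃.set (by omega), hs₃, hc₃⟩ ?_ fun σ' h => h
  rintro t ht σ' ⟨hk, hs, hc⟩ h20 h1
  refine wp_mono (L.wp_round hk hs hc) ?_
  rintro σ'' ⟨h20', hk', hs', hc'⟩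
  exact ⟨by rw [h20', h20], by rw [hk'.var 1 (by omega), L.v1], hk'.set (by omega), hs', hc'⟩

end Layout

/-! ### The program for the exploration -/

open Ex in
/-- A value that is `0` if and only if the variables are equal. -/
def neqEx (i j : ℕ) : Ex := (var i - var j) + (var j - var i)

open Ex in
/-- For the arc `var 28` with tail `var 25` and undecided head: execute `c`, with the head in
`var 30`. -/
def atOpenArc (c : Cmd) : Cmd := .block [
  .set 29 (mem (var 4 + var 28)),
  .set 30 (headEx 28),
  .ite (neqEx 29 25) .skip (.ite (mem (var 7 + var 30)) .skip c)]

open Ex in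
/-- Set `var 27` to `0` if and only if `var 25` does not have two undecided neighbours. The
first such neighbour that is found, plus `1`, is kept in `var 26`. -/
def testTwoOpen : Cmd := .block [
  .set 26 (num 0),
  .set 27 (num 0),
  .loop 28 2 (atOpenArc (.ite (var 26)
    (.ite ((var 30 + num 1 - var 26) + (var 26 - (var 30 + num 1))) (.set 27 (num 1)) .skip)
    (.set 26 (var 30 + num 1))))]

open Ex in
/-- Include the vertex `var 30`. -/
def inclCmd : Cmd := .block [
  .put (var 7 + var 30) (num 1),
  .put (var 8 + var 24) (var 30),
  .set 24 (var 24 + num 1)]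

open Ex in
/-- Exclude the vertex `var 30`. -/
def exclCmd : Cmd := .put (var 7 + var 30) (num 2)

open Ex in
/-- Decide about the vertex `var 30` by the next bit of the advice `var 22`. -/
def askCmd : Cmd := .block [
  .set 31 (var 22 - num 2 * (var 22 / num 2)),
  .set 22 (var 22 / num 2),
  .ite (var 31) inclCmd exclCmd]

open Ex in
/-- Decide about the undecided neighbours of `var 25`; the decision is forced if `var 26` is `0`. -/
def scanCmd : Cmd := .loop 28 2 (atOpenArc (.ite (var 26) askCmd inclCmd))

open Ex in
/-- Process the vertex in the position `var 23` of the queue. -/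
def roundCmd : Cmd := .ite (var 24 - var 23) (.block [
  .set 25 (mem (var 8 + var 23)),
  testTwoOpen,
  .ite (var 27) (.set 26 (num 1)) (.set 26 (mem (var 6 + var 25))),
  scanCmd]) .skip

open Ex in
/-- The exploration with the advice `var 21`. -/
def exploreCmd : Cmd := .block [
  .set 22 (var 21),
  .loop 23 1 (.put (var 7 + var 23) (num 0)),
  .put (var 7 + var 12) (num 1),
  .put (var 8) (var 12),
  .set 24 (num 1),
  .loop 23 1 roundCmd]

open Ex in
/-- Set `var 17` to `1` if the exploration has found a solution, where `var 13` is the bound on the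
number of vertices and `var 11` the bound on the cost. -/
def checkCmd : Cmd := .block [
  .set 25 (num 1),
  .loop 23 3 (.block [
    .set 26 (mem (var 7 + mem (var 5 + var 23))),
    .ite (var 26 - num 1) (.set 25 (num 0)) (.ite (var 26) .skip (.set 25 (num 0)))]),
  .set 26 (num 0),
  .set 27 (num 0),
  .loop 23 1 (.ite (mem (var 7 + var 23))
    (.block [.set 26 (var 26 + num 1), .set 27 (var 27 + mem (num 5 + var 23))]) .skip),
  .ite (var 26 - var 13) .skip (.ite (var 27 - var 11) .skip (.ite (var 25) (.set 17 (num 1)) .skip))]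

open Ex in
/-- The entry of the table for all the terminals. -/
def steinerEx : Ex := mem (var 9 + (var 10 - num 1) * var 1 + var 12)

open Ex in
/-- Search for a solution with all the advices, and put the answer into `var 0`. -/
def searchCmd : Cmd := .block [
  .set 13 (mem (num 3)),
  .set 16 ((var 13 - (steinerEx + num 1)) + var 3),
  .set 14 (num 1),
  .loop 19 16 (.set 14 (var 14 + var 14 + var 14 + var 14)),
  .set 17 (num 0),
  .loop 21 14 (.seq exploreCmd checkCmd),
  .set 0 (var 17)]

/-- The main program, after the preparation of the variables. -/
def mainCmd : Cmd := .block [fillTable, .ite (.var 1 - steinerEx) searchCmd .skip]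

/-- The store represents the state `c` of the exploration. -/
structure Shows (K : Par) (D : Net) (V M : ℕ → ℕ) (c : Search) (σ : Store) : Prop where
  keeps : Keeps V M σ
  st : ∀ v < D.n, σ.mem (V 7 + v) = c.st v
  q : ∀ i < c.tl, σ.mem (V 8 + i) = c.q i
  tl : σ.var 24 = c.tl
  adv : σ.var 22 = c.adv
  adv_le : c.adv ≤ K.b

theorem Shows.set {K : Par} {D : Net} {V M : ℕ → ℕ} {c : Search} {σ : Store}
    (h : Shows K D V M c σ) {i x : ℕ} (hi : 13 ≤ i) (h22 : i ≠ 22) (h24 : i ≠ 24) : Shows K D V M c (σ.set i x) :=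
  ⟨h.keeps.set hi, h.st, h.q, by rw [Store.set_var, if_neg h24.symm, h.tl],
    by rw [Store.set_var, if_neg h22.symm, h.adv], h.adv_le⟩

namespace Layout

variable {K : Par} {D : Net} {om V M : ℕ → ℕ} (L : Layout K D om V M)

include L

theorem wp_atOpenArc {σ : Store} {c : Search} (h : Shows K D V M c σ) {x j : ℕ} (hj : j < D.m2)
    (hx : x < D.n) (h25 : σ.var 25 = x) (h28 : σ.var 28 = j) {C : Cmd} {Q : Store → Prop}
    (hskip : ∀ σ', Shows K D V M c σ' → (∀ i < 29, σ'.var i = σ.var i) →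
      ¬ (D.src j = x ∧ c.st (D.dst j) = 0) → Q σ')
    (hC : ∀ σ', Shows K D V M c σ' → (∀ i < 29, σ'.var i = σ.var i) → σ'.var 30 = D.dst j →
      D.src j = x → c.st (D.dst j) = 0 → wp K C Q σ') :
    wp K (atOpenArc C) Q σ := by
  have hN := L.nums
  have hk := h.keeps
  have ha := D.src_lt j hj
  have hb := D.dst_lt j hj
  unfold atOpenArc
  refine wp_block_set (D.src j) (by norm_num) ?_ (by simpa [hk.var 4, h28] using L.tail_val hk hj) ?_
  · simp [hk.var 4, h28]
    exact ⟨by omega, L.readable _ (by omega)⟩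
  obtain ⟨hok, hval⟩ := L.head_ok (hk.set (i := 29) (x := D.src j) (by omega)) (i := 28) (j := j)
    (by norm_num) (by simpa using h28) hj
  refine wp_block_set (D.dst j) (by norm_num) hok hval ?_
  have h₂ : Shows K D V M c ((σ.set 29 (D.src j)).set 30 (D.dst j)) :=
    (h.set (by omega) (by omega) (by omega)).set (by omega) (by omega) (by omega)
  have hv₂ : ∀ i < 29, ((σ.set 29 (D.src j)).set 30 (D.dst j)).var i = σ.var i := fun i hi => by
    simp only [Store.set_var]
    rw [if_neg (by omega), if_neg (by omega)]
  rw [wp_block_cons, wp_ite]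
  refine ⟨?_, fun hne => hskip _ h₂ hv₂ ?_, fun he => ⟨?_, fun hne => hskip _ h₂ hv₂ ?_,
    fun h0 => ?_⟩⟩
  · simp [neqEx, h25]
    omega
  · rintro ⟨rfl, -⟩
    simp [neqEx, h25] at hne
  · simp [hk.var 7]
    exact ⟨by omega, L.readable _ (by omega)⟩
  · rintro ⟨-, h0⟩
    simp [hk.var 7, h.st _ hb, h0] at hne
  · simp [neqEx, h25] at he
    simp [hk.var 7, h.st _ hb] at h0
    exact hC _ h₂ hv₂ (by simp) (by omega) h0

theorem wp_testTwoOpen {σ : Store} {c : Search} (h : Shows K D V M c σ) {x : ℕ}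
    (hx : x < D.n) (h25 : σ.var 25 = x) :
    wp K testTwoOpen (fun σ' => Shows K D V M c σ' ∧ (∀ i < 26, σ'.var i = σ.var i) ∧
      (σ'.var 27 = 0 ↔ ¬ D.TwoOpen c x)) σ := by
  have hN := L.nums
  unfold testTwoOpen
  refine wp_block_set 0 (by norm_num) (by simp) rfl ?_
  refine wp_block_set 0 (by norm_num) (by simp) rfl ?_
  refine wp_block_of _ ?_ fun σ' hσ' => hσ'
  refine wp_loop D.m2 (by simp [h.keeps.var 2, L.v2]) (by norm_num) L.β2
    (fun j σ' => (Shows K D V M c σ' ∧ ∀ i < 26, σ'.var i = σ.var i) ∧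
      ((σ'.var 26 = 0 ∧ σ'.var 27 = 0 ∧ ∀ j' < j, D.src j' = x → c.st (D.dst j') ≠ 0) ∨
        ∃ b, σ'.var 26 = b + 1 ∧ D.Adj x b ∧ c.st b = 0 ∧
          ((σ'.var 27 = 0 ∧ ∀ j' < j, D.src j' = x → c.st (D.dst j') = 0 → D.dst j' = b) ∨
            (σ'.var 27 = 1 ∧ D.TwoOpen c x)))) ?_ ?_ ?_
  · refine ⟨⟨((h.set ?_ ?_ ?_).set ?_ ?_ ?_).set ?_ ?_ ?_, fun i hi => ?_⟩, .inl ⟨by simp, by simp,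
      fun j' hj' => absurd hj' (Nat.not_lt_zero _)⟩⟩
    all_goals try omega
    simp only [Store.set_var]
    rw [if_neg (by omega), if_neg (by omega), if_neg (by omega)]
  · rintro j hj σ₁ ⟨⟨h₁, hv⟩, hcase⟩ h28 h2
    have hb := D.dst_lt j hj
    refine L.wp_atOpenArc h₁ hj hx (by rw [hv 25 (by omega), h25]) h28 ?_ ?_
    · intro σ₂ h₂ hv₂ hn
      have hv' : ∀ i < 26, σ₂.var i = σ.var i := fun i hi => by rw [hv₂ i (by omega), hv i hi]
      have h28' : σ₂.var 28 = j := by rw [hv₂ 28 (by omega), h28]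
      have h2' : σ₂.var 2 = D.m2 := by rw [hv₂ 2 (by omega), h2]
      rw [← hv₂ 26 (by omega), ← hv₂ 27 (by omega)] at hcase
      refine ⟨h28', h2', ⟨h₂.set (by omega) (by omega) (by omega), fun i hi => ?_⟩, ?_⟩
      · rw [Store.set_var, if_neg (by omega), hv' i hi]
      · simp only [Store.set_var, Nat.reduceEqDiff, reduceIte]
        rcases hcase with ⟨h26, h27, hno⟩ | ⟨b, h26, hab, hb0, ⟨h27, hall⟩ | ⟨h27, htwo⟩⟩
        · refine .inl ⟨h26, h27, fun j' hj' hs hd => ?_⟩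
          rcases Nat.lt_succ_iff_lt_or_eq.1 hj' with hj' | rfl
          · exact hno j' hj' hs hd
          · exact hn ⟨hs, hd⟩
        · refine .inr ⟨b, h26, hab, hb0, .inl ⟨h27, fun j' hj' hs hd => ?_⟩⟩
          rcases Nat.lt_succ_iff_lt_or_eq.1 hj' with hj' | rfl
          · exact hall j' hj' hs hd
          · exact absurd ⟨hs, hd⟩ hn
        · exact .inr ⟨b, h26, hab, hb0, .inr ⟨h27, htwo⟩⟩
    · intro σ₂ h₂ hv₂ h30 hs h0
      have hv' : ∀ i < 26, σ₂.var i = σ.var i := fun i hi => by rw [hv₂ i (by omega), hv i hi]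
      have h28' : σ₂.var 28 = j := by rw [hv₂ 28 (by omega), h28]
      have h2' : σ₂.var 2 = D.m2 := by rw [hv₂ 2 (by omega), h2]
      rw [← hv₂ 26 (by omega), ← hv₂ 27 (by omega)] at hcase
      have hadj : D.Adj x (D.dst j) := ⟨j, hj, hs, rfl⟩
      rw [wp_ite, val_var]
      refine ⟨by norm_num, fun hne => ?_, fun he => ?_⟩
      · obtain ⟨b, h26, hab, hb0, hor⟩ := hcase.resolve_left fun h => hne h.1
        have hbn := hab.right_lt
        refine ⟨?_, fun hne' => ?_, fun he' => ?_⟩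
        · simp [h26, h30]
          omega
        · -- a second undecided neighbour
          refine ⟨by norm_num, by simp, by simp [h28'], by simp [h2'],
            ⟨(h₂.set (by omega) (by omega) (by omega)).set (by omega) (by omega) (by omega),
            fun i hi => ?_⟩, .inr ⟨b, by simp [h26], hab, hb0, .inr ⟨by simp, b, D.dst j, hab, hadj,
            hb0, h0, ?_⟩⟩⟩
          · simp only [Store.set_var]
            rw [if_neg (by omega), if_neg (by omega), hv' i hi]
          · rintro rfl
            simp [h26, h30] at hne'
        · refine ⟨h28', h2', ⟨h₂.set (by omega) (by omega) (by omega), fun i hi => ?_⟩, ?_⟩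
          · rw [Store.set_var, if_neg (by omega), hv' i hi]
          · refine .inr ⟨b, by simp [h26], hab, hb0, ?_⟩
            simp only [Store.set_var, Nat.reduceEqDiff, reduceIte]
            refine hor.imp_left fun ⟨h27, hall⟩ => ⟨h27, fun j' hj' hs' hd => ?_⟩
            rcases Nat.lt_succ_iff_lt_or_eq.1 hj' with hj' | rfl
            · exact hall j' hj' hs' hd
            · simp [h26, h30] at he'
              omega
      · -- the first undecided neighbour
        have hcase' := hcase.resolve_right fun ⟨b, h26, _⟩ => by omega
        have e : (Ex.var 30 + Ex.num 1).val σ₂ = D.dst j + 1 := by simp [h30]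
        rw [wp_set, e]
        refine ⟨by norm_num, ?_, by simp [h28'], by simp [h2'],
          ⟨(h₂.set (by omega) (by omega) (by omega)).set (by omega) (by omega) (by omega),
          fun i hi => ?_⟩, .inr ⟨D.dst j, by simp, hadj, h0, .inl ⟨by simp [hcase'.2.1],
          fun j' hj' hs' hd => ?_⟩⟩⟩
        · simp [h30]
          omega
        · simp only [Store.set_var]
          rw [if_neg (by omega), if_neg (by omega), hv' i hi]
        · rcases Nat.lt_succ_iff_lt_or_eq.1 hj' with hj' | rfl
          · exact absurd hd (hcase'.2.2 j' hj' hs')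
          · rfl
  · rintro σ₁ ⟨⟨h₁, hv⟩, hcase⟩
    refine ⟨h₁, hv, ?_⟩
    rcases hcase with ⟨h26, h27, hno⟩ | ⟨b, h26, hab, hb0, ⟨h27, hall⟩ | ⟨h27, htwo⟩⟩
    · refine iff_of_true h27 ?_
      rintro ⟨a, b, ⟨j, hj, hs, rfl⟩, -, ha, -⟩
      exact hno j hj hs ha
    · refine iff_of_true h27 ?_
      rintro ⟨a, b', ⟨j, hj, hs, rfl⟩, ⟨j', hj', hs', rfl⟩, ha, hb, hne⟩
      exact hne ((hall j hj hs ha).trans (hall j' hj' hs' hb).symm)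
    · exact iff_of_false (by omega) (not_not.2 htwo)

theorem wp_inclCmd {σ : Store} {c : Search} (h : Shows K D V M c σ) (htl : c.tl ≤ D.n) {b : ℕ}
    (hb : b < D.n) (h30 : σ.var 30 = b) :
    wp K inclCmd (fun σ' => Shows K D V M (c.incl b) σ' ∧ ∀ i, i ≠ 24 → σ'.var i = σ.var i) σ := by
  have hN := L.nums
  have hk := h.keeps
  unfold inclCmd
  refine wp_block_put (V 7 + b) 1 ?_ (by simp) (by simp [hk.var 7, h30]) rfl ?_
  · simp [hk.var 7, h30]
    omega
  refine wp_block_put (V 8 + c.tl) b ?_ (by simp) (by simp [hk.var 8, h.tl]) (by simp [h30]) ?_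
  · simp [hk.var 8, h.tl]
    omega
  refine wp_block_set (c.tl + 1) (by norm_num) ?_ (by simp [h.tl]) ?_
  · simp [h.tl]
    omega
  rw [wp_block_nil]
  refine ⟨⟨((hk.put (by omega)).put (by omega)).set (by omega), fun v hv => ?_, fun i hi => ?_,
    by simp [Search.incl], by simp [h.adv, Search.incl], h.adv_le⟩, fun i hi => ?_⟩
  · simp only [Store.set_mem, Store.put_mem, Search.incl, Function.update_apply]
    rw [if_neg (by omega), h.st v hv]
    exact if_congr (by omega) rfl rfl
  · simp only [Store.set_mem, Store.put_mem, Search.incl, Function.update_apply]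
    change i < c.tl + 1 at hi
    by_cases hit : i = c.tl
    · rw [if_pos (by omega), if_pos hit]
    · rw [if_neg (by omega), if_neg (by omega), if_neg hit, h.q i (by omega)]
  · simp [hi]

theorem wp_exclCmd {σ : Store} {c : Search} (h : Shows K D V M c σ) {b : ℕ}
    (hb : b < D.n) (h30 : σ.var 30 = b) :
    wp K exclCmd (fun σ' => Shows K D V M (c.excl b) σ' ∧ ∀ i, i ≠ 24 → σ'.var i = σ.var i) σ := by
  have hN := L.nums
  have hk := h.keeps
  have e : (Ex.var 7 + Ex.var 30).val σ = V 7 + b := by simp [hk.var 7, h30]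
  rw [exclCmd, wp_put, e, val_num]
  refine ⟨?_, by simp, ⟨hk.put (by omega), fun v hv => ?_, fun i hi => ?_, h.tl, h.adv, h.adv_le⟩,
    fun i hi => rfl⟩
  · simp [hk.var 7, h30]
    omega
  · simp only [Store.put_mem, Search.excl, Function.update_apply]
    rw [h.st v hv]
    exact if_congr (by omega) rfl rfl
  · rw [Store.put_mem, if_neg (by omega)]
    exact h.q i hi

theorem wp_askCmd {σ : Store} {c : Search} (h : Shows K D V M c σ) (htl : c.tl ≤ D.n) {b : ℕ}
    (hb : b < D.n) (h30 : σ.var 30 = b) :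
    wp K askCmd (fun σ' => Shows K D V M (c.ask b) σ' ∧
      ∀ i, i ≠ 22 → i ≠ 24 → i ≠ 31 → σ'.var i = σ.var i) σ := by
  have hN := L.nums
  have hadv := h.adv_le
  unfold askCmd
  refine wp_block_set (c.adv % 2) (by norm_num) ?_ (by simp [h.adv]; omega) ?_
  · simp [h.adv]
    omega
  refine wp_block_set (c.adv / 2) (by norm_num) ?_ (by simp [h.adv]) ?_
  · simp [h.adv]
    omega
  set σ₂ := (σ.set 31 (c.adv % 2)).set 22 (c.adv / 2) with hσ₂
  have h₂ : Shows K D V M { c with adv := c.adv / 2 } σ₂ :=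
    ⟨(h.keeps.set (by omega)).set (by omega), h.st, h.q, by simp [hσ₂, h.tl], by simp [hσ₂],
      (Nat.div_le_self _ _).trans hadv⟩
  have h30' : σ₂.var 30 = b := by simp [hσ₂, h30]
  have hv : ∀ i, i ≠ 22 → i ≠ 31 → σ₂.var i = σ.var i := fun i h1 h2 => by simp [hσ₂, h1, h2]
  have e : (Ex.var 31).val σ₂ = c.adv % 2 := by simp [hσ₂]
  rw [wp_block_cons, wp_ite, e, Search.ask]
  refine ⟨by norm_num, fun hne => ?_, fun he => ?_⟩
  · rw [if_neg hne]
    exact wp_mono (L.wp_inclCmd h₂ htl hb h30') fun σ' h' => ⟨h'.1, fun i h22 h24 h31 => by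
      rw [h'.2 i h24, hv i h22 h31]⟩
  · rw [if_pos he]
    exact wp_mono (L.wp_exclCmd h₂ hb h30') fun σ' h' => ⟨h'.1, fun i h22 h24 h31 => by
      rw [h'.2 i h24, hv i h22 h31]⟩

theorem wp_scanCmd {σ : Store} {c : Search} (h : Shows K D V M c σ) {h' : ℕ}
    (H : D.SearchInv h' h' c) (hh : h' < c.tl) (h25 : σ.var 25 = c.q h') {f : Prop}
    (h26 : σ.var 26 = 0 ↔ f) :
    wp K scanCmd (fun σ' => Shows K D V M (D.scan (c.q h') f c D.m2) σ' ∧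
      (∀ i < 22, σ'.var i = σ.var i) ∧ σ'.var 23 = σ.var 23) σ := by
  have hN := L.nums
  have hx : c.q h' < D.n := H.lt _ (by
    have := (H.mem_q _).2 ⟨h', hh, rfl⟩
    omega)
  refine wp_loop D.m2 (by rw [h.keeps.var 2 (by omega), L.v2]) (by norm_num) L.β2
    (fun j σ' => Shows K D V M (D.scan (c.q h') f c j) σ' ∧
      ∀ i < 28, i ≠ 22 → i ≠ 24 → σ'.var i = σ.var i) ?_ ?_ ?_
  · exact ⟨h.set (by omega) (by omega) (by omega), fun i hi _ _ => by
      rw [Store.set_var, if_neg (by omega)]⟩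
  · rintro j hj σ₁ ⟨h₁, hv⟩ h28 h2
    have htl := (H.scan hh f j hj.le).1.tl_le
    have hb := D.dst_lt j hj
    rw [Net.scan]
    set c₁ := D.scan (c.q h') f c j
    have fin : ∀ {c₂ σ₂}, Shows K D V M c₂ σ₂ → (∀ i < 29, i ≠ 22 → i ≠ 24 → σ₂.var i = σ₁.var i) →
        σ₂.var 28 = j ∧ σ₂.var 2 = D.m2 ∧ Shows K D V M c₂ (σ₂.set 28 (j + 1)) ∧
          ∀ i < 28, i ≠ 22 → i ≠ 24 → (σ₂.set 28 (j + 1)).var i = σ.var i := fun h₂ hv₂ =>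
      ⟨by rw [hv₂ 28 (by omega) (by omega) (by omega), h28],
        by rw [hv₂ 2 (by omega) (by omega) (by omega), h2],
        h₂.set (by omega) (by omega) (by omega), fun i hi h22 h24 => by
          rw [Store.set_var, if_neg (by omega), hv₂ i (by omega) h22 h24, hv i hi h22 h24]⟩
    refine L.wp_atOpenArc h₁ hj hx (by rw [hv 25 (by omega) (by omega) (by omega), h25]) h28
      (fun σ₂ h₂ hv₂ hn => ?_) fun σ₂ h₂ hv₂ h30 hs h0 => ?_
    · rw [Net.arcStep, if_neg hn]
      exact fin h₂ fun i hi _ _ => hv₂ i hi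
    · rw [Net.arcStep, if_pos ⟨hs, h0⟩, wp_ite, val_var, hv₂ 26 (by omega),
        hv 26 (by omega) (by omega) (by omega)]
      refine ⟨by norm_num, fun hne => ?_, fun he => ?_⟩
      · rw [if_neg fun hf => hne (h26.2 hf)]
        exact wp_mono (L.wp_askCmd h₂ htl hb h30) fun σ' h' => fin h'.1 fun i hi h22 h24 => by
          rw [h'.2 i h22 h24 (by omega), hv₂ i hi]
      · rw [if_pos (h26.1 he)]
        exact wp_mono (L.wp_inclCmd h₂ htl hb h30) fun σ' h' => fin h'.1 fun i hi h22 h24 => by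
          rw [h'.2 i h24, hv₂ i hi]
  · rintro σ' ⟨h', hv⟩
    exact ⟨h', fun i hi => hv i (by omega) (by omega) (by omega), hv 23 (by omega) (by omega) (by omega)⟩

theorem wp_roundCmd {σ : Store} {c : Search} (h : Shows K D V M c σ) {h' : ℕ}
    (H : D.SearchInv h' h' c) (h23 : σ.var 23 = h') :
    wp K roundCmd (fun σ' => Shows K D V M (D.round h' c) σ' ∧
      (∀ i < 22, σ'.var i = σ.var i) ∧ σ'.var 23 = σ.var 23) σ := by
  have hN := L.nums
  have htl := H.tl_le
  rw [roundCmd, wp_ite, val_sub, val_var, val_var, h.tl, h23, Net.round]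
  refine ⟨by simp, fun hne => ?_, fun he => ?_⟩
  · have hh : h' < c.tl := by omega
    rw [if_pos hh]
    have hx : c.q h' < D.n := H.lt _ (by
      have := (H.mem_q _).2 ⟨h', hh, rfl⟩
      omega)
    refine wp_block_set (c.q h') (by norm_num) ?_
      (by simp [h.keeps.var 8, h23, h.q h' hh]) ?_
    · simp [h.keeps.var 8, h23]
      exact ⟨by omega, L.readable _ (by omega)⟩
    refine wp_block_of _ (L.wp_testTwoOpen (h.set (by omega) (by omega) (by omega)) hx (by simp)) ?_
    rintro σ₂ ⟨h₂, hv₂, h27⟩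
    have hv₂' : ∀ i < 25, σ₂.var i = σ.var i := fun i hi => by
      rw [hv₂ i (by omega), Store.set_var, if_neg (by omega)]
    have h25 : σ₂.var 25 = c.q h' := by rw [hv₂ 25 (by omega)]; simp
    refine wp_block_of (fun σ' => Shows K D V M c σ' ∧ (∀ i < 26, σ'.var i = σ₂.var i) ∧
      (σ'.var 26 = 0 ↔ D.Forced c (c.q h'))) ?_ ?_
    · have hv : ∀ x, ∀ i < 26, (σ₂.set 26 x).var i = σ₂.var i := fun x i hi => by
        rw [Store.set_var, if_neg (by omega)]
      rw [wp_ite, val_var]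
      refine ⟨by norm_num, fun hne => ⟨by norm_num, by simp,
        h₂.set (by omega) (by omega) (by omega), hv _, ?_⟩, fun he => ⟨by norm_num, ?_,
        h₂.set (by omega) (by omega) (by omega), hv _, ?_⟩⟩
      · refine iff_of_false (by simp) fun hF => hne (h27.2 hF.2)
      · simp [h₂.keeps.var 6, h25]
        exact ⟨by omega, L.readable _ (by omega)⟩
      · have hm := h₂.keeps.mem (V 6 + c.q h') (by omega)
        have hit := L.isTer _ hx
        simp only [Store.set_var, reduceIte, val_mem, val_add, val_var, h₂.keeps.var 6 (by omega), h25,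
          hm, Net.Forced, h27.1 he, not_false_eq_true, and_true]
        rw [← not_iff_not]
        refine (show ¬ M (V 6 + c.q h') = 0 ↔ _ from hit).trans ?_
        push Not
        rfl
    rintro σ₃ ⟨h₃, hv₃, h26⟩
    refine wp_block_of _ (L.wp_scanCmd h₃ H hh (by rw [hv₃ 25 (by omega), h25]) h26) ?_
    rintro σ₄ ⟨h₄, hv₄, h23'⟩
    exact ⟨h₄, fun i hi => by rw [hv₄ i hi, hv₃ i (by omega), hv₂' i (by omega)],
      by rw [h23', hv₃ 23 (by omega), hv₂' 23 (by omega)]; exact h23⟩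
  · rw [if_neg (by omega)]
    exact ⟨h, fun i _ => rfl, h23⟩

/-- The exploration is carried out correctly. -/
theorem wp_exploreCmd {σ : Store} (hk : Keeps V M σ) {a : ℕ} (ha : a ≤ K.b) (h21 : σ.var 21 = a) :
    wp K exploreCmd (fun σ' => Shows K D V M (D.explore a D.n) σ' ∧ ∀ i < 22, σ'.var i = σ.var i)
      σ := by
  have hN := L.nums
  have ht := D.ter_lt 0 D.p_pos
  unfold exploreCmd
  refine wp_block_set a (by norm_num) (by simp) (by simp [h21]) ?_
  refine wp_block_of (fun σ' => Keeps V M σ' ∧ (∀ v < D.n, σ'.mem (V 7 + v) = 0) ∧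
    (∀ i < 22, σ'.var i = σ.var i) ∧ σ'.var 22 = a) ?_ ?_
  · refine wp_loop D.n (by simp [hk.var 1, L.v1]) (by norm_num) L.β1
      (fun j σ' => Keeps V M σ' ∧ (∀ v < j, σ'.mem (V 7 + v) = 0) ∧ (∀ i < 22, σ'.var i = σ.var i) ∧
        σ'.var 22 = a) ?_ ?_ fun σ' h => h
    · refine ⟨(hk.set (by omega)).set (by omega), fun v hv => absurd hv (by omega), fun i hi => ?_,
        by simp⟩
      simp only [Store.set_var]
      rw [if_neg (by omega), if_neg (by omega)]
    · rintro j hj σ₁ ⟨hk₁, hz, hv, h22⟩ h23 h1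
      have e : (Ex.var 7 + Ex.var 23).val σ₁ = V 7 + j := by simp [hk₁.var 7, h23]
      rw [wp_put, e, val_num]
      refine ⟨?_, by simp, h23, h1, (hk₁.put (by omega)).set (by omega), fun v hv => ?_,
        fun i hi => ?_, by simpa using h22⟩
      · simp [hk₁.var 7, h23]
        omega
      · rw [Store.set_mem, Store.put_mem]
        split_ifs with hc
        · rfl
        · exact hz v (by omega)
      · rw [Store.set_var, if_neg (by omega), Store.put_var, hv i hi]
  rintro σ₁ ⟨hk₁, hz, hv, h22⟩
  refine wp_block_put (V 7 + D.ter 0) 1 ?_ (by simp) (by simp [hk₁.var 7, hk₁.var 12, L.v12]) rfl ?_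
  · simp [hk₁.var 7, hk₁.var 12, L.v12]
    omega
  refine wp_block_put (V 8) (D.ter 0) (by simp) (by simp) (by simp [hk₁.var 8])
    (by simp [hk₁.var 12, L.v12]) ?_
  refine wp_block_set 1 (by norm_num) (by simp) rfl ?_
  refine wp_block_of _ ?_ fun σ' h => h
  have hk₂ : Keeps V M (((σ₁.put (V 7 + D.ter 0) 1).put (V 8) (D.ter 0)).set 24 1) :=
    ((hk₁.put (by omega)).put (by omega)).set (by omega)
  refine wp_loop D.n (by rw [hk₂.var 1 (by omega), L.v1]) (by norm_num) L.β1
    (fun j σ' => Shows K D V M (D.explore a j) σ' ∧ ∀ i < 22, σ'.var i = σ.var i) ?_ ?_ ?_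
  · refine ⟨⟨hk₂.set (by omega), fun v hv => ?_, fun i hi => ?_, by simp [Net.explore, Net.start],
      by simp [h22, Net.explore, Net.start], ha⟩, fun i hi => ?_⟩
    · simp only [Store.set_mem, Store.put_mem, Net.explore, Net.start, Function.update_apply]
      rw [if_neg (by omega)]
      split_ifs with h1 h2 h2
      · rfl
      · omega
      · omega
      · exact hz v hv
    · change i < 1 at hi
      simp only [Store.set_mem, Store.put_mem, Net.explore, Net.start]
      rw [if_pos (by omega)]
    · simp only [Store.set_var, Store.put_var]
      rw [if_neg (by omega), if_neg (by omega), hv i hi]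
  · rintro j hj σ₃ ⟨h₃, hv₃⟩ h23 h1
    refine wp_mono (L.wp_roundCmd h₃ (Net.searchInv_explore D a j) h23) ?_
    rintro σ₄ ⟨h₄, hv₄, h23'⟩
    exact ⟨by rw [h23', h23], by rw [hv₄ 1 (by omega), h1],
      h₄.set (by omega) (by omega) (by omega), fun i hi => by
        rw [Store.set_var, if_neg (by omega), hv₄ i hi, hv₃ i hi]⟩
  · exact fun σ' h => h

end Layout

/-! ### The search for a solution -/

/-- The exploration with the advice `a` finds a solution. -/
def Net.Found (D : Net) (om : ℕ → ℕ) (k C a : ℕ) : Prop :=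
  (∀ i < D.p, (D.explore a D.n).st (D.ter i) = 1) ∧ (D.decided (D.explore a D.n)).card ≤ k ∧
    ∑ v ∈ D.decided (D.explore a D.n), om v ≤ C

namespace Layout

variable {K : Par} {D : Net} {om V M : ℕ → ℕ} (L : Layout K D om V M)

include L

/-- The variable `17` is set to `1` if the exploration has found a solution, and kept otherwise. -/
theorem wp_checkCmd {σ : Store} {a k : ℕ} (h : Shows K D V M (D.explore a D.n) σ)
    (h13 : σ.var 13 = k) :
    wp K checkCmd (fun σ' => Keeps V M σ' ∧ (∀ i < 22, i ≠ 17 → σ'.var i = σ.var i) ∧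
      (D.Found om k (V 11) a → σ'.var 17 = 1) ∧
      (¬ D.Found om k (V 11) a → σ'.var 17 = σ.var 17)) σ := by
  have hN := L.nums
  unfold Net.Found
  set c := D.explore a D.n with hc
  unfold checkCmd
  refine wp_block_set 1 (by norm_num) (by simp) rfl ?_
  -- the terminals are included
  refine wp_block_of (fun σ' => Shows K D V M c σ' ∧ (∀ i < 22, σ'.var i = σ.var i) ∧
    (σ'.var 25 ≠ 0 ↔ ∀ i < D.p, c.st (D.ter i) = 1)) ?_ ?_
  · refine wp_loop D.p (by simp [h.keeps.var 3, L.v3]) (by norm_num) L.β3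
      (fun j σ' => Shows K D V M c σ' ∧ (∀ i < 22, σ'.var i = σ.var i) ∧
        (σ'.var 25 ≠ 0 ↔ ∀ i < j, c.st (D.ter i) = 1)) ?_ ?_ fun σ' h => h
    · refine ⟨(h.set (by omega) (by omega) (by omega)).set (by omega) (by omega) (by omega),
        fun i hi => ?_, by simp⟩
      simp only [Store.set_var]
      rw [if_neg (by omega), if_neg (by omega)]
    · rintro j hj σ₁ ⟨h₁, hv, h25⟩ h23 h3
      have htl := D.ter_lt j hj
      have hter := L.ter_val h₁.keeps hj
      refine wp_block_set (c.st (D.ter j)) (by norm_num) ?_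
        (by simp [h₁.keeps.var 7, h₁.keeps.var 5, h23, hter, h₁.st _ htl]) ?_
      · simp [h₁.keeps.var 7, h₁.keeps.var 5, h23, hter]
        and_intros <;> first | omega | exact L.readable _ (by omega)
      have fin : ∀ x, (x ≠ 0 ↔ ∀ i < j + 1, c.st (D.ter i) = 1) →
          ∀ σ₂ : Store, Shows K D V M c σ₂ → (∀ i < 24, σ₂.var i = σ₁.var i) → σ₂.var 25 = x →
          σ₂.var 23 = j ∧ σ₂.var 3 = D.p ∧ Shows K D V M c (σ₂.set 23 (j + 1)) ∧
          (∀ i < 22, (σ₂.set 23 (j + 1)).var i = σ.var i) ∧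
          ((σ₂.set 23 (j + 1)).var 25 ≠ 0 ↔ ∀ i < j + 1, c.st (D.ter i) = 1) := by
        intro x hx σ₂ h₂ hv₂ h25
        refine ⟨by rw [hv₂ 23 (by omega), h23], by rw [hv₂ 3 (by omega), h3],
          h₂.set (by omega) (by omega) (by omega), fun i hi => ?_, ?_⟩
        · rw [Store.set_var, if_neg (by omega), hv₂ i (by omega), hv i hi]
        · rw [Store.set_var, if_neg (by omega), h25]
          exact hx
      have h₂ := h₁.set (i := 26) (x := c.st (D.ter j)) (by omega) (by omega) (by omega)
      have h₃ := h₂.set (i := 25) (x := 0) (by omega) (by omega) (by omega)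
      have hv₂ : ∀ i < 24, (σ₁.set 26 (c.st (D.ter j))).var i = σ₁.var i := fun i hi => by
        rw [Store.set_var, if_neg (by omega)]
      have hv₃ : ∀ i < 24, ((σ₁.set 26 (c.st (D.ter j))).set 25 0).var i = σ₁.var i := fun i hi => by
        rw [Store.set_var, if_neg (by omega), hv₂ i hi]
      have hno : c.st (D.ter j) ≠ 1 → ((0 : ℕ) ≠ 0 ↔ ∀ i < j + 1, c.st (D.ter i) = 1) := fun hne =>
        iff_of_false (by simp) fun hall => hne (hall j (Nat.lt_succ_self j))
      have e : (Ex.var 26).val (σ₁.set 26 (c.st (D.ter j))) = c.st (D.ter j) := by simp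
      rw [wp_block_cons, wp_ite, wp_ite, wp_set, val_sub, e, val_num]
      refine ⟨by simp, fun hne => ⟨by norm_num, by simp, fin 0 (hno (by omega)) _ h₃ hv₃ (by simp)⟩,
        fun he => ⟨by norm_num, fun hne => fin (σ₁.var 25) ?_ _ h₂ hv₂ (by simp),
        fun h0 => ⟨by norm_num, by simp, fin 0 (hno (by omega)) _ h₃ hv₃ (by simp)⟩⟩⟩
      rw [h25, Nat.forall_lt_succ_right]
      exact (and_iff_left (by omega)).symm
  rintro σ₁ ⟨h₁, hv₁, h25⟩
  refine wp_block_set 0 (by norm_num) (by simp) rfl ?_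
  refine wp_block_set 0 (by norm_num) (by simp) rfl ?_
  -- the number and the costs of the decided vertices
  refine wp_block_of (fun σ' => Keeps V M σ' ∧ (∀ i < 22, σ'.var i = σ.var i) ∧
    σ'.var 25 = σ₁.var 25 ∧ σ'.var 26 = (D.decided c).card ∧ σ'.var 27 = ∑ v ∈ D.decided c, om v)
    ?_ ?_
  · refine wp_loop D.n (by simp [h₁.keeps.var 1, L.v1]) (by norm_num) L.β1
      (fun j σ' => Shows K D V M c σ' ∧ (∀ i < 22, σ'.var i = σ.var i) ∧
        σ'.var 25 = σ₁.var 25 ∧ σ'.var 26 = ((Finset.range j).filter fun v => c.st v ≠ 0).card ∧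
        σ'.var 27 = ∑ v ∈ (Finset.range j).filter fun v => c.st v ≠ 0, om v) ?_ ?_
      fun σ' h => ⟨h.1.keeps, h.2⟩
    · refine ⟨((h₁.set ?_ ?_ ?_).set ?_ ?_ ?_).set ?_ ?_ ?_, fun i hi => ?_, by simp, by simp, by simp⟩
      all_goals try omega
      simp only [Store.set_var]
      rw [if_neg (by omega), if_neg (by omega), if_neg (by omega), hv₁ i hi]
    · rintro j hj σ₂ ⟨h₂, hv₂, h25', h26, h27⟩ h23 h1
      have e : (Ex.mem (.var 7 + .var 23)).val σ₂ = c.st j := by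
        simp [h₂.keeps.var 7, h23, h₂.st j hj]
      rw [wp_ite, e, wp_skip]
      refine ⟨?_, fun hne => ?_, fun he => ?_⟩
      · simp [h₂.keeps.var 7, h23]
        exact ⟨by omega, L.readable _ (by omega)⟩
      · have hF : (Finset.range (j + 1)).filter (fun v => c.st v ≠ 0) =
            insert j ((Finset.range j).filter fun v => c.st v ≠ 0) := by
          rw [Finset.range_add_one, Finset.filter_insert, if_pos hne]
        have hj' : j ∉ (Finset.range j).filter fun v => c.st v ≠ 0 := by simp
        have hcard : ((Finset.range j).filter fun v => c.st v ≠ 0).card ≤ j :=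
          (Finset.card_filter_le _ _).trans (by simp)
        have hsum : ∑ v ∈ (Finset.range j).filter (fun v => c.st v ≠ 0), om v + om j ≤ K.B := by
          rw [Nat.add_comm, ← Finset.sum_insert hj']
          refine le_trans (Finset.sum_le_sum_of_subset ?_) L.cost_le
          rw [← hF]
          exact (Finset.filter_subset _ _).trans (Finset.range_subset_range.2 hj)
        have hom : σ₂.mem (5 + j) = om j := by rw [h₂.keeps.mem _ (by omega), L.cost j hj]
        refine wp_block_set (σ₂.var 26 + 1) (by norm_num) ?_ (by simp) ?_
        · simp only [ok_add, ok_var, ok_num, val_var, val_num, h26]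
          omega
        refine wp_block_set (σ₂.var 27 + om j) (by norm_num) ?_ (by simp [h23, hom]) ?_
        · simp [h27, h23, hom]
          and_intros <;> first | omega | exact L.readable _ (by omega)
        rw [wp_block_nil]
        refine ⟨by simp [h23], by simp [h1], ((h₂.set ?_ ?_ ?_).set ?_ ?_ ?_).set ?_ ?_ ?_, fun i hi => ?_,
          by simp [h25'], ?_, ?_⟩
        all_goals try omega
        · simp only [Store.set_var]
          rw [if_neg (by omega), if_neg (by omega), if_neg (by omega), hv₂ i hi]
        · rw [hF, Finset.card_insert_of_notMem hj']
          simp [h26]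
        · rw [hF, Finset.sum_insert hj']
          simp [h27, Nat.add_comm]
      · have hF : (Finset.range (j + 1)).filter (fun v => c.st v ≠ 0) =
            (Finset.range j).filter fun v => c.st v ≠ 0 := by
          rw [Finset.range_add_one, Finset.filter_insert, if_neg (not_not.2 he)]
        refine ⟨h23, h1, h₂.set (by omega) (by omega) (by omega), fun i hi => ?_, by simp [h25'],
          by rw [hF]; simp [h26], by rw [hF]; simp [h27]⟩
        rw [Store.set_var, if_neg (by omega), hv₂ i hi]
  rintro σ₂ ⟨hk₂, hv₂, h25', h26, h27⟩
  have hv₂' : ∀ i < 22, i ≠ 17 → σ₂.var i = σ.var i := fun i hi _ => hv₂ i hi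
  simp only [wp_block_cons, wp_block_nil, wp_ite, wp_skip, wp_set, val_sub, val_var, val_num, ok_sub,
    ok_var, ok_num, h26, h27, h25', hv₂ 13 (by omega), h13, hk₂.var 11 (by omega)]
  refine ⟨by norm_num, fun hne => ⟨hk₂, hv₂', fun hF => ?_, fun _ => hv₂ 17 (by omega)⟩,
    fun he => ⟨by norm_num, fun hne => ⟨hk₂, hv₂', fun hF => ?_, fun _ => hv₂ 17 (by omega)⟩,
    fun he' => ⟨by norm_num, fun hne => ⟨by norm_num, by norm_num, hk₂.set (by omega), fun i hi h17 => ?_,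
      fun _ => by simp, fun hF => ?_⟩,
    fun h0 => ⟨hk₂, hv₂', fun hF => ?_, fun _ => hv₂ 17 (by omega)⟩⟩⟩⟩
  · omega
  · omega
  · rw [Store.set_var, if_neg h17, hv₂ i hi]
  · exact absurd ⟨h25.1 hne, by omega, by omega⟩ hF
  · exact absurd h0 (h25.2 hF.1)

/-- The entry of the table that holds the size of a Steiner tree, minus `1`. -/
theorem steiner_ok {σ : Store} (hk : Keeps V M σ) : steinerEx.Ok K σ ∧
    steinerEx.val σ = tab D V σ (2 ^ D.p - 1) (D.ter 0) := by
  have hN := L.nums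
  have hlt := tab_lt (D := D) (X := 2 ^ D.p - 1) (by omega) (D.ter_lt 0 D.p_pos)
  constructor
  · simp [steinerEx, hk.var 9, hk.var 10, hk.var 1, hk.var 12, L.v1, L.v10, L.v12]
    and_intros <;> first | omega | exact L.readable _ (by omega)
  · simp [steinerEx, hk.var 9, hk.var 10, hk.var 1, hk.var 12, L.v1, L.v10, L.v12, tab]

/-- The search over all advices finds a solution if one of them leads to a solution. Here `ell` is the
size of a Steiner tree, as computed by the table. -/
theorem wp_searchCmd {σ : Store} (hk : Keeps V M σ) {k ell : ℕ} (h3 : K.X 3) (hk3 : M 3 = k)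
    (hell : tab D V σ (2 ^ D.p - 1) (D.ter 0) + 1 = ell) (hle : ell ≤ D.n)
    (hb : 4 ^ (k - ell + D.p) ≤ K.b)
    (h14 : 4 ^ (k - ell + D.p) ≤ K.β 14) (h16 : k - ell + D.p ≤ K.β 16) :
    wp K searchCmd (fun σ' => (σ'.var 0 = 1 ∧ ∃ a < 4 ^ (k - ell + D.p), D.Found om k (V 11) a) ∨
      (σ'.var 0 = 0 ∧ ¬ ∃ a < 4 ^ (k - ell + D.p), D.Found om k (V 11) a)) σ := by
  have hN := L.nums
  have hR : k - ell + D.p < 4 ^ (k - ell + D.p) := Nat.lt_pow_self (by norm_num)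
  set R := k - ell + D.p with hRdef
  have hmem3 : σ.mem 3 = k := by rw [hk.mem 3 (by omega), hk3]
  unfold searchCmd
  refine wp_block_set k (by norm_num) (by simp [h3]) (by simp [hmem3]) ?_
  have hk₁ : Keeps V M (σ.set 13 k) := hk.set (by omega)
  obtain ⟨hok, hval⟩ := L.steiner_ok hk₁
  rw [tab_set] at hval
  refine wp_block_set R (by norm_num) ?_ ?_ ?_
  · simp only [ok_add, ok_sub, ok_var, ok_num, val_add, val_sub, val_var, val_num, hval,
      hk₁.var 3 (by omega), L.v3, Store.set_var, reduceIte, hell]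
    refine ⟨⟨by omega, hok, by omega, by omega⟩, by omega, by omega⟩
  · simp only [val_add, val_sub, val_var, val_num, hval, hk₁.var 3 (by omega), L.v3, Store.set_var,
      reduceIte, hell, hRdef]
  refine wp_block_set 1 (by norm_num) (by simp) rfl ?_
  refine wp_block_of (fun σ' => Keeps V M σ' ∧ σ'.var 13 = k ∧ σ'.var 14 = 4 ^ R) ?_ ?_
  · refine wp_loop R (by simp) (by norm_num) h16
      (fun j σ' => Keeps V M σ' ∧ σ'.var 13 = k ∧ σ'.var 14 = 4 ^ j)
      ⟨((hk₁.set (by omega)).set (by omega)).set (by omega), by simp, by simp⟩ ?_ fun σ' h => h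
    rintro j hj σ₁ ⟨hk₁, h13, h14⟩ h19 h16
    have hpow : 4 ^ j ≤ 4 ^ R := Nat.pow_le_pow_right (by norm_num) hj.le
    have e : (Ex.var 14 + Ex.var 14 + Ex.var 14 + Ex.var 14).val σ₁ = 4 ^ (j + 1) := by
      simp [h14, pow_succ]; ring
    rw [wp_set, e]
    refine ⟨by norm_num, ?_, by simp [h19], by simp [h16], (hk₁.set (by omega)).set (by omega),
      by simp [h13], by simp⟩
    simp [h14]
    omega
  rintro σ₁ ⟨hk₁, h13, h14'⟩
  refine wp_block_set 0 (by norm_num) (by simp) rfl ?_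
  refine wp_block_of (fun σ' => (σ'.var 17 = 1 ∧ ∃ a < 4 ^ R, D.Found om k (V 11) a) ∨
    (σ'.var 17 = 0 ∧ ¬ ∃ a < 4 ^ R, D.Found om k (V 11) a)) ?_ ?_
  · refine wp_loop (4 ^ R) (by simp [h14']) (by norm_num) h14
      (fun j σ' => (Keeps V M σ' ∧ σ'.var 13 = k) ∧
        ((σ'.var 17 = 1 ∧ ∃ a < j, D.Found om k (V 11) a) ∨
        (σ'.var 17 = 0 ∧ ¬ ∃ a < j, D.Found om k (V 11) a)))
      ⟨⟨(hk₁.set (by omega)).set (by omega), by simp [h13]⟩, .inr (by simp)⟩ ?_ fun σ' h => h.2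
    rintro a ha σ₂ ⟨⟨hk₂, h13⟩, hor⟩ h21 h14
    refine wp_seq_of _ (L.wp_exploreCmd hk₂ (by omega) h21) ?_
    rintro σ₃ ⟨h₃, hv₃⟩
    refine wp_mono (L.wp_checkCmd h₃ (by rw [hv₃ 13 (by omega), h13])) ?_
    rintro σ₄ ⟨hk₄, hv₄, hyes, hno⟩
    refine ⟨by rw [hv₄ 21 (by omega) (by omega), hv₃ 21 (by omega), h21],
      by rw [hv₄ 14 (by omega) (by omega), hv₃ 14 (by omega), h14], ⟨hk₄.set (by omega), ?_⟩, ?_⟩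
    · rw [Store.set_var, if_neg (by omega), hv₄ 13 (by omega) (by omega), hv₃ 13 (by omega), h13]
    · rw [Store.set_var, if_neg (by omega)]
      by_cases hF : D.Found om k (V 11) a
      · exact .inl ⟨hyes hF, a, Nat.lt_succ_self a, hF⟩
      · rw [hno hF, hv₃ 17 (by omega)]
        refine hor.imp (fun ⟨h, a', ha', hF'⟩ => ⟨h, a', by omega, hF'⟩)
          fun ⟨h, hn⟩ => ⟨h, fun ⟨a', ha', hF'⟩ => ?_⟩
        rcases Nat.lt_succ_iff_lt_or_eq.1 ha' with h | rfl
        exacts [hn ⟨a', h, hF'⟩, hF hF']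
  intro σ₂ hor
  rw [wp_block_cons, wp_set]
  refine ⟨by norm_num, by simp, ?_⟩
  simpa using hor

/-- The main program answers correctly. The bounds only have to be large enough in terms of `k`, and
`k` only has to be readable, if the terminals can be connected; otherwise `k` may be arbitrarily large
although `r = 0`. -/
theorem wp_mainCmd {σ : Store} (hk : Keeps V M σ) (h0 : V 0 = 0) {k : ℕ} (hk3 : M 3 = k)
    (hell : ∀ ell, (∃ A, D.Sol A ∧ A.card = ell) → (∀ A, D.Sol A → ell ≤ A.card) →
      K.X 3 ∧ 4 ^ (k - ell + D.p) ≤ K.b ∧ 4 ^ (k - ell + D.p) ≤ K.β 14 ∧ k - ell + D.p ≤ K.β 16) :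
    wp K mainCmd (fun σ' => ∃ b : Bool, σ'.var 0 = b.toNat ∧
      (b = true ↔ ∃ A, D.YesSet om k (V 11) A)) σ := by
  unfold mainCmd
  refine wp_block_of _ (L.wp_fillTable hk) ?_
  rintro σ₁ ⟨hk₁, hs, hc⟩
  obtain ⟨hok, hval⟩ := L.steiner_ok hk₁
  rw [wp_block_cons, wp_ite, val_sub, hval, val_var, hk₁.var 1 (by omega), L.v1]
  refine ⟨⟨by norm_num, hok⟩, fun hne => ?_, fun he => ⟨false, ?_, ?_⟩⟩
  · obtain ⟨A, hA, hAc⟩ := hs.exists_sol (by omega)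
    have hmin : ∀ A, D.Sol A → tab D V σ₁ (2 ^ D.p - 1) (D.ter 0) + 1 ≤ A.card :=
      fun A hA => hc.card_sol hA
    obtain ⟨h3, hb, h14, h16⟩ := hell _ ⟨A, hA, le_antisymm hAc (hmin A hA)⟩ hmin
    refine wp_mono (L.wp_searchCmd hk₁ h3 hk3 rfl (by omega) hb h14 h16) ?_
    rintro σ₂ (⟨h, a, -, hF⟩ | ⟨h, hn⟩)
    · exact ⟨true, h, iff_of_true rfl ⟨_, Net.yesSet_of_explore hF.1 hF.2.1 hF.2.2⟩⟩
    · refine ⟨false, h, iff_of_false (by simp) fun ⟨A, hA⟩ => ?_⟩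
      obtain ⟨a, ha, hF⟩ := hA.exists_explore hmin
      exact hn ⟨a, ha, hF⟩
  · rw [hk₁.var 0 (by omega), h0]; rfl
  · refine iff_of_false (by simp) fun ⟨A, hA⟩ => ?_
    have h1 := hc.card_sol hA.1
    have h2 : A.card ≤ D.n := by simpa using Finset.card_le_card hA.1.1
    omega

end Layout

section

/-! ### The preparation of the variables -/

/-- The memory `M` holds the input that consists of the graph and the terminals `D`, the costs `om`
and the bounds `k` and `C`, followed by zeros. -/
structure Holds (D : Net) (om : ℕ → ℕ) (k C : ℕ) (M : ℕ → ℕ) : Prop where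
  n : M 0 = D.n
  m : 2 * M 1 = D.m2
  p : M 2 = D.p
  k : M 3 = k
  C : M 4 = C
  cost : ∀ v < D.n, M (5 + v) = om v
  src : ∀ j < D.m2, M (5 + D.n + j) = D.src j
  dst : ∀ j < D.m2, M (5 + D.n + (4 * (j / 2) + 1 - j)) = D.dst j
  ter : ∀ i < D.p, M (5 + D.n + D.m2 + i) = D.ter i
  rest : ∀ a, 5 + D.n + D.m2 + D.p ≤ a → M a = 0

/-- The bounds of `K` are large enough for the input. -/
structure Roomy (K : Par) (D : Net) (om : ℕ → ℕ) : Prop where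
  readable : ∀ a, a ≠ 3 → a ≠ 4 → K.X a
  β1 : D.n ≤ K.β 1
  β2 : D.m2 ≤ K.β 2
  β3 : D.p ≤ K.β 3
  β10 : 2 ^ D.p ≤ K.β 10
  β15 : 2 ^ D.p * D.n ≤ K.β 15
  n_le : D.n ≤ K.b
  m2_le : D.m2 ≤ K.b
  pow_le : 2 ^ D.p ≤ K.b
  addr_le : 5 + D.n + D.m2 + D.p + 3 * D.n + 2 ^ D.p * D.n ≤ K.B
  cost_le : ∑ v ∈ Finset.range D.n, om v ≤ K.B

open Ex in
/-- Compute the base addresses, the number of sets of terminals, the sum of the costs, and mark the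
terminals. -/
def prepCmd : Cmd := .block [
  .set 1 (mem (num 0)),
  .set 2 (mem (num 1) + mem (num 1)),
  .set 3 (mem (num 2)),
  .set 4 (num 5 + var 1),
  .set 5 (var 4 + var 2),
  .set 6 (var 5 + var 3),
  .set 7 (var 6 + var 1),
  .set 8 (var 7 + var 1),
  .set 9 (var 8 + var 1),
  .set 12 (mem (var 5)),
  .set 10 (num 1),
  .loop 20 3 (.set 10 (var 10 + var 10)),
  .set 11 (num 0),
  .loop 20 1 (.set 11 (var 11 + mem (num 5 + var 20))),
  .loop 20 3 (.put (var 6 + mem (var 5 + var 20)) (num 1))]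

open Ex in
/-- Replace the sum of the costs by `C` if `C` is smaller. This is the only command that reads
`C`. -/
def capCmd : Cmd := .ite (var 11 - mem (num 4)) (.set 11 (mem (num 4))) .skip

/-- The variables and the memory after the preparation. -/
structure Prepared (D : Net) (om M : ℕ → ℕ) (σ : Store) : Prop where
  v0 : σ.var 0 = 0
  v1 : σ.var 1 = D.n
  v2 : σ.var 2 = D.m2
  v3 : σ.var 3 = D.p
  v4 : σ.var 4 = 5 + D.n
  v5 : σ.var 5 = 5 + D.n + D.m2
  v6 : σ.var 6 = 5 + D.n + D.m2 + D.p
  v7 : σ.var 7 = 5 + D.n + D.m2 + D.p + D.n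
  v8 : σ.var 8 = 5 + D.n + D.m2 + D.p + D.n + D.n
  v9 : σ.var 9 = 5 + D.n + D.m2 + D.p + D.n + D.n + D.n
  v10 : σ.var 10 = 2 ^ D.p
  v11 : σ.var 11 = ∑ v ∈ Finset.range D.n, om v
  v12 : σ.var 12 = D.ter 0
  mem : ∀ a < 5 + D.n + D.m2 + D.p, σ.mem a = M a
  isTer : ∀ v < D.n, σ.mem (5 + D.n + D.m2 + D.p + v) ≠ 0 ↔ ∃ i < D.p, D.ter i = v

/-- The values of the variables that the assignments at the beginning of the preparation set for
good. -/
structure Addressed (D : Net) (σ : Store) : Prop where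
  v0 : σ.var 0 = 0
  v1 : σ.var 1 = D.n
  v2 : σ.var 2 = D.m2
  v3 : σ.var 3 = D.p
  v4 : σ.var 4 = 5 + D.n
  v5 : σ.var 5 = 5 + D.n + D.m2
  v6 : σ.var 6 = 5 + D.n + D.m2 + D.p
  v7 : σ.var 7 = 5 + D.n + D.m2 + D.p + D.n
  v8 : σ.var 8 = 5 + D.n + D.m2 + D.p + D.n + D.n
  v9 : σ.var 9 = 5 + D.n + D.m2 + D.p + D.n + D.n + D.n
  v12 : σ.var 12 = D.ter 0

theorem Addressed.congr {D : Net} {σ σ' : Store} (h : Addressed D σ)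
    (hv : ∀ i < 13, i ≠ 10 → i ≠ 11 → σ'.var i = σ.var i) : Addressed D σ' := by
  obtain ⟨h0, h1, h2, h3, h4, h5, h6, h7, h8, h9, h12⟩ := h
  constructor <;> rw [hv _ (by norm_num) (by norm_num) (by norm_num)] <;> assumption

theorem Addressed.set {D : Net} {σ : Store} (h : Addressed D σ) {i x : ℕ}
    (hi : i = 10 ∨ i = 11 ∨ 13 ≤ i) : Addressed D (σ.set i x) :=
  h.congr fun j _ _ _ => by rw [Store.set_var, if_neg (by omega)]

variable {K : Par} {D : Net} {om M : ℕ → ℕ} {k C : ℕ}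

/-- The preparation is carried out correctly. -/
theorem wp_prepCmd (R : Roomy K D om) (H : Holds D om k C M) {σ : Store}
    (h0 : σ.var 0 = 0) (hM : σ.mem = M) : wp K prepCmd (Prepared D om M) σ := by
  have hp := D.p_pos
  have hn : 0 < D.n := (Nat.zero_le _).trans_lt (D.ter_lt 0 hp)
  have hpn : 2 ^ D.p ≤ 2 ^ D.p * D.n := Nat.le_mul_of_pos_right _ hn
  have hA := R.addr_le
  have hr : ∀ a, a ≠ 3 → a ≠ 4 → K.X a := R.readable
  have hm : M 1 + M 1 = D.m2 := by have := H.m; omega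
  have ht : M (5 + D.n + D.m2) = D.ter 0 := by simpa using H.ter 0 hp
  unfold prepCmd
  refine wp_block_set D.n (by norm_num) (by simp; exact hr _ (by omega) (by omega))
    (by simp [hM, H.n]) ?_
  refine wp_block_set D.m2 (by norm_num) ?_ (by simp [hM, hm]) ?_
  · simp [hM, hm]
    exact ⟨hr _ (by omega) (by omega), by omega⟩
  refine wp_block_set D.p (by norm_num) (by simp; exact hr _ (by omega) (by omega))
    (by simp [hM, H.p]) ?_
  refine wp_block_set (5 + D.n) (by norm_num) (by simp; omega) (by simp) ?_
  refine wp_block_set (5 + D.n + D.m2) (by norm_num) (by simp; omega) (by simp) ?_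
  refine wp_block_set (5 + D.n + D.m2 + D.p) (by norm_num) (by simp; omega) (by simp) ?_
  refine wp_block_set (5 + D.n + D.m2 + D.p + D.n) (by norm_num) (by simp; omega) (by simp) ?_
  refine wp_block_set (5 + D.n + D.m2 + D.p + D.n + D.n) (by norm_num) (by simp; omega)
    (by simp) ?_
  refine wp_block_set (5 + D.n + D.m2 + D.p + D.n + D.n + D.n) (by norm_num) (by simp; omega)
    (by simp) ?_
  refine wp_block_set (D.ter 0) (by norm_num) (by simp; exact hr _ (by omega) (by omega))
    (by simp [hM, ht]) ?_
  refine wp_block_set 1 (by norm_num) (by simp) rfl ?_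
  refine wp_block_of (fun σ' => Addressed D σ' ∧ σ'.mem = M ∧ σ'.var 10 = 2 ^ D.p) ?_ ?_
  · refine wp_loop D.p (by simp) (by norm_num) R.β3
      (fun j σ' => Addressed D σ' ∧ σ'.mem = M ∧ σ'.var 10 = 2 ^ j)
      ⟨by constructor <;> simp [h0], by simpa using hM, by simp⟩ ?_ fun σ' h => h
    rintro j hj σ₁ ⟨hA₁, hm₁, h10⟩ h20 -
    have hpow : 2 ^ (j + 1) ≤ 2 ^ D.p := Nat.pow_le_pow_right (by norm_num) hj
    have e : 2 ^ j + 2 ^ j = 2 ^ (j + 1) := by rw [pow_succ]; ring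
    simp only [wp_set, val_add, val_var, ok_add, ok_var, h10, e]
    exact ⟨by norm_num, ⟨by norm_num, by norm_num, by omega⟩, by simp [h20], by simp [hA₁.v3],
      (hA₁.set (by omega)).set (by omega), hm₁, by simp⟩
  rintro σ₁ ⟨hA₁, hm₁, h10⟩
  refine wp_block_set 0 (by norm_num) (by simp) rfl ?_
  refine wp_block_of (fun σ' => Addressed D σ' ∧ σ'.mem = M ∧ σ'.var 10 = 2 ^ D.p ∧
    σ'.var 11 = ∑ v ∈ Finset.range D.n, om v) ?_ ?_
  · refine wp_loop D.n (by simp [hA₁.v1]) (by norm_num) R.β1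
      (fun j σ' => Addressed D σ' ∧ σ'.mem = M ∧ σ'.var 10 = 2 ^ D.p ∧
        σ'.var 11 = ∑ v ∈ Finset.range j, om v)
      ⟨(hA₁.set (by omega)).set (by omega), hm₁, by simp [h10], by simp⟩ ?_ fun σ' h => h
    rintro j hj σ₂ ⟨hA₂, hm₂, h10, h11⟩ h20 -
    have hle : ∑ v ∈ Finset.range (j + 1), om v ≤ K.B :=
      (Finset.sum_le_sum_of_subset (Finset.range_subset_range.2 hj)).trans R.cost_le
    have e : (Ex.var 11 + Ex.mem (.num 5 + .var 20)).val σ₂ = ∑ v ∈ Finset.range (j + 1), om v := by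
      simp [h11, h20, hm₂, H.cost j hj, Finset.sum_range_succ]
    have e' := e
    rw [val_add] at e'
    rw [wp_set, e]
    refine ⟨by norm_num, (ok_add _ _).2 ⟨by simp, ?_, e'.trans_le hle⟩, by simp [h20],
      by simp [hA₂.v1], (hA₂.set (by omega)).set (by omega), hm₂, by simp [h10], by simp⟩
    simp [h20]
    exact ⟨by omega, hr _ (by omega) (by omega)⟩
  rintro σ₂ ⟨hA₂, hm₂, h10, h11⟩
  refine wp_block_of (Prepared D om M) ?_ fun σ' h => h
  refine wp_loop D.p hA₂.v3 (by norm_num) R.β3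
    (fun j σ' => Addressed D σ' ∧ σ'.var 10 = 2 ^ D.p ∧ σ'.var 11 = ∑ v ∈ Finset.range D.n, om v ∧
      (∀ a < 5 + D.n + D.m2 + D.p, σ'.mem a = M a) ∧
      ∀ v < D.n, σ'.mem (5 + D.n + D.m2 + D.p + v) ≠ 0 ↔ ∃ i < j, D.ter i = v) ?_ ?_ ?_
  · refine ⟨hA₂.set (by omega), by simp [h10], by simp [h11], fun a _ => by simp [hm₂], fun v _ => ?_⟩
    simp [hm₂, H.rest]
  · rintro j hj σ₃ ⟨hA₃, h10, h11, hm₃, hT⟩ h20 h3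
    have htl := D.ter_lt j hj
    have hter : σ₃.mem (5 + D.n + D.m2 + j) = D.ter j := by rw [hm₃ _ (by omega), H.ter j hj]
    simp only [wp_put, val_add, val_var, val_mem, val_num, ok_add, ok_var, ok_mem, ok_num, hA₃.v6,
      hA₃.v5, h20, hter]
    refine ⟨⟨by norm_num, ⟨⟨by norm_num, by norm_num, by omega⟩, hr _ (by omega) (by omega)⟩,
      by omega⟩, by norm_num, h20, h3, (hA₃.congr (σ' := σ₃.put _ _) fun _ _ _ _ => rfl).set (by omega),
      by simp [h10], by simp [h11], fun a ha => ?_, fun v hv => ?_⟩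
    · rw [Store.set_mem, Store.put_mem, if_neg (by omega), hm₃ a ha]
    · rw [Store.set_mem, Store.put_mem]
      have hex : (∃ i < j + 1, D.ter i = v) ↔ (∃ i < j, D.ter i = v) ∨ D.ter j = v := by
        constructor
        · rintro ⟨i, hi, he⟩
          rcases Nat.lt_succ_iff_lt_or_eq.1 hi with h | rfl
          exacts [.inl ⟨i, h, he⟩, .inr he]
        · rintro (⟨i, hi, he⟩ | he)
          exacts [⟨i, by omega, he⟩, ⟨j, by omega, he⟩]
      rw [hex]
      split_ifs with h
      · exact iff_of_true (by norm_num) (.inr (by omega))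
      · rw [hT v hv]
        exact ⟨.inl, fun h' => h'.resolve_right fun h'' => h (by omega)⟩
  · rintro σ' ⟨⟨h0, h1, h2, h3, h4, h5, h6, h7, h8, h9, h12⟩, h10, h11, hm, hT⟩
    exact ⟨h0, h1, h2, h3, h4, h5, h6, h7, h8, h9, h10, h11, h12, hm, hT⟩

/-- After the preparation, the main program can start. It does not depend on which bound `x` on the
cost is chosen then. -/
theorem Prepared.layout {σ : Store} (P : Prepared D om M σ) (R : Roomy K D om)
    (H : Holds D om k C M) {x : ℕ} : Layout K D om (σ.set 11 x).var (σ.set 11 x).mem where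
  v1 := by simp [P.v1]
  v2 := by simp [P.v2]
  v3 := by simp [P.v3]
  v4 := by simp [P.v4]
  v5 := by simp [P.v5, P.v4]
  v6 := by simp [P.v6, P.v5]
  v7 := by simp [P.v7, P.v6]
  v8 := by simp [P.v8, P.v7]
  v9 := by simp [P.v9, P.v8]
  v10 := by simp [P.v10]
  v12 := by simp [P.v12]
  cost v hv := by rw [Store.set_mem, P.mem _ (by omega), H.cost v hv]
  src j hj := by simpa [P.v4] using (P.mem _ (by omega)).trans (H.src j hj)
  dst j hj := by
    have := H.m
    simpa [P.v4] using (P.mem _ (by omega)).trans (H.dst j hj)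
  even := ⟨_, H.m.symm⟩
  ter i hi := by simpa [P.v5] using (P.mem _ (by omega)).trans (H.ter i hi)
  isTer v hv := by simpa [P.v6] using P.isTer v hv
  readable a ha := R.readable a (by omega) (by omega)
  β1 := R.β1
  β2 := R.β2
  β3 := R.β3
  β10 := R.β10
  β15 := R.β15
  n_le := R.n_le
  m2_le := R.m2_le
  pow_le := R.pow_le
  addr_le := by
    have := R.addr_le
    simp [P.v9]
    omega
  cost_le := R.cost_le

end

section

/-! ### The running time -/

/-- The program that solves Secluded Steiner Tree. -/
def solver : Prog := .seq prepCmd.code (.seq capCmd.code mainCmd.code)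

theorem coinFree_solver : solver.CoinFree :=
  ⟨prepCmd.coinFree_code, capCmd.coinFree_code, mainCmd.coinFree_code⟩

theorem size_le_of_le_pow {x a : ℕ} (h : x ≤ 2 ^ a) : x.size ≤ a + 1 :=
  Nat.size_le.2 (h.trans_lt (Nat.pow_lt_pow_right one_lt_two (Nat.lt_succ_self a)))

theorem words_le_of_le_pow {w x a d : ℕ} (hw : 1 ≤ w) (h : x ≤ 2 ^ (a * w + d)) :
    words w x ≤ a + d + 2 := by
  have h1 : x.size / w ≤ (a * w + (d + 1)) / w := Nat.div_le_div_right (size_le_of_le_pow h)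
  rw [Nat.mul_comm, Nat.mul_add_div (by omega)] at h1
  have h2 : (d + 1) / w ≤ d + 1 := Nat.div_le_self _ _
  unfold words
  omega

/-- The bound on the operands of multiplications, where `q = p + r`. -/
def smallBound (n q : ℕ) : ℕ := 4 ^ (q + 2) * (n + 1) ^ 2

/-- The bound on all numbers except for `C`. -/
def largeBound (n q W : ℕ) : ℕ := smallBound n q * smallBound n q * (W + 1)

/-- The bounds on the loops. -/
def loopBound (n m2 p q : ℕ) : ℕ → ℕ
  | 1 => n
  | 2 => m2
  | 3 => p
  | 10 => 2 ^ p
  | 14 => 4 ^ q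
  | 15 => 2 ^ p * n
  | 16 => q
  | _ => 0

theorem Ex.steps_sub (e f : Ex) : (e - f).steps = e.steps + f.steps + 1 := rfl

theorem Ex.steps_div (e f : Ex) : (e / f).steps = e.steps + f.steps + 1 := rfl

theorem steps_prepCmd (n m2 p q : ℕ) :
    prepCmd.steps (loopBound n m2 p q) = 89 + p * 42 + n * 22 := by
  simp only [prepCmd, Cmd.steps, Cmd.block, Ex.steps, loopBound]
  ring

theorem steps_mainCmd (n m2 p q : ℕ) :
    mainCmd.steps (loopBound n m2 p q) = 112 + p * 37 + q * 25 +
      n * (38 + 2 ^ p * 39 + 2 ^ p * 2 ^ p * (p * 49 + m2 * 96 + 42)) +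
      4 ^ q * (91 + p * 40 + n * (m2 * 222 + 119)) := by
  simp only [mainCmd, fillTable, searchCmd, testDisjoint, relaxArc, exploreCmd, checkCmd,
    roundCmd, scanCmd, testTwoOpen, atOpenArc, askCmd, inclCmd, exclCmd, steinerEx, headEx, neqEx,
    Cmd.steps, Cmd.block, Ex.steps, Ex.steps_sub, Ex.steps_div, loopBound, Nat.reduceAdd]
  generalize 2 ^ p = P
  generalize 4 ^ q = F
  ring

/-- The number of steps of the program. -/
theorem steps_le {n m2 m' p q : ℕ} (hn : 1 ≤ n) (hm : m2 ≤ 2 * m') (hm' : 1 ≤ m') (hpq : p ≤ q)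
    (hq : 1 ≤ q) : prepCmd.steps (loopBound n m2 p q) + mainCmd.steps (loopBound n m2 p q) ≤
      2048 * (4 ^ q * q * n * m') := by
  rw [steps_prepCmd, steps_mainCmd]
  have hP : 1 ≤ 2 ^ p := Nat.one_le_two_pow
  have hPF : 2 ^ p * 2 ^ p ≤ 4 ^ q := by
    rw [← Nat.mul_pow]
    exact Nat.pow_le_pow_right (by norm_num) hpq
  generalize 2 ^ p = P at *
  generalize 4 ^ q = F at *
  have hPF' : P ≤ F := (Nat.le_mul_self P).trans hPF
  have hF : 1 ≤ F := hP.trans hPF'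
  -- every monomial is at most the product of all the factors
  have mono : ∀ {a b c d}, a ≤ F → b ≤ q → c ≤ n → d ≤ m' → a * b * c * d ≤ F * q * n * m' :=
    fun h1 h2 h3 h4 => Nat.mul_le_mul (Nat.mul_le_mul (Nat.mul_le_mul h1 h2) h3) h4
  have u1 := mono hF hq hn hm'
  have u2 := mono hF hpq hn hm'
  have u3 := mono hF hq le_rfl hm'
  have u4 := mono hF le_rfl hn hm'
  have u5 := mono hPF' hq le_rfl hm'
  have u6 := mono hPF hq le_rfl hm'
  have u7 := mono hPF hpq le_rfl hm'
  have u8 := mono hPF hq le_rfl le_rfl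
  have u8' : P * P * 1 * n * m2 ≤ P * P * 1 * n * (2 * m') := Nat.mul_le_mul_left _ hm
  have u9 := mono le_rfl hq hn hm'
  have u10 := mono le_rfl hq le_rfl hm'
  have u11 := mono le_rfl hq le_rfl le_rfl
  have u11' : F * 1 * n * m2 ≤ F * 1 * n * (2 * m') := Nat.mul_le_mul_left _ hm
  have u12 := mono le_rfl hpq hn hm'
  generalize hU : F * q * n * m' = U at *
  linarith only [u1, u2, u3, u4, u5, u6, u7, u8, u8', u9, u10, u11, u11', u12]

theorem smallBound_le (n q : ℕ) : smallBound n q ≤ 2 ^ (2 * n.size + (2 * q + 4)) := by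
  have h : (n + 1) ^ 2 ≤ (2 ^ n.size) ^ 2 := Nat.pow_le_pow_left (Nat.lt_size_self n) 2
  calc smallBound n q ≤ 4 ^ (q + 2) * (2 ^ n.size) ^ 2 := Nat.mul_le_mul_left _ h
    _ = 2 ^ (2 * n.size + (2 * q + 4)) := by
      rw [show 4 = 2 ^ 2 by norm_num, ← pow_mul, ← pow_mul, ← pow_add]
      congr 1
      ring

theorem largeBound_le (n q W : ℕ) :
    largeBound n q W ≤ 2 ^ (4 * n.size + (4 * q + 9 + Nat.log 2 W)) := by
  have h := smallBound_le n q
  calc largeBound n q W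
      ≤ 2 ^ (2 * n.size + (2 * q + 4)) * 2 ^ (2 * n.size + (2 * q + 4)) * 2 ^ (Nat.log 2 W + 1) :=
        Nat.mul_le_mul (Nat.mul_le_mul h h) (Nat.lt_pow_succ_log_self one_lt_two W)
    _ = _ := by
      rw [← pow_add, ← pow_add]
      congr 1
      ring

theorem le_smallBound (n q : ℕ) : 16 * 4 ^ q * (n + 1) ≤ smallBound n q := by
  calc 16 * 4 ^ q * (n + 1) ≤ 16 * 4 ^ q * (n + 1) * (n + 1) :=
        Nat.le_mul_of_pos_right _ (Nat.succ_pos n)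
    _ = smallBound n q := by rw [smallBound, pow_add]; ring

/-- The parameters of the run. Both bounds have `O(p + r)` words, apart from the words of the costs;
`k` may be read only if the terminals can be connected, and `C` may not be read. -/
def runPar (D : Net) (q W : ℕ) (hn : 1 ≤ D.n) : Par where
  w := D.n.size
  b := smallBound D.n q
  B := largeBound D.n q W
  κ := (2 * q + 8) * (2 * q + 8) + 2 * (4 * q + 15 + Nat.log 2 W)
  β := loopBound D.n D.m2 D.p q
  X a := a ≠ 4 ∧ (a = 3 → ∃ A, D.Sol A)
  eight_le := by
    have h1 := le_smallBound D.n q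
    have h2 : 16 * 1 * 1 ≤ 16 * 4 ^ q * (D.n + 1) :=
      Nat.mul_le_mul (Nat.mul_le_mul_left _ (Nat.one_le_pow _ _ (by norm_num))) (by omega)
    omega
  sq_le := Nat.le_mul_of_pos_right _ (Nat.succ_pos W)
  two_words_le := by
    have := words_le_of_le_pow (Nat.size_pos.2 hn) (largeBound_le D.n q W)
    omega
  words_sq_le := by
    have := words_le_of_le_pow (Nat.size_pos.2 hn) (smallBound_le D.n q)
    exact (Nat.mul_le_mul this this).trans (by rw [show 2 + (2 * q + 4) + 2 = 2 * q + 8 by ring]; omega)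

/-- The parameters for the command that reads `C`, which knows that all variables are at most
`x`. -/
def capPar (w x C : ℕ) : Par where
  w := w
  b := 8
  B := x + C + 64
  κ := words w 8 * words w 8 + 2 * words w (x + C + 64)
  β _ := 0
  X a := a = 4
  eight_le := le_rfl
  sq_le := by omega
  two_words_le := by omega
  words_sq_le := by omega

theorem Net.yesSet_min {D : Net} {om : ℕ → ℕ} {k C : ℕ} {A : Finset ℕ} :
    D.YesSet om k (min C (∑ v ∈ Finset.range D.n, om v)) A ↔ D.YesSet om k C A := by
  have h : ∑ v ∈ D.nbd A, om v ≤ ∑ v ∈ Finset.range D.n, om v :=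
    Finset.sum_le_sum_of_subset fun v hv => Finset.mem_range.2 (Net.mem_nbd.1 hv).1
  unfold Net.YesSet
  rw [le_min_iff, and_iff_left h]

theorem words_cap_le {w x C a d : ℕ} (hw : 1 ≤ w) (hx : x ≤ 2 ^ (a * w + (d + 6))) :
    words w (x + C + 64) ≤ a + d + Nat.log 2 C + 11 := by
  have h1 : 2 ^ (a * w + (d + 6)) ≤ 2 ^ (a * w + (d + Nat.log 2 C + 7)) :=
    Nat.pow_le_pow_right (by norm_num) (by omega)
  have h2 : C ≤ 2 ^ (a * w + (d + Nat.log 2 C + 7)) :=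
    (Nat.lt_pow_succ_log_self one_lt_two C).le.trans (Nat.pow_le_pow_right (by norm_num) (by omega))
  have h3 : 2 ^ 6 ≤ 2 ^ (a * w + (d + Nat.log 2 C + 7)) :=
    Nat.pow_le_pow_right (by norm_num) (by omega)
  have h4 : 2 ^ (a * w + (d + Nat.log 2 C + 9)) = 4 * 2 ^ (a * w + (d + Nat.log 2 C + 7)) := by
    rw [show a * w + (d + Nat.log 2 C + 9) = (a * w + (d + Nat.log 2 C + 7)) + 2 by ring, pow_add]
    ring
  have := words_le_of_le_pow (x := x + C + 64) (a := a) (d := d + Nat.log 2 C + 9) hw (by omega)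
  omega

/-- The sum of the times of the parts of the program, in closed form. -/
theorem total_time_le {n m' q W C s : ℕ} (hn : 1 ≤ n) (hm' : 1 ≤ m') (hq : 1 ≤ q)
    (hs : s ≤ 2048 * (4 ^ q * q * n * m')) :
    ((2 * q + 8) * (2 * q + 8) + 2 * (4 * q + 15 + Nat.log 2 W)) * s +
      (25 + 2 * (4 + (4 * q + 3 + Nat.log 2 W) + Nat.log 2 C + 11)) * 11 ≤
      2 ^ (24 * q) * (n * m') * max 1 (Nat.log 2 W) + 24 * Nat.log 2 C := by
  set L := max 1 (Nat.log 2 W) with hL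
  have hL1 : 1 ≤ L := le_max_left _ _
  have hL2 : Nat.log 2 W ≤ L := le_max_right _ _
  generalize Nat.log 2 W = lw at *
  have hqL : q ≤ q * L := Nat.le_mul_of_pos_right _ hL1
  have hqq : q ≤ q * q := Nat.le_mul_of_pos_right _ hq
  have hLq : L ≤ q * L := Nat.le_mul_of_pos_left _ hq
  have hqqL : q * q ≤ q * q * L := Nat.le_mul_of_pos_right _ hL1
  have hLqq : q * L ≤ q * q * L := Nat.mul_le_mul_right _ hqq
  have h1 : (2 * q + 8) * (2 * q + 8) + 2 * (4 * q + 15 + lw) ≤ 140 * (q * q * L) := by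
    have e : (2 * q + 8) * (2 * q + 8) = 4 * (q * q) + 32 * q + 64 := by ring
    rw [e]
    omega
  have h2 : q * L ≤ q * q * L * (4 ^ q * q * n * m') := by
    refine hLqq.trans (Nat.le_mul_of_pos_right _ ?_)
    positivity
  have h3 : q * q * L * (4 ^ q * q * n * m') ≤ 2 ^ (5 * q) * (n * m') * L := by
    have hq2 : q ≤ 2 ^ q := Nat.lt_two_pow_self.le
    calc q * q * L * (4 ^ q * q * n * m') = q * q * q * 4 ^ q * (n * m') * L := by ring
      _ ≤ 2 ^ q * 2 ^ q * 2 ^ q * 4 ^ q * (n * m') * L := by gcongr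
      _ = _ := by
        rw [show 4 = 2 ^ 2 by norm_num, ← pow_mul, ← pow_add, ← pow_add, ← pow_add]
        congr 3
        ring
  have h4 : 2 ^ 19 * 2 ^ (5 * q) ≤ 2 ^ (24 * q) := by
    rw [← pow_add]
    exact Nat.pow_le_pow_right (by norm_num) (by omega)
  calc _ ≤ 140 * (q * q * L) * (2048 * (4 ^ q * q * n * m')) +
        (25 + 2 * (4 + (4 * q + 3 + lw) + Nat.log 2 C + 11)) * 11 :=
        Nat.add_le_add_right (Nat.mul_le_mul h1 hs) _
    _ = 286720 * (q * q * L * (4 ^ q * q * n * m')) +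
        (25 + 2 * (4 + (4 * q + 3 + lw) + Nat.log 2 C + 11)) * 11 := by ring
    _ ≤ 2 ^ 19 * (2 ^ (5 * q) * (n * m') * L) + 24 * Nat.log 2 C := by omega
    _ = 2 ^ 19 * 2 ^ (5 * q) * (n * m') * L + 24 * Nat.log 2 C := by ring
    _ ≤ _ := by gcongr

variable {D : Net} {om M : ℕ → ℕ} {k C W r : ℕ}

/-- The program halts with the right answer and within the time bound, if the input is in the
memory. -/
theorem exec_solver (H : Holds D om k C M) (hn : 1 ≤ D.n) (hm : D.m2 ≤ 2 * D.n ^ 2)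
    (hW : ∀ v < D.n, om v ≤ W)
    (hr : ∀ ell, (∃ A, D.Sol A ∧ A.card = ell) → (∀ A, D.Sol A → ell ≤ A.card) → k - ell ≤ r)
    (τ : ℕ → Bool) : ∃ t s, ∃ b : Bool, Exec D.n.size τ solver ⟨fun _ => 0, M, 0⟩ t s ∧
      t ≤ 2 ^ (24 * (D.p + r)) * (D.n * max 1 (M 1)) * max 1 (Nat.log 2 W) + 24 * Nat.log 2 C ∧
      s.reg 0 = b.toNat ∧ (b = true ↔ ∃ A, D.YesSet om k C A) := by
  have hp := D.p_pos
  set q := D.p + r with hq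
  set K := runPar D q W hn with hK
  have hw : 1 ≤ D.n.size := Nat.size_pos.2 hn
  have hb := le_smallBound D.n q
  have hKb : K.b = smallBound D.n q := rfl
  have hKB : K.B = largeBound D.n q W := rfl
  have h4q : 1 ≤ 4 ^ q := Nat.one_le_pow _ _ (by norm_num)
  have hnb : 16 * (D.n + 1) ≤ K.b := by
    have : 16 * 1 * (D.n + 1) ≤ 16 * 4 ^ q * (D.n + 1) := by gcongr
    omega
  have hpow : 4 ^ q ≤ K.b := by
    have : 4 ^ q * 1 ≤ 4 ^ q * (16 * (D.n + 1)) := by gcongr; omega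
    have e : 16 * 4 ^ q * (D.n + 1) = 4 ^ q * (16 * (D.n + 1)) := by ring
    omega
  have h2p : 2 ^ D.p ≤ 4 ^ q := by
    rw [show 4 = 2 ^ 2 by norm_num, ← pow_mul]
    exact Nat.pow_le_pow_right (by norm_num) (by omega)
  have hpb : 2 ^ D.p * D.n ≤ K.b := by
    calc 2 ^ D.p * D.n ≤ 4 ^ q * (16 * (D.n + 1)) := Nat.mul_le_mul h2p (by omega)
      _ = 16 * 4 ^ q * (D.n + 1) := by ring
      _ ≤ _ := hb
  have hmb : D.m2 ≤ K.b := by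
    refine hm.trans ?_
    rw [hKb, smallBound, pow_add]
    exact Nat.mul_le_mul (by omega) (Nat.pow_le_pow_left (Nat.le_succ _) 2)
  have hpp : D.p < 2 ^ D.p := Nat.lt_two_pow_self
  have hqq : q < 4 ^ q := Nat.lt_pow_self (by norm_num)
  have h8 := K.eight_mul_le
  have hnW : D.n * W ≤ K.B := by
    have : D.n ≤ K.b * K.b := by
      have := Nat.le_mul_self K.b
      omega
    exact Nat.mul_le_mul this (Nat.le_succ W)
  have hWB : W ≤ K.B := (Nat.le_mul_of_pos_left _ hn).trans hnW
  have hsum : ∑ v ∈ Finset.range D.n, om v ≤ K.B := by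
    refine (Finset.sum_le_card_nsmul _ _ W fun v hv => hW v (Finset.mem_range.1 hv)).trans ?_
    simpa using hnW
  have R : Roomy K D om :=
    { readable := fun a h3 h4 => ⟨h4, fun h => absurd h h3⟩
      β1 := le_rfl
      β2 := le_rfl
      β3 := le_rfl
      β10 := le_rfl
      β15 := le_rfl
      n_le := by omega
      m2_le := hmb
      pow_le := h2p.trans hpow
      addr_le := by omega
      cost_le := hsum }
  -- if the terminals can be connected, there is a smallest solution
  have hmin : (∃ A, D.Sol A) → ∃ ell ≤ D.n, k - ell ≤ r := by
    intro h
    obtain ⟨A, hA, hle⟩ : ∃ A, D.Sol A ∧ ∀ B, D.Sol B → A.card ≤ B.card := by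
      classical
      have h' : ∃ c A, D.Sol A ∧ A.card = c := ⟨_, _, h.choose_spec, rfl⟩
      obtain ⟨A, hA, hc⟩ := Nat.find_spec h'
      exact ⟨A, hA, fun B hB => hc ▸ Nat.find_min' h' ⟨B, hB, rfl⟩⟩
    exact ⟨A.card, by simpa using Finset.card_le_card hA.1, hr _ ⟨A, hA, rfl⟩ hle⟩
  have hMB : ∀ a, K.X a → M a ≤ K.B := by
    intro a ha
    have hHm := H.m
    by_cases h0 : a = 0
    · rw [h0, H.n]; omega
    by_cases h1 : a = 1
    · rw [h1]; omega
    by_cases h2 : a = 2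
    · rw [h2, H.p]; omega
    by_cases h3 : a = 3
    · obtain ⟨ell, hell, hle⟩ := hmin (ha.2 h3)
      rw [h3, H.k]; omega
    have h4 : a ≠ 4 := ha.1
    by_cases h5 : a < 5 + D.n
    · obtain ⟨v, rfl⟩ := Nat.exists_eq_add_of_le (show 5 ≤ a by omega)
      rw [H.cost v (by omega)]
      exact (hW v (by omega)).trans hWB
    by_cases h6 : a < 5 + D.n + D.m2
    · obtain ⟨j, rfl⟩ := Nat.exists_eq_add_of_le (show 5 + D.n ≤ a by omega)
      have := D.src_lt j (by omega)
      rw [H.src j (by omega)]; omega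
    by_cases h7 : a < 5 + D.n + D.m2 + D.p
    · obtain ⟨i, rfl⟩ := Nat.exists_eq_add_of_le (show 5 + D.n + D.m2 ≤ a by omega)
      have := D.ter_lt i (by omega)
      rw [H.ter i (by omega)]; omega
    rw [H.rest a (by omega)]; omega
  -- the three parts of the run
  obtain ⟨t₁, s₁, σ₁, hx₁, ht₁, hr₁, hb₁, hP⟩ := exec_of_wp τ (wp_prepCmd R H (σ := ⟨fun _ => 0, M⟩)
    rfl rfl) ⟨fun _ => Nat.zero_le _, hMB⟩ (s := ⟨fun _ => 0, M, 0⟩) ⟨fun _ _ => rfl, rfl⟩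
  have hm4 : σ₁.mem 4 = C := by rw [hP.mem 4 (by omega), H.C]
  set S := ∑ v ∈ Finset.range D.n, om v with hS
  obtain ⟨t₂, s₂, σ₂, hx₂, ht₂, hr₂, -, hQ⟩ := exec_of_wp (K := capPar D.n.size K.B C) τ (c := capCmd)
    (Q := fun σ => σ = σ₁.set 11 (min C S)) (σ := σ₁) (by
      simp only [capCmd, wp_ite, wp_set, wp_skip, ok_sub, ok_var, ok_mem, ok_num, val_sub, val_var,
        val_mem, val_num, hm4, hP.v11]
      refine ⟨⟨by norm_num, by norm_num, rfl⟩, fun h => ⟨by norm_num, ⟨by norm_num, rfl⟩, ?_⟩,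
        fun h => ?_⟩
      · rw [min_eq_left (by omega)]
      · rw [min_eq_right (by omega), show S = σ₁.var 11 from hP.v11.symm]
        simp [Store.set])
    ⟨fun i => (hb₁.1 i).trans (by change K.B ≤ K.B + C + 64; omega), fun a ha => by
      obtain rfl : a = 4 := ha
      rw [hm4]; change C ≤ K.B + C + 64; omega⟩ hr₁
  subst hQ
  obtain ⟨t₃, s₃, σ₃, hx₃, ht₃, hr₃, -, b, h0, hiff⟩ := exec_of_wp τ
    ((hP.layout (x := min C S) R H).wp_mainCmd (k := k) ⟨fun _ _ => rfl, fun _ _ => rfl⟩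
      (by simp [hP.v0]) (by rw [Store.set_mem, hP.mem 3 (by omega), H.k]) fun ell h h' => by
        have hle : k - ell + D.p ≤ q := by have := hr ell h h'; omega
        have hle' : 4 ^ (k - ell + D.p) ≤ 4 ^ q := Nat.pow_le_pow_right (by norm_num) hle
        exact ⟨⟨by norm_num, fun _ => h.imp fun _ h => h.1⟩, hle'.trans hpow, hle', hle⟩)
    ⟨fun i => by
      rw [Store.set_var]
      split_ifs
      exacts [(min_le_right _ _).trans hsum, hb₁.1 i], hb₁.2⟩ hr₂
  refine ⟨_, s₃, b, .seq hx₁ (.seq hx₂ hx₃), ?_, by rw [hr₃.1 0 (by norm_num), h0], ?_⟩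
  · have hsteps := steps_le (n := D.n) (m2 := D.m2) (m' := max 1 (M 1)) (p := D.p) (q := q) hn
      (by have := H.m; omega) (le_max_left _ _) (by omega) (by omega)
    refine le_trans ?_ (total_time_le (W := W) (C := C) hn (le_max_left _ _) (by omega) hsteps)
    have hcap : t₂ ≤ (25 + 2 * (4 + (4 * q + 3 + Nat.log 2 W) + Nat.log 2 C + 11)) * 11 := by
      refine ht₂.trans (Nat.mul_le_mul ?_ le_rfl)
      have h1 := words_cap_le (x := K.B) (C := C) (a := 4) (d := 4 * q + 3 + Nat.log 2 W) hw
        ((largeBound_le D.n q W).trans (Nat.pow_le_pow_right (by norm_num) (by omega)))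
      have h2 : words D.n.size 8 ≤ 5 :=
        Nat.succ_le_succ ((Nat.div_le_self _ _).trans (by decide))
      have h3 := Nat.mul_le_mul h2 h2
      change words D.n.size 8 * words D.n.size 8 + 2 * words D.n.size (K.B + C + 64) ≤ _
      omega
    rw [Nat.mul_add]
    change t₁ ≤ ((2 * q + 8) * (2 * q + 8) + 2 * (4 * q + 15 + Nat.log 2 W)) * _ at ht₁
    change t₃ ≤ ((2 * q + 8) * (2 * q + 8) + 2 * (4 * q + 15 + Nat.log 2 W)) * _ at ht₃
    exact (by omega : t₁ + (t₂ + t₃) = t₁ + t₃ + t₂).trans_le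
      (Nat.add_le_add (Nat.add_le_add ht₁ ht₃) hcap)
  · rw [hiff]
    simp only [Store.set_var, reduceIte]
    exact exists_congr fun A => Net.yesSet_min

end

/-! ### The input of the program -/

/-- The list of the pairs, flattened, has the first components in the even positions and the second
components in the odd positions. -/
theorem getD_flatMap_pair {α : Type*} (f g : α → ℕ) (l : List α) {i : ℕ} (hi : i < l.length) :
    (l.flatMap fun e => [f e, g e]).getD (2 * i) 0 = f l[i] ∧
      (l.flatMap fun e => [f e, g e]).getD (2 * i + 1) 0 = g l[i] := by
  induction l generalizing i with
  | nil => simp at hi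
  | cons e l ih =>
    cases i with
    | zero => simp
    | succ i => simpa [Nat.mul_add] using ih (i := i) (by simpa using hi)

namespace Presentation

variable {I : Instance} (E : Presentation I)

/-- The number in the memory cell `a`. -/
def cell (a : ℕ) : ℕ := E.input.getD a 0

theorem length_input :
    E.input.length = 5 + I.n + 2 * E.edges.length + E.terminals.length := by
  simp [input]
  omega

theorem cell_cost (v : Fin I.n) : E.cell (5 + v) = I.ω v := by
  unfold cell input
  rw [List.getD_append _ _ _ _ (by simp; omega), List.getD_append _ _ _ _ (by simp; omega),
    List.getD_append_right _ _ _ _ (by simp)]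
  simp

theorem cell_edge {i : ℕ} (hi : i < E.edges.length) :
    E.cell (5 + I.n + 2 * i) = E.edges[i].1 ∧ E.cell (5 + I.n + (2 * i + 1)) = E.edges[i].2 := by
  have h := getD_flatMap_pair (fun e : Fin I.n × Fin I.n => (e.1 : ℕ)) (fun e => (e.2 : ℕ)) E.edges hi
  unfold cell input
  constructor
  · rw [List.getD_append _ _ _ _ (by simp; omega),
      List.getD_append_right _ _ _ _ (by simp; omega), ← h.1]
    congr 1
    simp
    omega
  · rw [List.getD_append _ _ _ _ (by simp; omega),
      List.getD_append_right _ _ _ _ (by simp; omega), ← h.2]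
    congr 1
    simp
    omega

theorem cell_terminal {i : ℕ} (hi : i < E.terminals.length) :
    E.cell (5 + I.n + 2 * E.edges.length + i) = E.terminals[i] := by
  unfold cell input
  rw [List.getD_append_right _ _ _ _ (by simp; omega)]
  have e : 5 + I.n + 2 * E.edges.length + i - ([I.n, E.edges.length, E.terminals.length, I.k, I.C] ++
      List.ofFn I.ω ++ E.edges.flatMap fun e => [(e.1 : ℕ), (e.2 : ℕ)]).length = i := by
    simp
    omega
  rw [e]
  -- the list of the terminals enters the input through a monadic coercion to a list of numbers
  simp only [List.bind_eq_flatMap, List.pure_def, ← List.map_eq_flatMap, List.map_id']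
  rw [List.getD_eq_getElem _ _ (by rwa [List.length_map]), List.getElem_map]

theorem cell_rest {a : ℕ} (ha : 5 + I.n + 2 * E.edges.length + E.terminals.length ≤ a) :
    E.cell a = 0 :=
  List.getD_eq_default _ _ (by rw [length_input]; exact ha)

/-- The position `4 (j / 2) + 1 - j` belongs to the same edge as the position `j`, and to its other
end. -/
theorem exists_edge {j : ℕ} (hj : j < 2 * E.edges.length) : ∃ i < E.edges.length,
    (j = 2 * i ∧ 4 * (j / 2) + 1 - j = 2 * i + 1) ∨ (j = 2 * i + 1 ∧ 4 * (j / 2) + 1 - j = 2 * i) :=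
  ⟨j / 2, by omega, by omega⟩

theorem terminals_length : E.terminals.length = I.p := by
  rw [← List.toFinset_card_of_nodup E.terminals_nodup, Instance.p]
  congr 1
  ext v
  simp [E.mem_terminals]

theorem edges_length : E.edges.length = I.m := by
  have h : I.G.edgeSet = ((E.edges.map fun e => s(e.1, e.2)).toFinset : Set (Sym2 (Fin I.n))) := by
    ext e
    induction e with
    | _ u v => rw [SimpleGraph.mem_edgeSet, ← E.mem_edges, List.coe_toFinset]; rfl
  rw [Instance.m, h, Set.ncard_coe_finset, List.toFinset_card_of_nodup E.edges_nodup,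
    List.length_map]

theorem edges_length_le : E.edges.length ≤ I.n ^ 2 := by
  have h := (List.Nodup.of_map _ E.edges_nodup).length_le_card
  rw [Fintype.card_prod, Fintype.card_fin] at h
  rwa [pow_two]

/-- The graph and the terminals, as they stand in the memory. -/
def net : Net where
  n := I.n
  m2 := 2 * E.edges.length
  p := E.terminals.length
  src j := E.cell (5 + I.n + j)
  dst j := E.cell (5 + I.n + (4 * (j / 2) + 1 - j))
  ter i := E.cell (5 + I.n + 2 * E.edges.length + i)
  src_lt j hj := by
    obtain ⟨i, hi, ⟨rfl, -⟩ | ⟨rfl, -⟩⟩ := E.exists_edge hj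
    · rw [(E.cell_edge hi).1]; exact Fin.is_lt _
    · rw [(E.cell_edge hi).2]; exact Fin.is_lt _
  dst_lt j hj := by
    obtain ⟨i, hi, ⟨-, h⟩ | ⟨-, h⟩⟩ := E.exists_edge hj
    · rw [h, (E.cell_edge hi).2]; exact Fin.is_lt _
    · rw [h, (E.cell_edge hi).1]; exact Fin.is_lt _
  symm j hj := by
    refine ⟨4 * (j / 2) + 1 - j, by omega, rfl, ?_⟩
    congr 2
    omega
  ter_lt i hi := by rw [E.cell_terminal hi]; exact Fin.is_lt _
  ter_inj i hi i' hi' h := by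
    rw [E.cell_terminal hi, E.cell_terminal hi'] at h
    exact (E.terminals_nodup.getElem_inj_iff).1 (Fin.val_injective h)
  p_pos := by
    rw [E.terminals_length]
    exact I.S_nonempty.card_pos

theorem holds : Holds E.net (fun v => E.cell (5 + v)) I.k I.C E.cell where
  n := rfl
  m := rfl
  p := rfl
  k := rfl
  C := rfl
  cost _ _ := rfl
  src _ _ := rfl
  dst _ _ := rfl
  ter _ _ := rfl
  rest _ h := E.cell_rest h

theorem net_adj (u v : Fin I.n) : E.net.Adj u v ↔ I.G.Adj u v := by
  rw [← E.mem_edges, List.mem_map]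
  constructor
  · rintro ⟨j, hj, hu, hv⟩
    change E.cell (5 + I.n + j) = u at hu
    change E.cell (5 + I.n + (4 * (j / 2) + 1 - j)) = v at hv
    obtain ⟨i, hi, ⟨rfl, h⟩ | ⟨rfl, h⟩⟩ := E.exists_edge hj
    · rw [(E.cell_edge hi).1] at hu
      rw [h, (E.cell_edge hi).2] at hv
      exact ⟨_, List.getElem_mem hi, Sym2.eq_iff.2 (.inl ⟨Fin.ext hu, Fin.ext hv⟩)⟩
    · rw [(E.cell_edge hi).2] at hu
      rw [h, (E.cell_edge hi).1] at hv
      exact ⟨_, List.getElem_mem hi, Sym2.eq_iff.2 (.inr ⟨Fin.ext hv, Fin.ext hu⟩)⟩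
  · rintro ⟨e, he, heq⟩
    obtain ⟨i, hi, rfl⟩ := List.getElem_of_mem he
    have h : E.net.Adj E.edges[i].1 E.edges[i].2 := by
      refine ⟨2 * i, show 2 * i < 2 * E.edges.length by omega, (E.cell_edge hi).1, ?_⟩
      change E.cell (5 + I.n + (4 * (2 * i / 2) + 1 - 2 * i)) = _
      rw [show 4 * (2 * i / 2) + 1 - 2 * i = 2 * i + 1 by omega, (E.cell_edge hi).2]
    rcases Sym2.eq_iff.1 heq with ⟨h1, h2⟩ | ⟨h1, h2⟩
    · rwa [h1, h2] at h
    · rw [h1, h2] at h; exact h.symm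

theorem exists_ter_eq (v : Fin I.n) : (∃ i < E.net.p, E.net.ter i = v) ↔ v ∈ I.S := by
  rw [← E.mem_terminals]
  constructor
  · rintro ⟨i, hi, h⟩
    have h' : E.cell (5 + I.n + 2 * E.edges.length + i) = v := h
    rw [E.cell_terminal hi] at h'
    rw [← Fin.ext h']
    exact List.getElem_mem hi
  · intro hv
    obtain ⟨i, hi, rfl⟩ := List.getElem_of_mem hv
    exact ⟨i, hi, E.cell_terminal hi⟩

/-! ### Subgraphs and sets of vertices -/

open Classical in
/-- A set of vertices of the instance as a set of natural numbers. -/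
noncomputable def vertexSet (U : Set (Fin I.n)) : Finset ℕ :=
  (Finset.univ.filter (· ∈ U)).map Fin.valEmbedding

theorem mem_vertexSet {U : Set (Fin I.n)} {a : ℕ} :
    a ∈ vertexSet U ↔ ∃ h : a < I.n, (⟨a, h⟩ : Fin I.n) ∈ U := by
  simp only [vertexSet, Finset.mem_map, Finset.mem_filter, Finset.mem_univ, true_and,
    Fin.valEmbedding_apply]
  constructor
  · rintro ⟨v, hv, rfl⟩
    exact ⟨v.2, hv⟩
  · rintro ⟨h, hU⟩
    exact ⟨_, hU, rfl⟩

theorem coe_mem_vertexSet {U : Set (Fin I.n)} {v : Fin I.n} : (v : ℕ) ∈ vertexSet U ↔ v ∈ U :=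
  mem_vertexSet.trans ⟨fun ⟨_, h⟩ => h, fun h => ⟨v.2, h⟩⟩

theorem vertexSet_subset (U : Set (Fin I.n)) : vertexSet U ⊆ Finset.range I.n := fun _ ha =>
  Finset.mem_range.2 (mem_vertexSet.1 ha).1

theorem card_vertexSet (U : Set (Fin I.n)) : ((vertexSet U).card : ℕ∞) = U.encard := by
  classical
  rw [vertexSet, Finset.card_map, ← Set.encard_coe_eq_coe_finsetCard]
  congr 1
  ext v
  simp

theorem nbd_vertexSet (U : Set (Fin I.n)) :
    E.net.nbd (vertexSet U) = (I.closedNbhd U).map Fin.valEmbedding := by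
  ext a
  rw [Net.mem_nbd, Finset.mem_map]
  simp only [Instance.closedNbhd, Finset.mem_filter, Finset.mem_univ, true_and,
    Fin.valEmbedding_apply]
  constructor
  · rintro ⟨ha, h⟩
    refine ⟨⟨a, ha⟩, h.imp (fun h => coe_mem_vertexSet.1 h) ?_, rfl⟩
    rintro ⟨u, hu, hua⟩
    obtain ⟨hu', hU⟩ := mem_vertexSet.1 hu
    exact ⟨⟨u, hu'⟩, hU, (E.net_adj ⟨u, hu'⟩ ⟨a, ha⟩).1 hua⟩
  · rintro ⟨v, h, rfl⟩
    exact ⟨v.2, h.imp coe_mem_vertexSet.2 fun ⟨u, hu, huv⟩ =>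
      ⟨u, coe_mem_vertexSet.2 hu, (E.net_adj u v).2 huv⟩⟩

theorem con_of_connected {T : I.G.Subgraph} (hT : T.Connected) {v : Fin I.n} (hv : v ∈ T.verts) :
    E.net.Con (vertexSet T.verts) v := by
  refine ⟨coe_mem_vertexSet.2 hv, fun B hB hcl w hw => ?_⟩
  obtain ⟨hw', hwT⟩ := mem_vertexSet.1 hw
  have h := hT.preconnected ⟨v, hv⟩ ⟨⟨w, hw'⟩, hwT⟩
  rw [SimpleGraph.reachable_iff_reflTransGen] at h
  have main : ∀ x : T.verts, Relation.ReflTransGen T.coe.Adj ⟨v, hv⟩ x → ((x : Fin I.n) : ℕ) ∈ B := by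
    intro x hx
    induction hx with
    | refl => exact hB
    | @tail y z _ hyz ih =>
      exact hcl _ ih (coe_mem_vertexSet.2 y.2) _ (coe_mem_vertexSet.2 z.2)
        ((E.net_adj _ _).2 (T.adj_sub hyz))
  exact main _ h

theorem connected_of_con {U : Set (Fin I.n)} {v : ℕ} (h : E.net.Con (vertexSet U) v) :
    ((⊤ : I.G.Subgraph).induce U).Connected := by
  obtain ⟨hv, hvU⟩ := mem_vertexSet.1 h.1
  set T := (⊤ : I.G.Subgraph).induce U
  have main : ∀ w (hw : w ∈ U), T.coe.Reachable ⟨⟨v, hv⟩, hvU⟩ ⟨w, hw⟩ := by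
    intro w hw
    have := h.2 {a | ∃ (ha : a < I.n) (haU : (⟨a, ha⟩ : Fin I.n) ∈ U),
      T.coe.Reachable ⟨⟨v, hv⟩, hvU⟩ ⟨⟨a, ha⟩, haU⟩} ⟨hv, hvU, .refl _⟩ ?_ w (coe_mem_vertexSet.2 hw)
    · exact this.2.2
    · rintro a ⟨ha, haU, hr⟩ - b hb hab
      obtain ⟨hb', hbU⟩ := mem_vertexSet.1 hb
      refine ⟨hb', hbU, hr.trans (SimpleGraph.Adj.reachable ?_)⟩
      have hG := (E.net_adj ⟨a, ha⟩ ⟨b, hb'⟩).1 hab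
      exact ⟨haU, hbU, hG⟩
  rw [SimpleGraph.Subgraph.connected_iff]
  exact ⟨⟨fun x y => (main x x.2).symm.trans (main y y.2)⟩, ⟨_, hvU⟩⟩

theorem sol_of_connects {T : I.G.Subgraph} (hT : I.Connects T) :
    E.net.Sol (vertexSet T.verts) := by
  have hter : ∀ i < E.net.p, ∃ h : E.net.ter i < I.n, (⟨E.net.ter i, h⟩ : Fin I.n) ∈ T.verts := by
    intro i hi
    have h := E.net.ter_lt i hi
    exact ⟨h, hT.2 ((E.exists_ter_eq ⟨_, h⟩).1 ⟨i, hi, rfl⟩)⟩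
  obtain ⟨h0, h0T⟩ := hter 0 E.net.p_pos
  exact ⟨vertexSet_subset _, E.con_of_connected hT.1 h0T, fun i hi => mem_vertexSet.2 (hter i hi)⟩

theorem exists_connects {A : Finset ℕ} (hA : E.net.Sol A) :
    ∃ T : I.G.Subgraph, I.Connects T ∧ vertexSet T.verts = A := by
  have e : vertexSet {v : Fin I.n | (v : ℕ) ∈ A} = A := by
    ext a
    rw [mem_vertexSet]
    exact ⟨fun ⟨_, h⟩ => h, fun h => ⟨Finset.mem_range.1 (hA.1 h), h⟩⟩
  refine ⟨(⊤ : I.G.Subgraph).induce {v : Fin I.n | (v : ℕ) ∈ A}, ⟨?_, fun v hv => ?_⟩, e⟩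
  · exact E.connected_of_con (v := E.net.ter 0) (by rw [e]; exact hA.2.1)
  · obtain ⟨i, hi, h⟩ := (E.exists_ter_eq v).2 hv
    change (v : ℕ) ∈ A
    rw [← h]
    exact hA.2.2 i hi

/-- The instance is a yes-instance if and only if a set of vertices of its net is a solution. -/
theorem exists_yesSet_iff : (∃ A, E.net.YesSet (fun v => E.cell (5 + v)) I.k I.C A) ↔ I.IsYes := by
  have key : ∀ U : Set (Fin I.n), (E.net.nbd (vertexSet U)).card = (I.closedNbhd U).card ∧
      ∑ v ∈ E.net.nbd (vertexSet U), E.cell (5 + v) = ∑ v ∈ I.closedNbhd U, I.ω v := by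
    intro U
    rw [nbd_vertexSet, Finset.card_map, Finset.sum_map]
    exact ⟨rfl, Finset.sum_congr rfl fun v _ => E.cell_cost v⟩
  constructor
  · rintro ⟨A, hA, hk, hC⟩
    obtain ⟨T, hT, rfl⟩ := E.exists_connects hA
    rw [(key _).1] at hk
    rw [(key _).2] at hC
    exact ⟨T, hT, hk, hC⟩
  · rintro ⟨T, hT, hk, hC⟩
    exact ⟨_, E.sol_of_connects hT, (key _).1.trans_le hk, (key _).2.trans_le hC⟩

/-- The difference that the program computes is the parameter `r`, if the terminals can be
connected. -/
theorem sub_eq_r {ell : ℕ} (h : ∃ A, E.net.Sol A ∧ A.card = ell)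
    (hmin : ∀ A, E.net.Sol A → ell ≤ A.card) : I.k - ell = I.r := by
  have hell : I.ell = ell := by
    refine le_antisymm ?_ (le_iInf₂ fun T hT => ?_)
    · obtain ⟨A, hA, rfl⟩ := h
      obtain ⟨T, hT, rfl⟩ := E.exists_connects hA
      rw [card_vertexSet]
      exact iInf₂_le T hT
    · rw [← card_vertexSet]
      exact_mod_cast hmin _ (E.sol_of_connects hT)
  rw [Instance.r, hell, ← ENat.natCast_sub, ENat.toNat_natCast]

/-! ### The algorithm and its time in terms of the instance -/

theorem size_le_length {x : ℕ} (h : x ∈ E.input) : x.size ≤ E.length :=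
  (Nat.le_succ _).trans (List.le_sum_of_mem (List.mem_map_of_mem (f := fun x => x.size + 1) h))

theorem input_length_le : E.input.length ≤ E.length := by
  have := List.length_le_sum_of_one_le (E.input.map fun x => x.size + 1) (by simp)
  rwa [List.length_map] at this

end Presentation

theorem log_le_size (x : ℕ) : Nat.log 2 x ≤ x.size := by
  rcases Nat.eq_zero_or_pos x with rfl | h
  · simp
  · exact (Nat.log_lt_of_lt_pow h.ne' (Nat.lt_size_self x)).le

/-- The running time in terms of the instance. -/
noncomputable def solverTime (I : Instance) : ℕ :=
  2 ^ (24 * (I.p + I.r)) * (I.n * max 1 I.m) * max 1 (Nat.log 2 I.W) + 24 * Nat.log 2 I.C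

theorem Instance.n_pos (I : Instance) : 1 ≤ I.n :=
  (Nat.zero_le _).trans_lt I.S_nonempty.choose.2

theorem Answers.mono {P : Prog} {I : Instance} {E : Presentation I} {τ : ℕ → Bool} {T T' : ℕ}
    {b : Bool} (h : Answers P E τ T b) (hT : T ≤ T') : Answers P E τ T' b := by
  obtain ⟨t, s, hx, ht, h0⟩ := h
  exact ⟨t, s, hx, ht.trans hT, h0⟩

/-- The program solves the problem within the time bound, whatever the coins are. -/
theorem Presentation.answers_solver {I : Instance} (E : Presentation I) (τ : ℕ → Bool) :
    ∃ b, Answers solver E τ (solverTime I) b ∧ (b = true ↔ I.IsYes) := by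
  obtain ⟨t, s, b, hx, ht, h0, hb⟩ := exec_solver (W := I.W) (r := I.r) E.holds I.n_pos
    (Nat.mul_le_mul_left 2 E.edges_length_le)
    (fun v hv => (E.cell_cost ⟨v, hv⟩).trans_le (Finset.le_sup (Finset.mem_univ _)))
    (fun ell h h' => (E.sub_eq_r h h').le) τ
  refine ⟨b, ⟨t, s, hx, ?_, h0⟩, hb.trans E.exists_yesSet_iff⟩
  have h1 : E.net.p = I.p := E.terminals_length
  have h2 : E.cell 1 = I.m := E.edges_length
  rwa [h1, h2] at ht

/-- The running time is bounded by a power of the input length, up to a function of the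
parameter. -/
theorem Presentation.solverTime_le {I : Instance} (E : Presentation I) :
    solverTime I ≤ (2 ^ (24 * (I.p + I.r)) + 24) * E.length ^ 3 := by
  have hlen := E.length_input
  have hle := E.input_length_le
  rw [E.edges_length] at hlen
  have hC : Nat.log 2 I.C ≤ E.length :=
    (log_le_size _).trans (E.size_le_length (by simp [Presentation.input]))
  have hW : Nat.log 2 I.W ≤ E.length := by
    have : Nonempty (Fin I.n) := ⟨I.S_nonempty.choose⟩
    obtain ⟨v, -, hv⟩ := Finset.exists_mem_eq_sup Finset.univ Finset.univ_nonempty I.ω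
    refine (log_le_size _).trans (E.size_le_length ?_)
    rw [Instance.W, hv]
    simp [Presentation.input]
  have h1 : 1 ≤ E.length := by omega
  have h2 : I.n ≤ E.length := by omega
  have h3 : max 1 I.m ≤ E.length := by omega
  have h4 : max 1 (Nat.log 2 I.W) ≤ E.length := by omega
  have h5 : E.length ≤ E.length ^ 3 := Nat.le_self_pow (by norm_num) _
  calc solverTime I ≤ 2 ^ (24 * (I.p + I.r)) * (E.length * E.length) * E.length + 24 * E.length ^ 3 := by
        unfold solverTime
        gcongr
        omega
    _ = _ := by ring

instance : IsProbabilityMeasure coins := by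
  unfold coins
  infer_instance

end Secluded

theorem theorem5 :
    -- fixed-parameter tractability for the parameter `p + r`
    (∃ (P : Secluded.Prog) (f : ℕ → ℕ) (d : ℕ), Secluded.SolvesDet P fun I E =>
      f (I.p + I.r) * E.length ^ d) ∧
    -- the true-biased Monte Carlo algorithm
    (∃ (P : Secluded.Prog) (c : ℕ), Secluded.SolvesMonteCarlo P fun I _ =>
      2 ^ (c * (I.p + I.r)) * (I.n * max 1 I.m) * max 1 (Nat.log 2 I.W)
        + c * Nat.log 2 I.C) ∧
    -- the deterministic algorithm
    (∃ (P : Secluded.Prog) (c : ℕ), Secluded.SolvesDet P fun I _ =>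
      2 ^ (c * (I.p + I.r)) * (I.n * max 1 I.m) * max 1 (Nat.log 2 I.n) * max 1 (Nat.log 2 I.W)
        + c * Nat.log 2 I.C) := by
  refine ⟨⟨Secluded.solver, fun x => 2 ^ (24 * x) + 24, 3, Secluded.coinFree_solver, fun I E τ => ?_⟩,
    ⟨Secluded.solver, 24, fun I E => ⟨fun τ => ?_, fun hyes => ?_⟩⟩,
    ⟨Secluded.solver, 24, Secluded.coinFree_solver, fun I E τ => ?_⟩⟩
  · obtain ⟨b, h, hb⟩ := E.answers_solver τ
    exact ⟨b, h.mono E.solverTime_le, hb⟩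
  · obtain ⟨b, h, hb⟩ := E.answers_solver τ
    exact ⟨b, h, hb.1⟩
  · -- the program tosses no coins, so that the right answer is certain
    have huniv : {τ | Secluded.Answers Secluded.solver E τ (Secluded.solverTime I) true} = Set.univ := by
      refine Set.eq_univ_of_forall fun τ => ?_
      obtain ⟨b, h, hb⟩ := E.answers_solver τ
      rwa [hb.2 hyes] at h
    refine le_of_le_of_eq ?_ (huniv ▸ measure_univ).symm
    exact ENNReal.ofReal_le_one.2 (by linarith [Real.exp_pos (-1)])
  · obtain ⟨b, h, hb⟩ := E.answers_solver τ
    refine ⟨b, h.mono ?_, hb⟩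
    unfold Secluded.solverTime
    exact Nat.add_le_add_right (Nat.mul_le_mul_right _ (Nat.le_mul_of_pos_right _
      (lt_max_of_lt_left Nat.one_pos))) _
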